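/- Let $\Omega=(-\pi,\pi)\subset\mathbb R$, $0<\alpha<2$, and let $H_0^{\alpha/2}(\Omega)$ be the space of all $u\in L^2(\Omega)$ whose extension by zero to $\mathbb R$ (again denoted $u$) satisfies $$\|u\|_{H_0^{\alpha/2}}^2:=\|u\|_{L^2(\Omega)}^2+\int_{\mathbb R}\int_{\mathbb R}\frac{|u(x)-u(y)|^2}{|x-y|^{1+\alpha}}\,dy\,dx<\infty .$$ For $\varphi\in C_c^\infty(\mathbb R)$ let $$(-\Delta)^{\alpha/2}\varphi(x)=\frac{\alpha}{2^{1-\alpha}\pi^{1/2}}\,\frac{\Gamma(\frac{1+\alpha}{2})}{\Gamma(1-\frac{\alpha}{2})}\;\lim_{\epsilon\downarrow0}\int_{|x-y|\ge\epsilon}\frac{\varphi(x)-\varphi(y)}{|x-y|^{1+\alpha}}\,dy .$$ Let $A_\alpha=-(-\Delta)^{\alpha/2}$ be the operator in $L^2(\Omega)$ whose domain consists of all $u\in H_0^{\alpha/2}(\Omega)$ for which there is $h\in L^2(\Omega)$ with $\int_\Omega u\,(-\Delta)^{\alpha/2}\varphi\,dx=\int_\Omega h\varphi\,dx$ for all $\varphi\in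 C_c^\infty(\Omega)$, and then $A_\alpha u=-h$. Let $g\in L^2(\Omega)$, and let $f:\mathbb R\to\mathbb R$ satisfy: * the map $u\mapsto f(u)$ takes $H_0^{\alpha/2}(\Omega)$ into $L^2(\Omega)$ and is Lipschitz continuous from each bounded subset of $H_0^{\alpha/2}(\Omega)$ to $L^2(\Omega)$; * there are $p\ge2$ and constants $c_1,c_2,c_3,c_4>0$ with $c_1|s|^p-c_2\le f(s)s\le c_3|s|^p+c_4$ for all $s\in\mathbb R$. Consider the problem $$u_t+(-\Delta)^{\alpha/2}u+f(u)=g\ \text{ in }\Omega,\qquad u=0\ \text{ in }\mathbb R\setminus\Omega,\qquad u(0)=u_0 .$$ For $I=[0,T]$ or $I=[0,\infty)$, a solution on $I$ is a function $u\in C^0(I,H_0^{\alpha/2}(\Omega))$ such that $$u(t)=e^{tA_\alpha}u_0-\int_0^te^{(t-s)A_\alpha}\bigl(f(u(s))-g\bigr)\,ds\qquad(t\in I),$$ where $e^{tA_\alpha}$ is the strongly continuous semigroup on $L^2(\Omega)$ generated by $A_\alpha$. (That $A_\alpha$ generates such a semigroup is part of the claim.) Then: 1. For every $u_0\in H_0^{\alpha/2}(\Omega)$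 there is a solution $u\in C^0([0,\infty),H_0^{\alpha/2}(\Omega))$, and for every $T>0$ each solution on $[0,T]$ with the same initial value coincides with $u$ on $[0,T]$. 2. For every $M\ge0$ there is $K\ge0$ such that every solution on $[0,\infty)$ with $\|u_0\|_{H_0^{\alpha/2}}\le M$ satisfies $\sup_{t\ge0}\|u(t)\|_{H_0^{\alpha/2}}\le K$ (hence also $\sup_{t\ge0}\|u(t)\|_{L^2(\Omega)}\le K$). 3. There is $R\ge0$ such that for every $M\ge0$ there is $t_0\ge0$ such that every solution on $[0,\infty)$ with $\|u_0\|_{H_0^{\alpha/2}}\le M$ satisfies $\|u(t)\|_{H_0^{\alpha/2}}\le R$ for all $t\ge t_0$; that is, there is a bounded absorbing set. -/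

import Mathlib

open Set Filter Topology MeasureTheory
open scoped NNReal ENNReal ContDiff

noncomputable section

/-- The spatial domain `Ω = (-π, π)`. -/
def Omega : Set ℝ := Ioo (-Real.pi) Real.pi

/-- The real Hilbert space `L²(Ω)`. -/
abbrev L2Omega : Type := Lp ℝ 2 (volume.restrict Omega)

/-- The extension of `u ∈ L²(Ω)` to the whole line by `0` outside `Ω`. -/
def zeroExt (u : L2Omega) : ℝ → ℝ := Omega.indicator u

/-- The squared Gagliardo seminorm of order `α / 2` over the whole line of the zero extension
of `u`, namely `∬ |u x - u y|² / |x - y|^(1 + α) dy dx`, with values in `[0, ∞]`. -/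
def gagliardoSq (α : ℝ) (u : L2Omega) : ℝ≥0∞ :=
  ∫⁻ x : ℝ, ∫⁻ y : ℝ, ENNReal.ofReal ((zeroExt u x - zeroExt u y) ^ 2 / |x - y| ^ (1 + α))

/-- The norm of `H₀^{α/2}(Ω)`, extended by `∞` to all of `L²(Ω)`. -/
def eH0Norm (α : ℝ) (u : L2Omega) : ℝ≥0∞ :=
  (‖u‖ₑ ^ 2 + gagliardoSq α u) ^ (1 / 2 : ℝ)

/-- Membership in `H₀^{α/2}(Ω)`: the functions on `Ω` whose extension by `0` lies in
`H^{α/2}(ℝ)`. -/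
def MemH0 (α : ℝ) (u : L2Omega) : Prop := eH0Norm α u < ⊤

/-- The constant `C(n, α)` of the fractional Laplacian, in dimension `n = 1`. -/
def fracLapConst (α : ℝ) : ℝ :=
  α / (2 ^ (1 - α) * Real.pi ^ (1 / 2 : ℝ)) * (Real.Gamma ((1 + α) / 2) / Real.Gamma (1 - α / 2))

/-- The fractional Laplacian `(-Δ)^{α/2} φ` on the line, as a principal value integral.
It is used only for smooth compactly supported `φ`, for which the limit exists. -/
def fracLap (α : ℝ) (φ : ℝ → ℝ) (x : ℝ) : ℝ :=
  fracLapConst α *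
    limUnder (𝓝[>] (0 : ℝ)) fun ε : ℝ =>
      ∫ y in (Metric.ball x ε)ᶜ, (φ x - φ y) / |x - y| ^ (1 + α)

/-- Test functions: smooth with compact support inside `Ω`. -/
def IsTestFunction (φ : ℝ → ℝ) : Prop :=
  ContDiff ℝ ∞ φ ∧ HasCompactSupport φ ∧ tsupport φ ⊆ Omega

/-- The graph of the fractional Laplacian in `L²(Ω)` with the exterior condition `u = 0` on
`ℝ \ Ω`: `u` belongs to the domain and `(-Δ)^{α/2} u = h` when `u ∈ H₀^{α/2}(Ω)` and
`h ∈ L²(Ω)` is the fractional Laplacian of `u` on `Ω` in the sense of distributions. -/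
def HasFracLap (α : ℝ) (u h : L2Omega) : Prop :=
  MemH0 α u ∧ ∀ φ : ℝ → ℝ, IsTestFunction φ →
    ∫ x in Omega, u x * fracLap α φ x = ∫ x in Omega, h x * φ x

/-- `S` is, on `t ≥ 0`, the strongly continuous semigroup `exp (t A_α)` on `L²(Ω)` whose
infinitesimal generator (with its full domain) is `A_α = -(-Δ)^{α/2}`. -/
structure IsFracHeatSemigroup (α : ℝ) (S : ℝ → L2Omega →L[ℝ] L2Omega) : Prop where
  zero : S 0 = ContinuousLinearMap.id ℝ L2Omega
  add : ∀ s t : ℝ, 0 ≤ s → 0 ≤ t → S (s + t) = (S s).comp (S t)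
  continuousOn : ∀ w : L2Omega, ContinuousOn (fun t : ℝ => S t w) (Ici 0)
  generator : ∀ w h : L2Omega,
    Tendsto (fun t : ℝ => t⁻¹ • (S t w - w)) (𝓝[>] 0) (𝓝 h) ↔ HasFracLap α w (-h)

open Classical in
/-- The superposition operator `u ↦ f(u)` into `L²(Ω)` (with value `0` where `f(u)` is not
square integrable). -/
def superpose (f : ℝ → ℝ) (u : L2Omega) : L2Omega :=
  if h : MemLp (fun x => f (u x)) 2 (volume.restrict Omega) then h.toLp _ else 0

/-- `u ↦ f(u)` maps `H₀^{α/2}(Ω)` into `L²(Ω)` and is Lipschitz continuous on bounded sets. -/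
def LipschitzOnBoundedSets (α : ℝ) (f : ℝ → ℝ) : Prop :=
  (∀ u : L2Omega, MemH0 α u → MemLp (fun x => f (u x)) 2 (volume.restrict Omega)) ∧
  ∀ R : ℝ≥0, ∃ L : ℝ≥0, ∀ u v : L2Omega, eH0Norm α u ≤ R → eH0Norm α v ≤ R →
    ‖superpose f u - superpose f v‖ₑ ≤ L * eH0Norm α (u - v)

/-- The growth and dissipativity condition on the nonlinearity. -/
def GrowthCondition (f : ℝ → ℝ) : Prop :=
  ∃ p : ℝ, 2 ≤ p ∧ ∃ c₁ c₂ c₃ c₄ : ℝ, 0 < c₁ ∧ 0 < c₂ ∧ 0 < c₃ ∧ 0 < c₄ ∧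
    ∀ s : ℝ, c₁ * |s| ^ p - c₂ ≤ f s * s ∧ f s * s ≤ c₃ * |s| ^ p + c₄

/-- `u` is a solution in `C⁰(I, H₀^{α/2}(Ω))` of `u_t + (-Δ)^{α/2} u + f(u) = g` in `Ω`,
`u = 0` outside `Ω`, `u(0) = u₀`, in the sense of the variation of constants formula.
The interval `I` is `[0, T]` or `[0, ∞)`. -/
structure IsSolutionOn (α : ℝ) (f : ℝ → ℝ) (g u₀ : L2Omega) (I : Set ℝ) (u : ℝ → L2Omega) :
    Prop where
  mem : ∀ t ∈ I, MemH0 α (u t)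
  continuousOn : ∀ t ∈ I, Tendsto (fun s : ℝ => eH0Norm α (u s - u t)) (𝓝[I] t) (𝓝 0)
  duhamel : ∃ S : ℝ → L2Omega →L[ℝ] L2Omega, IsFracHeatSemigroup α S ∧
    ∀ t ∈ I, u t = S t u₀ - ∫ s in (0 : ℝ)..t, S (t - s) (superpose f (u s) - g)

end

/-! ### Spectral theory of a compact dense embedding of Hilbert spaces. -/

section Spectral

open scoped InnerProductSpace
open Module.End

/-! Let `V = H₀^{α/2}(Ω)`. It is a Hilbert space, compactly and densely embedded in `L²(Ω)`.
Diagonalising the embedding gives an orthonormal basis `e i` of `L²(Ω)` and numbers `ν i ≥ 1` with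
`‖u‖_V² = ∑ ν i ⟨e i, u⟩²`. Integration by parts on test functions, and their density in `V`, show
that `-A_α` is the operator of the form `γ [u, v]`, with `[u, v]` the Gagliardo form and `γ =
fracLapConst α / 2`. Since `‖u‖_V² = ‖u‖² + [u, u]`, its eigenvalues are `γ (ν i - 1)`.
`FracSpectrum` records this outcome; the linear theory uses nothing else. In particular the
semigroup exists, is diagonal, and is determined by its generator.

Every `u` in `V` is `B w` with `w` in `L²(Ω)` and `‖u‖_V = ‖w‖`. For the coefficients of `w` the
equation becomes a family of scalar equations `w_i' = -γ (ν i - 1) w_i + √(ν i) ⟨e i, g - f(B w)⟩`.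
The unbounded factor `√(ν i)` is harmless: the exponential kernel has squared `L²` norm in time of
order `1 / ν i`, so Cauchy-Schwarz bounds the solution in `V` by the source in `L²` of time and
space (`mul_integral_exp_sq_le`). Hence a bounded, globally Lipschitz source has a global solution
by a contraction in an exponentially weighted norm, and Grönwall gives uniqueness. A cutoff reduces
global existence to an a priori bound.

That bound comes from the energy `E(u) = γ/2 [u, u] + ∫ F(u) - ⟨g, u⟩`, `F' = f`. It does not
increase along solutions, and the growth condition makes it coercive in `V`. For the absorbing set,
the growth condition also gives `d/dt ‖u‖² ≤ -2 (E(u) - C) / (k + 1)` with `C` independent of the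
solution. If `E` still exceeded `C + 1` at a late time, it would have done so at all earlier times,
and `‖u‖²` would have become negative.

Mild solutions need not be differentiable in `V`, so both identities are computed on finitely many
modes and passed to the limit; the truncation error is uniform in time because the squared
coefficients have a summable bound independent of time. -/

/-- A compact self-adjoint operator has a Hilbert basis of eigenvectors. -/
theorem exists_hilbertBasis_eigenvectors {X : Type} [NormedAddCommGroup X] [InnerProductSpace ℝ X]
    [CompleteSpace X] (T : X →L[ℝ] X) (hT : IsCompactOperator T)
    (hs : (T : X →ₗ[ℝ] X).IsSymmetric) :
    ∃ (ι : Type) (e : HilbertBasis ι ℝ X) (κ : ι → ℝ), ∀ i, T (e i) = κ i • e i := by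
  have hclosed (μ : ℝ) : IsClosed ((eigenspace (T : X →ₗ[ℝ] X) μ : Submodule ℝ X) : Set X) := by
    have : ((eigenspace (T : X →ₗ[ℝ] X) μ : Submodule ℝ X) : Set X) = {x | T x = μ • x} := by
      ext x; simp
    rw [this]
    exact isClosed_eq T.continuous (continuous_const_smul μ)
  have hcomplete (μ : ℝ) : CompleteSpace (eigenspace (T : X →ₗ[ℝ] X) μ) :=
    (hclosed μ).completeSpace_coe
  -- All real `μ` are used as indices; the zero eigenspaces contribute empty bases.
  choose w b hb using fun μ : ℝ => exists_hilbertBasis ℝ (eigenspace (T : X →ₗ[ℝ] X) μ)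
  have hO := hs.orthogonalFamily_eigenspaces.orthonormal_sigma_orthonormal
    (v_family := fun μ => (b μ)) (fun μ => (b μ).orthonormal)
  have hbot : (Submodule.span ℝ (Set.range fun a : (Σ μ : ℝ, w μ) =>
      (eigenspace (T : X →ₗ[ℝ] X) a.1).subtypeₗᵢ (b a.1 a.2)))ᗮ = ⊥ := by
    rw [← ContinuousLinearMap.orthogonalComplement_iSup_eigenspaces_eq_bot (T := T) hT hs,
      eq_comm, ← Submodule.iInf_orthogonal]
    refine le_antisymm ?_ (le_iInf fun μ => ?_)
    · rw [Submodule.iInf_orthogonal]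
      refine Submodule.orthogonal_le (Submodule.span_le.2 ?_)
      rintro _ ⟨a, rfl⟩
      exact Submodule.mem_iSup_of_mem a.1 (b a.1 a.2).2
    · intro x hx
      rw [Submodule.mem_orthogonal]
      intro y hy
      have h0 := (b μ).hasSum_repr ⟨y, hy⟩
      have h1 := ((innerSL ℝ x).comp (eigenspace (T : X →ₗ[ℝ] X) μ).subtypeL).hasSum h0
      have h2 : (fun i => ((innerSL ℝ x).comp (eigenspace (T : X →ₗ[ℝ] X) μ).subtypeL)
          ((b μ).repr ⟨y, hy⟩ i • b μ i)) = fun _ => 0 := by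
        funext i
        have : ⟪x, ((b μ i : eigenspace (T : X →ₗ[ℝ] X) μ) : X)⟫_ℝ = 0 := by
          rw [real_inner_comm]
          exact (Submodule.mem_orthogonal _ _).1 hx _ (Submodule.subset_span ⟨⟨μ, i⟩, rfl⟩)
        simp [this]
      have h3 : HasSum (fun _ : w μ => (0 : ℝ)) ⟪x, y⟫_ℝ := by
        rw [← h2]; simpa using h1
      rw [real_inner_comm]
      exact h3.unique hasSum_zero
  refine ⟨_, HilbertBasis.mkOfOrthogonalEqBot hO hbot, fun a => a.1, fun a => ?_⟩
  rw [HilbertBasis.coe_mkOfOrthogonalEqBot]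
  exact mem_eigenspace_iff.1 (b a.1 a.2).2

/-- Simultaneous diagonalisation of a compact dense embedding `V → X` of Hilbert spaces. -/
theorem exists_hilbertBasis_of_compact_embedding {X V : Type}
    [NormedAddCommGroup X] [InnerProductSpace ℝ X] [CompleteSpace X]
    [NormedAddCommGroup V] [InnerProductSpace ℝ V] [CompleteSpace V]
    (j : V →L[ℝ] X) (hj : IsCompactOperator j)
    (hinj : Function.Injective j) (hdense : ∀ h : X, (∀ v, ⟪h, j v⟫_ℝ = 0) → h = 0)
    (hnorm : ∀ v, ‖j v‖ ≤ ‖v‖) :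
    ∃ (ι : Type) (e : HilbertBasis ι ℝ X) (ν : ι → ℝ) (W : X ≃ₗᵢ[ℝ] V),
      (∀ i, 1 ≤ ν i) ∧ ∀ w i, ⟪e i, j (W w)⟫_ℝ = (√(ν i))⁻¹ * ⟪e i, w⟫_ℝ := by
  set js := ContinuousLinearMap.adjoint j with hjs
  have hadj (x : X) (v : V) : ⟪js x, v⟫_ℝ = ⟪x, j v⟫_ℝ :=
    ContinuousLinearMap.adjoint_inner_left j v x
  -- The operator `j j*` on `X` is compact and symmetric. Its eigenvalues `κ i = ‖j* e i‖²` are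
  -- positive because `j` has dense range and at most `1` because `j` is a contraction; `ν i` will
  -- be `1 / κ i`.
  obtain ⟨ι, e, κ, he⟩ := exists_hilbertBasis_eigenvectors (j.comp js) (hj.comp_clm js) (by
    intro x y
    change ⟪j (js x), y⟫_ℝ = ⟪x, j (js y)⟫_ℝ
    rw [← hadj x, real_inner_comm, ← hadj y, real_inner_comm])
  have he' (i) : j (js (e i)) = κ i • e i := he i
  have hee (i k) : ⟪js (e i), js (e k)⟫_ℝ = κ k * ⟪e i, e k⟫_ℝ := by
    rw [hadj, he', inner_smul_right]
  have hκ (i) : κ i = ‖js (e i)‖ ^ 2 := by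
    have := hee i i
    rw [real_inner_self_eq_norm_sq, real_inner_self_eq_norm_sq, e.orthonormal.1 i] at this
    linarith
  have hpos (i) : 0 < κ i := by
    rw [hκ]
    refine pow_pos (norm_pos_iff.2 fun h => ?_) 2
    have : e i = 0 := hdense _ fun v => by rw [← hadj, h, inner_zero_left]
    have h1 := e.orthonormal.1 i
    rw [this, norm_zero] at h1
    exact zero_ne_one h1
  have hle (i) : κ i ≤ 1 := by
    have h1 : ‖js (e i)‖ ^ 2 ≤ 1 * ‖js (e i)‖ := by
      rw [← real_inner_self_eq_norm_sq, hadj]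
      calc _ ≤ ‖e i‖ * ‖j (js (e i))‖ := real_inner_le_norm _ _
        _ ≤ _ := by rw [e.orthonormal.1 i]; exact mul_le_mul_of_nonneg_left (hnorm _) zero_le_one
    have h2 : ‖js (e i)‖ ≤ 1 := by
      by_contra! h
      nlinarith
    rw [hκ]
    exact pow_le_one₀ (norm_nonneg _) h2
  -- The normalised vectors `j* e i` are an orthonormal basis of `V`, complete because `j` is
  -- injective; `W` carries the basis `e` to it.
  have hO : Orthonormal ℝ fun i => (√(κ i))⁻¹ • js (e i) := by
    constructor
    · intro i
      rw [norm_smul, norm_inv, Real.norm_of_nonneg (Real.sqrt_nonneg _), hκ,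
        Real.sqrt_sq (norm_nonneg _)]
      refine inv_mul_cancel₀ fun h => ?_
      have := hpos i
      rw [hκ, h] at this
      norm_num at this
    · intro i k hik
      change ⟪_, _⟫_ℝ = 0
      rw [inner_smul_left, inner_smul_right, hee, e.orthonormal.2 hik]
      simp
  have hbot : (Submodule.span ℝ (Set.range fun i => (√(κ i))⁻¹ • js (e i)))ᗮ = ⊥ := by
    rw [Submodule.eq_bot_iff]
    intro v hv
    have hz (i) : ⟪e i, j v⟫_ℝ = 0 := by
      have h1 := (Submodule.mem_orthogonal _ _).1 hv _ (Submodule.subset_span ⟨i, rfl⟩)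
      rw [inner_smul_left, hadj] at h1
      refine (mul_eq_zero.1 h1).resolve_left ?_
      simpa using (Real.sqrt_pos.2 (hpos i)).ne'
    have : e.repr (j v) = 0 := by
      ext i
      rw [e.repr_apply_apply, hz]; rfl
    exact hinj (by rw [map_zero]; simpa using this)
  set b := HilbertBasis.mkOfOrthogonalEqBot hO hbot with hb
  have hbi (i) : b i = (√(κ i))⁻¹ • js (e i) := by
    rw [hb, HilbertBasis.coe_mkOfOrthogonalEqBot]
  refine ⟨ι, e, fun i => (κ i)⁻¹, e.repr.trans b.repr.symm, fun i => (one_le_inv₀ (hpos i)).2 (hle i),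
    fun w i => ?_⟩
  set v := (e.repr.trans b.repr.symm) w with hv
  have h1 : ⟪b i, v⟫_ℝ = ⟪e i, w⟫_ℝ := by
    rw [← b.repr_apply_apply, ← e.repr_apply_apply, hv]; simp
  rw [hbi, inner_smul_left, hadj] at h1
  rw [Real.sqrt_inv, inv_inv, ← h1]
  have := (Real.sqrt_pos.2 (hpos i)).ne'
  simp [this]

end Spectral

/-! ### The Hilbert space `H₀^{α/2}(Ω)`. -/

noncomputable section

theorem eLpNorm_two_sq {Y E : Type*} [MeasurableSpace Y] [NormedAddCommGroup E] (μ : Measure Y)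
    (f : Y → E) : eLpNorm f 2 μ ^ 2 = ∫⁻ y, ‖f y‖ₑ ^ 2 ∂μ := by
  have := eLpNorm_nnreal_pow_eq_lintegral (μ := μ) (f := f) (p := 2) (by norm_num)
  norm_num at this
  exact_mod_cast this

theorem lintegral_sq_le {Y : Type*} [MeasurableSpace Y] (μ : Measure Y) {f : Y → ℝ≥0∞}
    (hf : AEMeasurable f μ) : (∫⁻ y, f y ∂μ) ^ 2 ≤ μ univ * ∫⁻ y, f y ^ 2 ∂μ := by
  have h := ENNReal.lintegral_mul_le_Lp_mul_Lq μ Real.HolderConjugate.two_two hf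
    (aemeasurable_const (b := (1 : ℝ≥0∞)))
  simp only [Pi.mul_apply, mul_one, ENNReal.one_rpow, lintegral_const, one_mul] at h
  calc (∫⁻ y, f y ∂μ) ^ 2 ≤ ((∫⁻ y, f y ^ (2 : ℝ) ∂μ) ^ (1 / 2 : ℝ) * μ univ ^ (1 / 2 : ℝ)) ^ 2 := by
        gcongr
    _ = μ univ * ∫⁻ y, f y ^ 2 ∂μ := by
        rw [mul_pow, ← ENNReal.rpow_natCast, ← ENNReal.rpow_natCast, ← ENNReal.rpow_mul,
          ← ENNReal.rpow_mul]
        norm_num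
        rw [mul_comm]

theorem measurableSet_Omega : MeasurableSet Omega := measurableSet_Ioo

theorem measurable_zeroExt (u : L2Omega) : Measurable (zeroExt u) :=
  (Lp.stronglyMeasurable u).measurable.indicator measurableSet_Omega

theorem zeroExt_of_mem (u : L2Omega) {x : ℝ} (hx : x ∈ Omega) : zeroExt u x = u x :=
  indicator_of_mem hx _

theorem zeroExt_of_notMem (u : L2Omega) {x : ℝ} (hx : x ∉ Omega) : zeroExt u x = 0 :=
  indicator_of_notMem hx _

/-- Two functions that agree a.e. on `Ω` and vanish outside `Ω` agree a.e. -/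
theorem ae_eq_of_ae_eq_Omega {v w : ℝ → ℝ} (h : v =ᵐ[volume.restrict Omega] w)
    (hv : ∀ x ∉ Omega, v x = 0) (hw : ∀ x ∉ Omega, w x = 0) : v =ᵐ[volume] w := by
  filter_upwards [(ae_restrict_iff' measurableSet_Omega).1 h] with x hx
  by_cases hm : x ∈ Omega
  · exact hx hm
  · rw [hv x hm, hw x hm]

theorem zeroExt_ae_eq {u : L2Omega} {v : ℝ → ℝ} (h : u =ᵐ[volume.restrict Omega] v)
    (hv : ∀ x ∉ Omega, v x = 0) : zeroExt u =ᵐ[volume] v := by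
  refine ae_eq_of_ae_eq_Omega ?_ (fun x hx => zeroExt_of_notMem u hx) hv
  filter_upwards [h, ae_restrict_mem measurableSet_Omega] with x hx hm
  rw [zeroExt_of_mem u hm, hx]

theorem zeroExt_add (u v : L2Omega) :
    zeroExt (u + v) =ᵐ[volume] fun x => zeroExt u x + zeroExt v x := by
  refine zeroExt_ae_eq ?_ fun x hx => by simp [zeroExt_of_notMem _ hx]
  filter_upwards [Lp.coeFn_add u v, ae_restrict_mem measurableSet_Omega] with x hx hm
  rw [hx, zeroExt_of_mem _ hm, zeroExt_of_mem _ hm]; rfl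

theorem zeroExt_smul (c : ℝ) (u : L2Omega) :
    zeroExt (c • u) =ᵐ[volume] fun x => c * zeroExt u x := by
  refine zeroExt_ae_eq ?_ fun x hx => by simp [zeroExt_of_notMem _ hx]
  filter_upwards [Lp.coeFn_smul c u, ae_restrict_mem measurableSet_Omega] with x hx hm
  rw [hx, zeroExt_of_mem _ hm]; rfl

theorem zeroExt_zero : zeroExt 0 =ᵐ[volume] fun _ => 0 := by
  refine zeroExt_ae_eq ?_ fun x hx => rfl
  exact Lp.coeFn_zero _ _ _

theorem lintegral_zeroExt (u : L2Omega) : ∫⁻ x, ‖zeroExt u x‖ₑ ^ 2 = ‖u‖ₑ ^ 2 := by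
  rw [Lp.enorm_def, eLpNorm_two_sq, ← lintegral_indicator measurableSet_Omega]
  refine lintegral_congr fun x => ?_
  by_cases hm : x ∈ Omega
  · rw [zeroExt_of_mem _ hm, indicator_of_mem hm]
  · rw [zeroExt_of_notMem _ hm, indicator_of_notMem hm]; simp

/-- The weighted difference `(u x - u y) / |x - y|^((1 + α) / 2)`. -/
def diffQuot (α : ℝ) (u : ℝ → ℝ) (p : ℝ × ℝ) : ℝ :=
  (u p.1 - u p.2) * |p.1 - p.2| ^ (-((1 + α) / 2))

/-- The squared Gagliardo seminorm of a function on the line. -/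
def gagSq (α : ℝ) (u : ℝ → ℝ) : ℝ≥0∞ := ∫⁻ p : ℝ × ℝ, ‖diffQuot α u p‖ₑ ^ 2

theorem measurable_diffQuot (α : ℝ) {u : ℝ → ℝ} (hu : Measurable u) :
    Measurable (diffQuot α u) := by
  unfold diffQuot
  fun_prop

theorem diffQuot_congr (α : ℝ) {u v : ℝ → ℝ} (h : u =ᵐ[volume] v) :
    diffQuot α u =ᵐ[volume] diffQuot α v := by
  have h1 := Measure.quasiMeasurePreserving_fst (μ := (volume : Measure ℝ))
    (ν := (volume : Measure ℝ)) |>.ae_eq_comp h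
  have h2 := Measure.quasiMeasurePreserving_snd (μ := (volume : Measure ℝ))
    (ν := (volume : Measure ℝ)) |>.ae_eq_comp h
  filter_upwards [h1, h2] with p hp hp'
  simp only [Function.comp_apply] at hp hp'
  simp only [diffQuot, hp, hp']

theorem gagSq_congr (α : ℝ) {u v : ℝ → ℝ} (h : u =ᵐ[volume] v) : gagSq α u = gagSq α v :=
  lintegral_congr_ae <| (diffQuot_congr α h).mono fun p hp => by simp only [hp]

theorem enorm_diffQuot_sq (α : ℝ) (u : ℝ → ℝ) (x y : ℝ) :
    ‖diffQuot α u (x, y)‖ₑ ^ 2 = ENNReal.ofReal ((u x - u y) ^ 2 / |x - y| ^ (1 + α)) := by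
  rw [← ofReal_norm, ← ENNReal.ofReal_pow (norm_nonneg _), Real.norm_eq_abs, sq_abs]
  congr 1
  rcases eq_or_ne x y with rfl | hxy
  · simp [diffQuot]
  · have : 0 < |x - y| := abs_pos.2 (sub_ne_zero.2 hxy)
    simp only [diffQuot]
    rw [mul_pow, ← Real.rpow_natCast (|x - y| ^ _), ← Real.rpow_mul this.le, div_eq_mul_inv (_ ^ 2),
      ← Real.rpow_neg this.le]
    congr 2
    push_cast; ring

theorem gagSq_eq_lintegral (α : ℝ) {u : ℝ → ℝ} (hu : Measurable u) :
    gagSq α u = ∫⁻ x, ∫⁻ y, ‖diffQuot α u (x, y)‖ₑ ^ 2 := by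
  rw [gagSq, Measure.volume_eq_prod, lintegral_prod]
  exact ((measurable_diffQuot α hu).enorm.pow_const 2).aemeasurable

theorem gagliardoSq_eq (α : ℝ) (u : L2Omega) : gagliardoSq α u = gagSq α (zeroExt u) := by
  rw [gagSq_eq_lintegral α (measurable_zeroExt u), gagliardoSq]
  simp only [enorm_diffQuot_sq]

/-- The space `H₀^{α/2}(Ω)` as the graph of the operator taking `u` to its weighted differences. -/
def H0Space (α : ℝ) : Submodule ℝ (WithLp 2 (L2Omega × Lp ℝ 2 (volume : Measure (ℝ × ℝ)))) where
  carrier := {p | p.snd =ᵐ[volume] diffQuot α (zeroExt p.fst)}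
  add_mem' {p q} hp hq := by
    change (p + q).snd =ᵐ[volume] diffQuot α (zeroExt (p + q).fst)
    rw [WithLp.add_snd, WithLp.add_fst]
    filter_upwards [Lp.coeFn_add p.snd q.snd, diffQuot_congr α (zeroExt_add p.fst q.fst), hp, hq]
      with x h1 h2 h3 h4
    rw [h1, h2, Pi.add_apply, h3, h4]
    simp only [diffQuot]; ring
  zero_mem' := by
    change (0 : WithLp 2 (L2Omega × Lp ℝ 2 (volume : Measure (ℝ × ℝ)))).snd =ᵐ[volume] _
    filter_upwards [Lp.coeFn_zero ℝ 2 (volume : Measure (ℝ × ℝ)), diffQuot_congr α zeroExt_zero]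
      with x h1 h2
    rw [WithLp.zero_snd, h1]
    change _ = diffQuot α (zeroExt 0) x
    rw [h2]; simp [diffQuot]
  smul_mem' c p hp := by
    change (c • p).snd =ᵐ[volume] diffQuot α (zeroExt (c • p).fst)
    rw [WithLp.smul_snd, WithLp.smul_fst]
    filter_upwards [Lp.coeFn_smul c p.snd, diffQuot_congr α (zeroExt_smul c p.fst), hp]
      with x h1 h2 h3
    rw [h1, h2, Pi.smul_apply, h3]
    simp only [diffQuot, smul_eq_mul]; ring

/-- Along a common subsequence both components converge almost everywhere, and the pointwise
relation between a function and its weighted differences survives such a limit. Completeness of the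
energy space follows. -/
theorem isClosed_H0Space (α : ℝ) :
    IsClosed (H0Space α : Set (WithLp 2 (L2Omega × Lp ℝ 2 (volume : Measure (ℝ × ℝ))))) := by
  refine IsSeqClosed.isClosed fun p q hp hpq => ?_
  have h1 : Tendsto (fun n => (p n).fst) atTop (𝓝 q.fst) :=
    ((WithLp.fstL 2 ℝ L2Omega (Lp ℝ 2 (volume : Measure (ℝ × ℝ)))).continuous.tendsto q).comp hpq
  have h2 : Tendsto (fun n => (p n).snd) atTop (𝓝 q.snd) :=
    ((WithLp.sndL 2 ℝ L2Omega (Lp ℝ 2 (volume : Measure (ℝ × ℝ)))).continuous.tendsto q).comp hpq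
  obtain ⟨a, ha, ha'⟩ := (tendstoInMeasure_of_tendsto_Lp h1).exists_seq_tendsto_ae
  obtain ⟨b, hb, hb'⟩ :=
    (tendstoInMeasure_of_tendsto_Lp (h2.comp ha.tendsto_atTop)).exists_seq_tendsto_ae
  have hz : ∀ᵐ x, Tendsto (fun n => zeroExt (p (a (b n))).fst x) atTop (𝓝 (zeroExt q.fst x)) := by
    filter_upwards [(ae_restrict_iff' measurableSet_Omega).1 ha'] with x hx
    by_cases hm : x ∈ Omega
    · simpa only [zeroExt_of_mem _ hm] using! (hx hm).comp hb.tendsto_atTop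
    · simp only [zeroExt_of_notMem _ hm]; exact tendsto_const_nhds
  have hz1 := (Measure.quasiMeasurePreserving_fst (μ := (volume : Measure ℝ))
    (ν := (volume : Measure ℝ))).ae hz
  have hz2 := (Measure.quasiMeasurePreserving_snd (μ := (volume : Measure ℝ))
    (ν := (volume : Measure ℝ))).ae hz
  have hall : ∀ᵐ x, ∀ n, (p (a (b n))).snd x = diffQuot α (zeroExt (p (a (b n))).fst) x :=
    ae_all_iff.2 fun n => hp (a (b n))
  change q.snd =ᵐ[volume] diffQuot α (zeroExt q.fst)
  filter_upwards [hz1, hz2, hb', hall] with x h3 h4 h5 h6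
  refine tendsto_nhds_unique h5 ?_
  simp only [Function.comp_apply, h6, diffQuot]
  exact (h3.sub h4).mul_const _

instance (α : ℝ) : CompleteSpace (H0Space α) := (isClosed_H0Space α).completeSpace_coe

/-- The embedding of `H₀^{α/2}(Ω)` into `L²(Ω)`. -/
def H0Space.incl (α : ℝ) : H0Space α →L[ℝ] L2Omega :=
  (WithLp.fstL 2 ℝ L2Omega (Lp ℝ 2 (volume : Measure (ℝ × ℝ)))).comp (H0Space α).subtypeL

/-- The weighted differences of an element of `H₀^{α/2}(Ω)`. -/
def H0Space.diff (α : ℝ) : H0Space α →L[ℝ] Lp ℝ 2 (volume : Measure (ℝ × ℝ)) :=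
  (WithLp.sndL 2 ℝ L2Omega (Lp ℝ 2 (volume : Measure (ℝ × ℝ)))).comp (H0Space α).subtypeL

namespace H0Space

variable {α : ℝ}

theorem diff_ae_eq (v : H0Space α) : diff α v =ᵐ[volume] diffQuot α (zeroExt (incl α v)) := v.2

theorem norm_sq (v : H0Space α) : ‖v‖ ^ 2 = ‖incl α v‖ ^ 2 + ‖diff α v‖ ^ 2 :=
  WithLp.prod_norm_sq_eq_of_L2 v.1

theorem inner_eq (v w : H0Space α) :
    inner ℝ v w = inner ℝ (incl α v) (incl α w) + inner ℝ (diff α v) (diff α w) :=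
  WithLp.prod_inner_apply v.1 w.1

theorem norm_incl_le (v : H0Space α) : ‖incl α v‖ ≤ ‖v‖ := by
  refine le_of_sq_le_sq ?_ (norm_nonneg _)
  rw [norm_sq]; nlinarith [sq_nonneg ‖diff α v‖]

theorem enorm_diff_sq (v : H0Space α) : ‖diff α v‖ₑ ^ 2 = gagSq α (zeroExt (incl α v)) := by
  rw [Lp.enorm_def, eLpNorm_congr_ae (diff_ae_eq v), eLpNorm_two_sq, gagSq]

theorem enorm_sq (v : H0Space α) :
    ‖v‖ₑ ^ 2 = ‖incl α v‖ₑ ^ 2 + gagSq α (zeroExt (incl α v)) := by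
  rw [← enorm_diff_sq]
  simp only [← ofReal_norm]
  rw [← ENNReal.ofReal_pow (norm_nonneg _), ← ENNReal.ofReal_pow (norm_nonneg _),
    ← ENNReal.ofReal_pow (norm_nonneg _), norm_sq, ENNReal.ofReal_add (by positivity)
    (by positivity)]

theorem eH0Norm_incl (v : H0Space α) : eH0Norm α (incl α v) = ‖v‖ₑ := by
  rw [eH0Norm, gagliardoSq_eq, ← enorm_sq, ← ENNReal.rpow_natCast, ← ENNReal.rpow_mul]
  norm_num

theorem incl_injective : Function.Injective (incl α) := by
  intro v w h
  have hd : diff α v = diff α w := by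
    refine Lp.ext ?_
    filter_upwards [diff_ae_eq v, diff_ae_eq w] with x h1 h2
    rw [h1, h2, h]
  have : v - w = 0 := by
    rw [← norm_eq_zero, ← sq_eq_zero_iff, norm_sq, map_sub, map_sub, h, hd]; simp
  exact sub_eq_zero.1 this

theorem exists_of_gagSq_lt_top (u : L2Omega) (hu : gagSq α (zeroExt u) < ⊤) :
    ∃ v : H0Space α, incl α v = u := by
  have hm : MemLp (diffQuot α (zeroExt u)) 2 (volume : Measure (ℝ × ℝ)) := by
    refine ⟨(measurable_diffQuot α (measurable_zeroExt u)).aestronglyMeasurable, ?_⟩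
    have h := eLpNorm_two_sq (volume : Measure (ℝ × ℝ)) (diffQuot α (zeroExt u))
    rw [← gagSq] at h
    by_contra htop
    rw [not_lt, top_le_iff] at htop
    rw [htop] at h
    norm_num at h
    exact hu.ne h.symm
  exact ⟨⟨WithLp.toLp 2 (u, hm.toLp _), hm.coeFn_toLp⟩, rfl⟩

theorem memH0_iff (u : L2Omega) : MemH0 α u ↔ ∃ v : H0Space α, incl α v = u := by
  refine ⟨fun h => exists_of_gagSq_lt_top u ?_, ?_⟩
  · rw [MemH0, eH0Norm, gagliardoSq_eq] at h
    have := (ENNReal.rpow_lt_top_iff_of_pos (by norm_num)).1 h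
    exact (ENNReal.add_lt_top.1 this).2
  · rintro ⟨v, rfl⟩
    rw [MemH0, eH0Norm_incl]
    exact enorm_lt_top

end H0Space

end

/-! ### Compactness of the embedding into `L²(Ω)`, by averaging over small cells. -/

noncomputable section

/-- The cell `[j / N, (j + 1) / N)` of the uniform partition of the line. -/
def cell (N : ℕ) (j : ℤ) : Set ℝ := {y | ⌊(N : ℝ) * y⌋ = j}

theorem measurableSet_cell (N : ℕ) (j : ℤ) : MeasurableSet (cell N j) :=
  (Int.measurable_floor.comp (measurable_const_mul (N : ℝ))) (measurableSet_singleton j)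

theorem volume_cell {N : ℕ} (hN : 0 < N) (j : ℤ) : volume (cell N j) = ENNReal.ofReal (N : ℝ)⁻¹ := by
  have hN' : (0 : ℝ) < N := by exact_mod_cast hN
  have : cell N j = Ico (j / N : ℝ) ((j + 1) / N) := by
    ext y
    simp only [cell, mem_ofPred_eq, Int.floor_eq_iff, mem_Ico]
    rw [div_le_iff₀' hN', lt_div_iff₀' hN']
  rw [this, Real.volume_Ico]
  congr 1
  field_simp
  ring

/-- The average of `u` (extended by `0`) over the cell containing `x`. -/
def cellAvg (N : ℕ) (u : ℝ → ℝ) (x : ℝ) : ℝ := N * ∫ y in cell N ⌊(N : ℝ) * x⌋, u y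

theorem enorm_sub_sq_le_of_mem_cell {α : ℝ} (hα : 0 < α) {N : ℕ} (hN : 0 < N) (u : ℝ → ℝ) {x y : ℝ}
    (hy : y ∈ cell N ⌊(N : ℝ) * x⌋) :
    ‖u x - u y‖ₑ ^ 2 ≤ ENNReal.ofReal ((N : ℝ) ^ (-(1 + α))) * ‖diffQuot α u (x, y)‖ₑ ^ 2 := by
  have hN' : (0 : ℝ) < N := by exact_mod_cast hN
  rw [enorm_diffQuot_sq, ← ENNReal.ofReal_mul (by positivity), ← ofReal_norm,
    ← ENNReal.ofReal_pow (norm_nonneg _), Real.norm_eq_abs, sq_abs]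
  refine ENNReal.ofReal_le_ofReal ?_
  rcases eq_or_ne x y with rfl | hxy
  · simp
  have h0 : 0 < |x - y| := abs_pos.2 (sub_ne_zero.2 hxy)
  have h1 : |x - y| ≤ (N : ℝ)⁻¹ := by
    have := Int.abs_sub_lt_one_of_floor_eq_floor (hy : ⌊(N : ℝ) * y⌋ = ⌊(N : ℝ) * x⌋)
    rw [← mul_sub, abs_mul, abs_of_pos hN', abs_sub_comm] at this
    rw [le_inv_comm₀ h0 hN', ← one_div, le_div_iff₀ h0]
    exact this.le
  have h2 : |x - y| ^ (1 + α) ≤ (N : ℝ) ^ (-(1 + α)) := by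
    rw [Real.rpow_neg hN'.le, ← Real.inv_rpow hN'.le]
    exact Real.rpow_le_rpow h0.le h1 (by linarith)
  rw [← mul_div_assoc, le_div_iff₀ (by positivity), mul_comm]
  exact mul_le_mul_of_nonneg_right h2 (sq_nonneg _)

/-- Cauchy-Schwarz on a cell of length `1 / N` costs a factor `N`, while points of one cell are at
distance at most `1 / N`, which gains `N ^ (-(1 + α))` against the kernel. The net gain is `N ^
(-α)`. -/
theorem enorm_sub_cellAvg_sq_le {α : ℝ} (hα : 0 < α) {N : ℕ} (hN : 0 < N) {u : ℝ → ℝ}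
    (hu : Measurable u) (hui : Integrable u) (x : ℝ) :
    ‖u x - cellAvg N u x‖ₑ ^ 2 ≤
      ENNReal.ofReal ((N : ℝ) ^ (-α)) * ∫⁻ y, ‖diffQuot α u (x, y)‖ₑ ^ 2 := by
  have hN' : (0 : ℝ) < N := by exact_mod_cast hN
  set C := cell N ⌊(N : ℝ) * x⌋ with hC
  have hvol : volume C = ENNReal.ofReal (N : ℝ)⁻¹ := volume_cell hN _
  have hvol' : volume C ≠ ⊤ := by rw [hvol]; exact ENNReal.ofReal_ne_top
  have hrepr : u x - cellAvg N u x = N * ∫ y in C, (u x - u y) := by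
    rw [integral_sub (integrable_const_iff.2 (Or.inr ⟨by
      rw [Measure.restrict_apply_univ]; exact hvol'.lt_top⟩)) hui.integrableOn, setIntegral_const,
      Measure.real, hvol, ENNReal.toReal_ofReal (by positivity), smul_eq_mul, cellAvg, hC]
    field_simp
  have hsplit : ENNReal.ofReal (N : ℝ) * ENNReal.ofReal (N : ℝ)⁻¹ = 1 := by
    rw [← ENNReal.ofReal_mul hN'.le, mul_inv_cancel₀ hN'.ne', ENNReal.ofReal_one]
  calc ‖u x - cellAvg N u x‖ₑ ^ 2
      ≤ (ENNReal.ofReal N * ∫⁻ y in C, ‖u x - u y‖ₑ) ^ 2 := by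
        rw [hrepr, enorm_mul, Real.enorm_of_nonneg hN'.le]
        gcongr
        exact enorm_integral_le_lintegral_enorm _
    _ ≤ ENNReal.ofReal N ^ 2 * (ENNReal.ofReal (N : ℝ)⁻¹ * ∫⁻ y in C, ‖u x - u y‖ₑ ^ 2) := by
        rw [mul_pow]
        gcongr
        have := lintegral_sq_le (volume.restrict C) (f := fun y => ‖u x - u y‖ₑ)
          (by fun_prop)
        rwa [Measure.restrict_apply_univ, hvol] at this
    _ = ENNReal.ofReal N * ∫⁻ y in C, ‖u x - u y‖ₑ ^ 2 := by
        rw [sq, ← mul_assoc, mul_assoc (ENNReal.ofReal N), hsplit, mul_one]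
    _ ≤ ENNReal.ofReal N * ∫⁻ y in C, ENNReal.ofReal ((N : ℝ) ^ (-(1 + α))) *
          ‖diffQuot α u (x, y)‖ₑ ^ 2 := by
        gcongr 1
        exact setLIntegral_mono_ae' (measurableSet_cell _ _)
          (ae_of_all _ fun y hy => enorm_sub_sq_le_of_mem_cell hα hN u hy)
    _ ≤ ENNReal.ofReal N * ∫⁻ y, ENNReal.ofReal ((N : ℝ) ^ (-(1 + α))) *
          ‖diffQuot α u (x, y)‖ₑ ^ 2 := by
        gcongr 1
        exact setLIntegral_le_lintegral _ _
    _ = _ := by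
        rw [lintegral_const_mul' _ _ ENNReal.ofReal_ne_top, ← mul_assoc,
          ← ENNReal.ofReal_mul hN'.le]
        congr 2
        nth_rewrite 1 [← Real.rpow_one (N : ℝ)]
        rw [← Real.rpow_add hN']
        congr 1; ring

theorem integrable_zeroExt (u : L2Omega) : Integrable (zeroExt u) := by
  have : IntegrableOn u Omega := by
    have : IsFiniteMeasure (volume.restrict Omega) := by
      rw [Omega]; infer_instance
    exact (Lp.memLp u).integrable (by norm_num)
  exact (integrable_indicator_iff measurableSet_Omega).2 this

theorem lintegral_sub_cellAvg_sq_le {α : ℝ} (hα : 0 < α) {N : ℕ} (hN : 0 < N) (u : L2Omega) :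
    ∫⁻ x, ‖zeroExt u x - cellAvg N (zeroExt u) x‖ₑ ^ 2 ≤
      ENNReal.ofReal ((N : ℝ) ^ (-α)) * gagSq α (zeroExt u) := by
  rw [gagSq_eq_lintegral _ (measurable_zeroExt u), ← lintegral_const_mul' _ _ ENNReal.ofReal_ne_top]
  exact lintegral_mono fun x =>
    enorm_sub_cellAvg_sq_le hα hN (measurable_zeroExt u) (integrable_zeroExt u) x

theorem restrict_cell_ne_top {N : ℕ} (hN : 0 < N) (j : ℤ) :
    volume.restrict Omega (cell N j) ≠ ⊤ :=
  ((Measure.restrict_le_self _).trans_lt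
    (by rw [volume_cell hN]; exact ENNReal.ofReal_lt_top)).ne

/-- The normalised indicator function of a cell. -/
def cellInd (N : ℕ) (hN : 0 < N) (j : ℤ) : L2Omega :=
  indicatorConstLp 2 (measurableSet_cell N j) (restrict_cell_ne_top hN j) (1 : ℝ)

/-- The finite rank operator replacing a function by its averages over the cells. -/
def cellAvgOp (N : ℕ) (hN : 0 < N) : L2Omega →L[ℝ] L2Omega :=
  ∑ j ∈ Finset.Icc (-(4 * N : ℤ)) (4 * N),
    (N : ℝ) • (innerSL ℝ (cellInd N hN j)).smulRight (cellInd N hN j)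

theorem isCompactOperator_cellAvgOp (N : ℕ) (hN : 0 < N) : IsCompactOperator (cellAvgOp N hN) := by
  have key : ∀ s : Finset ℤ, IsCompactOperator (∑ j ∈ s,
      (N : ℝ) • (innerSL ℝ (cellInd N hN j)).smulRight (cellInd N hN j) :
        L2Omega →L[ℝ] L2Omega) := by
    intro s
    induction s using Finset.induction_on with
    | empty => simpa using! isCompactOperator_zero
    | insert j s hj ih =>
      rw [Finset.sum_insert hj]
      refine IsCompactOperator.add ?_ ih
      refine IsCompactOperator.smul ?_ _
      have h1 : IsCompactOperator (innerSL ℝ (cellInd N hN j)) :=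
        isCompactOperator_of_locallyCompactSpace_dom (innerSL ℝ (cellInd N hN j) : L2Omega →L[ℝ] ℝ)
      exact h1.clm_comp (ContinuousLinearMap.toSpanSingleton ℝ (cellInd N hN j))
  exact key _

theorem cellAvgOp_ae_eq (N : ℕ) (hN : 0 < N) (u : L2Omega) :
    cellAvgOp N hN u =ᵐ[volume.restrict Omega] cellAvg N (zeroExt u) := by
  have hN' : (0 : ℝ) < N := by exact_mod_cast hN
  have hc (j : ℤ) : inner ℝ (cellInd N hN j) u = ∫ y in cell N j, zeroExt u y := by
    rw [cellInd, L2.inner_indicatorConstLp_one, Measure.restrict_restrict (measurableSet_cell _ _)]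
    exact (setIntegral_indicator measurableSet_Omega).symm
  have h1 : cellAvgOp N hN u = ∑ j ∈ Finset.Icc (-(4 * N : ℤ)) (4 * N),
      ((N : ℝ) * ∫ y in cell N j, zeroExt u y) • cellInd N hN j := by
    simp only [cellAvgOp, _root_.sum_apply, _root_.smul_apply,
      ContinuousLinearMap.smulRight_apply, innerSL_apply_apply, hc, smul_smul]
  have h2 : ∀ j, ∀ᵐ x ∂volume.restrict Omega,
      (((N : ℝ) * ∫ y in cell N j, zeroExt u y) • cellInd N hN j : L2Omega) x =
        ((N : ℝ) * ∫ y in cell N j, zeroExt u y) * (cell N j).indicator (fun _ => 1) x := by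
    intro j
    filter_upwards [Lp.coeFn_smul ((N : ℝ) * ∫ y in cell N j, zeroExt u y) (cellInd N hN j),
      indicatorConstLp_coeFn (p := 2) (hs := measurableSet_cell N j)
        (hμs := restrict_cell_ne_top hN j) (c := (1 : ℝ))] with x hx hx'
    rw [hx, Pi.smul_apply, smul_eq_mul, cellInd, hx']
  rw [h1]
  filter_upwards [ae_all_iff.2 h2, ae_restrict_mem measurableSet_Omega,
    Lp.coeFn_finsetSum (Finset.Icc (-(4 * N : ℤ)) (4 * N))
      (fun j => (((N : ℝ) * ∫ y in cell N j, zeroExt u y) • cellInd N hN j : L2Omega))]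
      with x hx hm hs
  rw [hs, Finset.sum_apply, Finset.sum_congr rfl fun j _ => hx j]
  -- Since `π < 4`, the cells with index between `-4N` and `4N` cover `Ω`.
  have hj : ⌊(N : ℝ) * x⌋ ∈ Finset.Icc (-(4 * N : ℤ)) (4 * N) := by
    have h4 := Real.pi_lt_four
    obtain ⟨ha, hb⟩ := hm
    rw [Finset.mem_Icc, Int.le_floor]
    constructor
    · push_cast; nlinarith
    · exact (Int.floor_lt.2 (by push_cast; nlinarith)).le
  rw [Finset.sum_eq_single_of_mem _ hj fun j _ hne => ?_]
  · rw [indicator_of_mem (by rfl), mul_one]; rfl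
  · rw [indicator_of_notMem (fun h => hne h.symm), mul_zero]

theorem norm_sub_cellAvgOp_le {α : ℝ} (hα : 0 < α) {N : ℕ} (hN : 0 < N) (v : H0Space α) :
    ‖H0Space.incl α v - cellAvgOp N hN (H0Space.incl α v)‖ ≤ (N : ℝ) ^ (-α / 2) * ‖v‖ := by
  have hN' : (0 : ℝ) < N := by exact_mod_cast hN
  set u := H0Space.incl α v with hu
  have h1 : ‖u - cellAvgOp N hN u‖ₑ ^ 2 ≤ ENNReal.ofReal ((N : ℝ) ^ (-α)) * ‖v‖ₑ ^ 2 := by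
    calc ‖u - cellAvgOp N hN u‖ₑ ^ 2
        = ∫⁻ x in Omega, ‖zeroExt u x - cellAvg N (zeroExt u) x‖ₑ ^ 2 := by
          rw [Lp.enorm_def, eLpNorm_two_sq]
          refine lintegral_congr_ae ?_
          filter_upwards [Lp.coeFn_sub u (cellAvgOp N hN u), cellAvgOp_ae_eq N hN u,
            ae_restrict_mem measurableSet_Omega] with x h1 h2 h3
          rw [h1, Pi.sub_apply, h2, zeroExt_of_mem _ h3]
      _ ≤ ∫⁻ x, ‖zeroExt u x - cellAvg N (zeroExt u) x‖ₑ ^ 2 := setLIntegral_le_lintegral _ _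
      _ ≤ ENNReal.ofReal ((N : ℝ) ^ (-α)) * gagSq α (zeroExt u) :=
          lintegral_sub_cellAvg_sq_le hα hN u
      _ ≤ _ := by
          rw [H0Space.enorm_sq]
          gcongr
          exact le_add_self
  have h2 : ‖u - cellAvgOp N hN u‖ ^ 2 ≤ (N : ℝ) ^ (-α) * ‖v‖ ^ 2 := by
    rw [← ofReal_norm, ← ofReal_norm, ← ENNReal.ofReal_pow (norm_nonneg _),
      ← ENNReal.ofReal_pow (norm_nonneg _), ← ENNReal.ofReal_mul (by positivity)] at h1
    exact (ENNReal.ofReal_le_ofReal_iff (by positivity)).1 h1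
  refine le_of_sq_le_sq ?_ (by positivity)
  rw [mul_pow, ← Real.rpow_natCast ((N : ℝ) ^ _), ← Real.rpow_mul hN'.le]
  rw [show -α / 2 * ((2 : ℕ) : ℝ) = -α by push_cast; ring]
  exact h2

/-- The embedding is the operator norm limit of the finite rank averaging operators, with error `N ^
(-α / 2)`. -/
theorem isCompactOperator_incl {α : ℝ} (hα : 0 < α) : IsCompactOperator (H0Space.incl α) := by
  refine isCompactOperator_of_tendsto (l := atTop)
    (F := fun n : ℕ => (cellAvgOp (n + 1) n.succ_pos).comp (H0Space.incl α)) ?_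
    (Eventually.of_forall fun n => (isCompactOperator_cellAvgOp _ _).comp_clm _)
  refine (tendsto_iff_norm_sub_tendsto_zero (E := H0Space α →L[ℝ] L2Omega)).2 ?_
  have h0 : Tendsto (fun n : ℕ => ((n + 1 : ℕ) : ℝ) ^ (-α / 2)) atTop (𝓝 0) := by
    have := (tendsto_rpow_neg_atTop (half_pos hα)).comp
      (tendsto_natCast_atTop_atTop (R := ℝ) |>.comp (tendsto_add_atTop_nat 1))
    simpa only [neg_div] using! this
  refine squeeze_zero (fun _ => norm_nonneg (E := H0Space α →L[ℝ] L2Omega) _) (fun n => ?_) h0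
  rw [norm_sub_rev (E := H0Space α →L[ℝ] L2Omega)]
  exact ContinuousLinearMap.opNorm_le_bound _ (by positivity)
    fun v => norm_sub_cellAvgOp_le hα n.succ_pos v

end

/-! ### The fractional Laplacian of smooth functions: principal value and integration by parts. -/

noncomputable section

/-- The weight `min(z², 1) / |z|^(1 + α)`. -/
def levyWeight (α z : ℝ) : ℝ := min (z ^ 2) 1 / |z| ^ (1 + α)

theorem levyWeight_nonneg (α z : ℝ) : 0 ≤ levyWeight α z := by unfold levyWeight; positivity

theorem levyWeight_neg (α z : ℝ) : levyWeight α (-z) = levyWeight α z := by simp [levyWeight]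

/-- Near the origin the weight is `|z| ^ (1 - α)`, integrable since `α < 2`; at infinity it is `|z|
^ (-1 - α)`, integrable since `0 < α`. It is the dominating function in every limit that removes the
cutoff of the kernel from second differences. -/
theorem integrable_levyWeight {α : ℝ} (hα₀ : 0 < α) (hα₂ : α < 2) : Integrable (levyWeight α) := by
  have h1 : IntegrableOn (levyWeight α) (Ioc 0 1) := by
    have h := (intervalIntegral.intervalIntegrable_rpow' (a := 0) (b := 1)
      (show (-1 : ℝ) < 1 - α by linarith)).1
    refine h.congr_fun (fun z hz => ?_) measurableSet_Ioc
    have hz0 : 0 < z := hz.1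
    simp only [levyWeight]
    rw [min_eq_left (pow_le_one₀ hz0.le hz.2), abs_of_pos hz0, ← Real.rpow_natCast,
      ← Real.rpow_sub hz0]
    congr 1; push_cast; ring
  have h2 : IntegrableOn (levyWeight α) (Ioi 1) := by
    have h := integrableOn_Ioi_rpow_of_lt (show -(1 + α) < -1 by linarith) zero_lt_one
    refine h.congr_fun (fun z hz => ?_) measurableSet_Ioi
    have hz1 : 1 < z := hz
    have hz0 : 0 < z := by linarith
    simp only [levyWeight]
    rw [min_eq_right (one_le_pow₀ hz1.le), abs_of_pos hz0, Real.rpow_neg hz0.le, one_div]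
  have h3 : IntegrableOn (levyWeight α) (Ioi 0) := by
    rw [← Ioc_union_Ioi_eq_Ioi zero_le_one]
    exact h1.union h2
  have h4 : IntegrableOn (levyWeight α) (Iic 0) := by
    have := (integrableOn_Ici_iff_integrableOn_Ioi (by simp)).2 h3
    rw [← neg_zero] at this
    simpa only [levyWeight_neg] using! this.comp_neg_Iic
  rw [← integrableOn_univ, ← Iic_union_Ioi (a := (0 : ℝ))]
  exact h4.union h3

theorem diffQuot_mul (α : ℝ) (u v : ℝ → ℝ) (x y : ℝ) :
    diffQuot α u (x, y) * diffQuot α v (x, y) = (u x - u y) * (v x - v y) / |x - y| ^ (1 + α) := by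
  rcases eq_or_ne x y with rfl | hxy
  · simp [diffQuot]
  · have : 0 < |x - y| := abs_pos.2 (sub_ne_zero.2 hxy)
    simp only [diffQuot]
    rw [mul_mul_mul_comm, ← Real.rpow_add this, div_eq_mul_inv (_ * _), ← Real.rpow_neg this.le]
    congr 2
    ring

/-- The kernel `|z|^(-1-α)` cut off near the origin. -/
def truncKer (α ε : ℝ) (z : ℝ) : ℝ := {z : ℝ | ε ≤ |z|}.indicator (fun z => (|z| ^ (1 + α))⁻¹) z

theorem truncKer_neg (α ε z : ℝ) : truncKer α ε (-z) = truncKer α ε z := by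
  simp only [truncKer, indicator, mem_ofPred_eq, abs_neg]

theorem truncKer_nonneg (α ε z : ℝ) : 0 ≤ truncKer α ε z :=
  indicator_nonneg (fun z _ => by positivity) z

theorem measurable_truncKer (α ε : ℝ) : Measurable (truncKer α ε) := by
  unfold truncKer
  refine Measurable.indicator (by fun_prop) ?_
  exact measurableSet_le measurable_const (by fun_prop)

theorem truncKer_mul_le {α ε : ℝ} (z : ℝ) :
    min (z ^ 2) 1 * truncKer α ε z ≤ levyWeight α z := by
  unfold truncKer levyWeight
  by_cases h : z ∈ {z : ℝ | ε ≤ |z|}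
  · rw [indicator_of_mem h, div_eq_mul_inv]
  · rw [indicator_of_notMem h, mul_zero]; positivity

theorem truncKer_le {α ε : ℝ} (hε : 0 < ε) (z : ℝ) :
    truncKer α ε z ≤ (min (ε ^ 2) 1)⁻¹ * levyWeight α z := by
  by_cases h : z ∈ {z : ℝ | ε ≤ |z|}
  · have h0 : 0 < min (ε ^ 2) 1 := by positivity
    have h1 : min (ε ^ 2) 1 ≤ min (z ^ 2) 1 := by
      refine min_le_min_right _ ?_
      rw [← sq_abs z]
      exact pow_le_pow_left₀ hε.le h 2
    rw [inv_mul_eq_div, le_div_iff₀ h0, mul_comm]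
    exact (mul_le_mul_of_nonneg_right h1 (truncKer_nonneg _ _ _)).trans (truncKer_mul_le z)
  · rw [truncKer, indicator_of_notMem h]
    exact mul_nonneg (by positivity) (levyWeight_nonneg _ _)

theorem integrable_truncKer {α ε : ℝ} (hα₀ : 0 < α) (hα₂ : α < 2) (hε : 0 < ε) :
    Integrable (truncKer α ε) := by
  refine ((integrable_levyWeight hα₀ hα₂).const_mul (min (ε ^ 2) 1)⁻¹).mono'
    (measurable_truncKer α ε).aestronglyMeasurable (ae_of_all _ fun z => ?_)
  rw [Real.norm_of_nonneg (truncKer_nonneg _ _ _)]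
  exact truncKer_le hε z

section SmoothCompactSupport

variable {φ : ℝ → ℝ} (hφ : ContDiff ℝ ∞ φ) (hc : HasCompactSupport φ)

include hφ hc

theorem exists_abs_le : ∃ M, 0 ≤ M ∧ ∀ x, |φ x| ≤ M := by
  obtain ⟨M, hM⟩ := hc.exists_bound_of_continuous hφ.continuous
  exact ⟨M, (abs_nonneg _).trans (hM 0), hM⟩

theorem exists_sub_sq_le : ∃ C, 0 ≤ C ∧ ∀ x y, (φ x - φ y) ^ 2 ≤ C * min ((x - y) ^ 2) 1 := by
  obtain ⟨M, hM0, hM⟩ := exists_abs_le hφ hc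
  obtain ⟨K, hK⟩ := ContDiff.lipschitzWith_of_hasCompactSupport hc hφ (by simp)
  refine ⟨K ^ 2 + (2 * M) ^ 2, by positivity, fun x y => ?_⟩
  have h1 : |φ x - φ y| ≤ K * |x - y| := by simpa [Real.dist_eq] using hK.dist_le_mul x y
  have h2 : |φ x - φ y| ≤ 2 * M := (abs_sub _ _).trans (by linarith [hM x, hM y])
  have h3 := pow_le_pow_left₀ (abs_nonneg _) h1 2
  have h4 := pow_le_pow_left₀ (abs_nonneg _) h2 2
  rw [mul_pow, sq_abs, sq_abs] at h3
  rw [sq_abs] at h4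
  rcases min_cases ((x - y) ^ 2) 1 with h | h <;> rw [h.1] <;>
    nlinarith [sq_nonneg (x - y), sq_nonneg (K : ℝ), sq_nonneg (2 * M)]

theorem exists_second_diff_le :
    ∃ C, 0 ≤ C ∧ ∀ x z, |2 * φ x - φ (x - z) - φ (x + z)| ≤ C * min (z ^ 2) 1 := by
  obtain ⟨M, hM0, hM⟩ := exists_abs_le hφ hc
  have hd : ContDiff ℝ ∞ (deriv φ) := ((contDiff_infty_iff_deriv).1 hφ).2
  obtain ⟨K, hK⟩ := ContDiff.lipschitzWith_of_hasCompactSupport hc.deriv hd (by simp)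
  have hdiff : Differentiable ℝ φ := hφ.differentiable (by simp)
  refine ⟨K + 4 * M, by positivity, fun x z => ?_⟩
  have h1 : |2 * φ x - φ (x - z) - φ (x + z)| ≤ K * z ^ 2 := by
    -- The second difference is a first difference, with step `z`, of this first difference, whose
    -- derivative is at most `K |z|`.
    have hL : LipschitzWith (K * ‖z‖₊) (fun s => φ (s + z) - φ s) := by
      refine lipschitzWith_of_nnnorm_deriv_le (by fun_prop) fun s => ?_
      rw [deriv_fun_sub (by fun_prop) (by fun_prop), deriv_comp_add_const]
      rw [← NNReal.coe_le_coe]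
      simpa [Real.dist_eq] using hK.dist_le_mul (s + z) s
    have := hL.dist_le_mul (x - z) x
    simp only [sub_add_cancel, Real.dist_eq, NNReal.coe_mul, coe_nnnorm, Real.norm_eq_abs,
      sub_sub_cancel_left, abs_neg, mul_assoc, ← sq, sq_abs] at this
    convert this using 2; ring
  have h2 : |2 * φ x - φ (x - z) - φ (x + z)| ≤ 4 * M := by
    have := hM x; have := hM (x - z); have := hM (x + z)
    rw [abs_le] at *
    constructor <;> linarith
  rcases min_cases (z ^ 2) 1 with h | h <;> rw [h.1] <;> nlinarith [sq_nonneg z, K.2]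

end SmoothCompactSupport

theorem truncated_integral_eq (α ε : ℝ) (φ : ℝ → ℝ) (x : ℝ) :
    ∫ y in (Metric.ball x ε)ᶜ, (φ x - φ y) / |x - y| ^ (1 + α) =
      ∫ y, (φ x - φ y) * truncKer α ε (x - y) := by
  rw [← integral_indicator Metric.isOpen_ball.measurableSet.compl]
  refine integral_congr_ae (ae_of_all _ fun y => ?_)
  simp only [truncKer, indicator, mem_compl_iff, Metric.mem_ball, mem_ofPred_eq, not_lt,
    Real.dist_eq, abs_sub_comm y x]
  split_ifs <;> simp [div_eq_mul_inv]

/-- The fractional Laplacian, without its constant, as an absolutely convergent integral of second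
differences. -/
def levyLap (α : ℝ) (φ : ℝ → ℝ) (x : ℝ) : ℝ :=
  1 / 2 * ∫ z, (2 * φ x - φ (x - z) - φ (x + z)) / |z| ^ (1 + α)

section PrincipalValue

variable {α : ℝ} (hα₀ : 0 < α) (hα₂ : α < 2) {φ : ℝ → ℝ} (hφ : ContDiff ℝ ∞ φ)
  (hc : HasCompactSupport φ)

include hα₀ hα₂ hφ hc

theorem integrable_sub_mul_truncKer {ε : ℝ} (hε : 0 < ε) (x : ℝ) :
    Integrable fun y => (φ x - φ y) * truncKer α ε (x - y) := by
  obtain ⟨M, hM0, hM⟩ := exists_abs_le hφ hc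
  have hcont := hφ.continuous
  refine (((integrable_truncKer hα₀ hα₂ hε).comp_sub_left x).bdd_mul (c := 2 * M)
    (by fun_prop) (ae_of_all _ fun y => ?_))
  exact (abs_sub _ _).trans (by linarith [hM x, hM y])

/-- Averaging over `z` and `-z` cancels the odd first order part of `φ x - φ (x - z)`. What remains
is quadratically small at the origin, which makes the principal value an absolutely convergent
integral. -/
theorem truncated_integral_eq_second_diff {ε : ℝ} (hε : 0 < ε) (x : ℝ) :
    ∫ y, (φ x - φ y) * truncKer α ε (x - y) =
      1 / 2 * ∫ z, (2 * φ x - φ (x - z) - φ (x + z)) * truncKer α ε z := by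
  have hi := (integrable_sub_mul_truncKer hα₀ hα₂ hφ hc hε x)
  have h1 : ∫ y, (φ x - φ y) * truncKer α ε (x - y) =
      ∫ z, (φ x - φ (x - z)) * truncKer α ε z := by
    rw [← integral_sub_left_eq_self (fun y => (φ x - φ y) * truncKer α ε (x - y)) volume x]
    simp
  have hi1 : Integrable fun z => (φ x - φ (x - z)) * truncKer α ε z := by
    simpa using hi.comp_sub_left x
  have h2 : ∫ y, (φ x - φ y) * truncKer α ε (x - y) =
      ∫ z, (φ x - φ (x + z)) * truncKer α ε z := by
    rw [h1, ← integral_neg_eq_self (fun z => (φ x - φ (x - z)) * truncKer α ε z)]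
    simp [truncKer_neg]
  have hi2 : Integrable fun z => (φ x - φ (x + z)) * truncKer α ε z := by
    simpa [truncKer_neg] using hi1.comp_neg
  have h3 : ∫ z, (2 * φ x - φ (x - z) - φ (x + z)) * truncKer α ε z =
      (∫ z, (φ x - φ (x - z)) * truncKer α ε z) + ∫ z, (φ x - φ (x + z)) * truncKer α ε z := by
    rw [← integral_add hi1 hi2]
    congr 1 with z
    ring
  rw [h3, ← h1, ← h2]
  ring

/-- Uniformity in both `ε` and `x` is what permits the limit `ε → 0` under an integral against a
function that is merely integrable. -/
theorem exists_abs_truncated_le : ∃ C, ∀ ε, 0 < ε → ∀ x,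
    |∫ y, (φ x - φ y) * truncKer α ε (x - y)| ≤ C := by
  obtain ⟨C, hC0, hC⟩ := exists_second_diff_le hφ hc
  refine ⟨1 / 2 * ∫ z, C * levyWeight α z, fun ε hε x => ?_⟩
  rw [truncated_integral_eq_second_diff hα₀ hα₂ hφ hc hε, abs_mul, abs_of_pos (by norm_num)]
  refine mul_le_mul_of_nonneg_left ?_ (by norm_num)
  rw [← Real.norm_eq_abs]
  refine norm_integral_le_of_norm_le ((integrable_levyWeight hα₀ hα₂).const_mul C)
    (ae_of_all _ fun z => ?_)
  rw [norm_mul, Real.norm_of_nonneg (truncKer_nonneg _ _ _)]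
  calc _ ≤ C * min (z ^ 2) 1 * truncKer α ε z :=
        mul_le_mul_of_nonneg_right (hC x z) (truncKer_nonneg _ _ _)
    _ ≤ _ := by rw [mul_assoc]; exact mul_le_mul_of_nonneg_left (truncKer_mul_le z) hC0

omit hα₀ hα₂ hφ hc in
theorem eventually_truncKer_eq {z : ℝ} (hz : z ≠ 0) :
    ∀ᶠ ε in 𝓝[>] (0 : ℝ), truncKer α ε z = (|z| ^ (1 + α))⁻¹ := by
  filter_upwards [Ioo_mem_nhdsGT (abs_pos.2 hz)] with ε hε
  exact indicator_of_mem (show z ∈ {z : ℝ | ε ≤ |z|} from hε.2.le) _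

theorem tendsto_truncated (x : ℝ) :
    Tendsto (fun ε : ℝ => ∫ y, (φ x - φ y) * truncKer α ε (x - y)) (𝓝[>] 0)
      (𝓝 (levyLap α φ x)) := by
  obtain ⟨C, hC0, hC⟩ := exists_second_diff_le hφ hc
  have hcont := hφ.continuous
  have h : Tendsto (fun ε : ℝ => 1 / 2 * ∫ z, (2 * φ x - φ (x - z) - φ (x + z)) * truncKer α ε z)
      (𝓝[>] 0) (𝓝 (levyLap α φ x)) := by
    refine Tendsto.const_mul _ ?_
    refine tendsto_integral_filter_of_dominated_convergence (fun z => C * levyWeight α z)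
      (Eventually.of_forall fun ε => ?_) (Eventually.of_forall fun ε => ae_of_all _ fun z => ?_)
      ((integrable_levyWeight hα₀ hα₂).const_mul C) (ae_of_all _ fun z => ?_)
    · have := measurable_truncKer α ε
      exact Measurable.aestronglyMeasurable (by fun_prop)
    · rw [norm_mul, Real.norm_of_nonneg (truncKer_nonneg _ _ _)]
      calc _ ≤ C * min (z ^ 2) 1 * truncKer α ε z :=
            mul_le_mul_of_nonneg_right (hC x z) (truncKer_nonneg _ _ _)
        _ ≤ _ := by rw [mul_assoc]; exact mul_le_mul_of_nonneg_left (truncKer_mul_le z) hC0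
    · rcases eq_or_ne z 0 with rfl | hz
      · simp only [sub_zero, add_zero, show 2 * φ x - φ x - φ x = 0 by ring, zero_mul, zero_div]
        exact tendsto_const_nhds
      · refine tendsto_const_nhds.congr' ?_
        filter_upwards [eventually_truncKer_eq (α := α) hz] with ε hε
        rw [hε, div_eq_mul_inv]
  refine h.congr' ?_
  filter_upwards [self_mem_nhdsWithin] with ε hε
  rw [truncated_integral_eq_second_diff hα₀ hα₂ hφ hc hε]

theorem fracLap_eq (x : ℝ) : fracLap α φ x = fracLapConst α * levyLap α φ x := by
  rw [fracLap]
  congr 1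
  simp only [truncated_integral_eq]
  exact (tendsto_truncated hα₀ hα₂ hφ hc x).limUnder_eq

/-- With the kernel cut off, each of the two terms of `u p.1 - u p.2` is integrable on its own.
Exchanging the variables shows that they contribute equally, hence the factor `2`; Fubini does the
rest. -/
theorem integral_truncated_diffQuot_mul {u : ℝ → ℝ} (hu : Integrable u) {ε : ℝ} (hε : 0 < ε) :
    ∫ p : ℝ × ℝ, (u p.1 - u p.2) * ((φ p.1 - φ p.2) * truncKer α ε (p.1 - p.2)) =
      2 * ∫ x, u x * ∫ y, (φ x - φ y) * truncKer α ε (x - y) := by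
  obtain ⟨M, hM0, hM⟩ := exists_abs_le hφ hc
  have hcont := hφ.continuous
  have hi0 : Integrable (fun p : ℝ × ℝ => u p.2 * truncKer α ε (p.1 - p.2)) :=
    hu.convolution_integrand (ContinuousLinearMap.mul ℝ ℝ) (integrable_truncKer hα₀ hα₂ hε)
  have hi2 : Integrable (fun p : ℝ × ℝ =>
      u p.2 * ((φ p.1 - φ p.2) * truncKer α ε (p.1 - p.2))) := by
    have := hi0.bdd_mul (c := 2 * M) (f := fun p : ℝ × ℝ => φ p.1 - φ p.2)
      (by fun_prop) (ae_of_all _ fun p => (abs_sub _ _).trans (by linarith [hM p.1, hM p.2]))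
    refine this.congr (ae_of_all _ fun p => ?_)
    ring
  have hi1 : Integrable (fun p : ℝ × ℝ =>
      u p.1 * ((φ p.1 - φ p.2) * truncKer α ε (p.1 - p.2))) := by
    refine hi2.swap.neg.congr (ae_of_all _ fun p => ?_)
    simp only [Pi.neg_apply, Function.comp_apply, Prod.fst_swap, Prod.snd_swap]
    rw [← truncKer_neg, neg_sub]; ring
  have hsw : ∫ p : ℝ × ℝ, u p.2 * ((φ p.1 - φ p.2) * truncKer α ε (p.1 - p.2)) =
      -∫ p : ℝ × ℝ, u p.1 * ((φ p.1 - φ p.2) * truncKer α ε (p.1 - p.2)) := by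
    rw [Measure.volume_eq_prod, ← integral_prod_swap, ← integral_neg]
    refine integral_congr_ae (ae_of_all _ fun p => ?_)
    simp only [Prod.fst_swap, Prod.snd_swap]
    rw [← truncKer_neg, neg_sub]; ring
  simp only [sub_mul (u _)]
  rw [integral_sub hi1 hi2, hsw, sub_neg_eq_add, ← two_mul, Measure.volume_eq_prod,
    integral_prod _ hi1]
  simp only [integral_const_mul]

/-- Integration by parts against a smooth compactly supported function. -/
theorem integral_diffQuot_mul {u : ℝ → ℝ} (hu : Integrable u)
    (hint : Integrable fun p : ℝ × ℝ => diffQuot α u p * diffQuot α φ p) :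
    ∫ p : ℝ × ℝ, diffQuot α u p * diffQuot α φ p = 2 * ∫ x, u x * levyLap α φ x := by
  have hcont := hφ.continuous
  obtain ⟨C, hC⟩ := exists_abs_truncated_le hα₀ hα₂ hφ hc
  -- Both sides of the truncated identity converge as `ε → 0`: the left is dominated by the full
  -- product of weighted differences, the right by `C |u|`.
  have h1 : Tendsto (fun ε : ℝ => ∫ p : ℝ × ℝ,
      (u p.1 - u p.2) * ((φ p.1 - φ p.2) * truncKer α ε (p.1 - p.2))) (𝓝[>] 0)
      (𝓝 (∫ p : ℝ × ℝ, diffQuot α u p * diffQuot α φ p)) := by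
    have hm1 : AEStronglyMeasurable (fun p : ℝ × ℝ => u p.1) := hu.aestronglyMeasurable.comp_fst
    have hm2 : AEStronglyMeasurable (fun p : ℝ × ℝ => u p.2) := hu.aestronglyMeasurable.comp_snd
    refine tendsto_integral_filter_of_dominated_convergence
      (fun p => ‖diffQuot α u p * diffQuot α φ p‖)
      (Eventually.of_forall fun ε => ?_) (Eventually.of_forall fun ε => ae_of_all _ fun p => ?_)
      hint.norm (ae_of_all _ fun p => ?_)
    · have := measurable_truncKer α ε
      refine (hm1.sub hm2).mul (Measurable.aestronglyMeasurable (by fun_prop))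
    · obtain ⟨x, y⟩ := p
      rw [diffQuot_mul, ← mul_assoc, norm_mul, norm_div, div_eq_mul_inv]
      refine mul_le_mul_of_nonneg_left ?_ (norm_nonneg _)
      rw [Real.norm_of_nonneg (truncKer_nonneg _ _ _),
        Real.norm_of_nonneg (by positivity : 0 ≤ |x - y| ^ (1 + α))]
      exact indicator_le_self' (fun z _ => by positivity) _
    · obtain ⟨x, y⟩ := p
      rw [diffQuot_mul]
      rcases eq_or_ne x y with rfl | hxy
      · simp
      · refine tendsto_const_nhds.congr' ?_
        filter_upwards [eventually_truncKer_eq (α := α) (sub_ne_zero.2 hxy)] with ε hε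
        rw [hε, div_eq_mul_inv, mul_assoc]
  have h2 : Tendsto (fun ε : ℝ => 2 * ∫ x, u x * ∫ y, (φ x - φ y) * truncKer α ε (x - y)) (𝓝[>] 0)
      (𝓝 (2 * ∫ x, u x * levyLap α φ x)) := by
    refine Tendsto.const_mul _ ?_
    refine tendsto_integral_filter_of_dominated_convergence (fun x => ‖u x‖ * C)
      (Eventually.of_forall fun ε => ?_) ?_ (hu.norm.mul_const C) (ae_of_all _ fun x => ?_)
    · refine hu.aestronglyMeasurable.mul ?_
      have := measurable_truncKer α ε
      refine AEStronglyMeasurable.integral_prod_right' (μ := volume) (ν := volume)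
        (f := fun p : ℝ × ℝ => (φ p.1 - φ p.2) * truncKer α ε (p.1 - p.2)) ?_
      exact Measurable.aestronglyMeasurable (by fun_prop)
    · filter_upwards [self_mem_nhdsWithin] with ε hε
      refine ae_of_all _ fun x => ?_
      rw [norm_mul]
      exact mul_le_mul_of_nonneg_left (hC ε hε x) (norm_nonneg _)
    · exact (tendsto_truncated hα₀ hα₂ hφ hc x).const_mul _
  refine tendsto_nhds_unique h1 (h2.congr' ?_)
  filter_upwards [self_mem_nhdsWithin] with ε hε
  rw [integral_truncated_diffQuot_mul hα₀ hα₂ hφ hc hu hε]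

end PrincipalValue

/-- The integrand is at most a constant times `levyWeight α (x - y)` and vanishes unless one of the
two points lies in the compact support, so it is dominated by an integrable convolution integrand
and its swap. -/
theorem gagSq_lt_top_of_contDiff {α : ℝ} (hα₀ : 0 < α) (hα₂ : α < 2) {φ : ℝ → ℝ}
    (hφ : ContDiff ℝ ∞ φ) (hc : HasCompactSupport φ) : gagSq α φ < ⊤ := by
  obtain ⟨C, hC0, hC⟩ := exists_sub_sq_le hφ hc
  set K := tsupport φ
  have hK : volume K < ⊤ := IsCompact.measure_lt_top hc
  have hKm : MeasurableSet K := (isClosed_tsupport φ).measurableSet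
  have hi0 : Integrable (fun p : ℝ × ℝ => K.indicator (fun _ => C) p.2 * levyWeight α (p.1 - p.2)) :=
    Integrable.convolution_integrand (f := K.indicator (fun _ => C)) (ContinuousLinearMap.mul ℝ ℝ)
      (IntegrableOn.integrable_indicator (integrableOn_const hK.ne) hKm)
      (integrable_levyWeight hα₀ hα₂)
  refine lt_of_le_of_lt (lintegral_mono fun p => ?_) (hi0.add hi0.swap).lintegral_lt_top
  obtain ⟨x, y⟩ := p
  rw [enorm_diffQuot_sq]
  refine ENNReal.ofReal_le_ofReal ?_
  simp only [Pi.add_apply, Function.comp_apply, Prod.swap_prod_mk]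
  rw [← neg_sub x y, levyWeight_neg, ← add_mul]
  have h1 : (φ x - φ y) ^ 2 / |x - y| ^ (1 + α) ≤ C * levyWeight α (x - y) := by
    rw [levyWeight, ← mul_div_assoc]
    exact div_le_div_of_nonneg_right (hC x y) (by positivity)
  by_cases hx : x ∈ K
  · refine h1.trans (mul_le_mul_of_nonneg_right ?_ (levyWeight_nonneg _ _))
    rw [indicator_of_mem hx]
    exact le_add_of_nonneg_left (indicator_nonneg (fun _ _ => hC0) _)
  by_cases hy : y ∈ K
  · refine h1.trans (mul_le_mul_of_nonneg_right ?_ (levyWeight_nonneg _ _))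
    rw [indicator_of_mem hy]
    exact le_add_of_nonneg_right (indicator_nonneg (fun _ _ => hC0) _)
  · rw [image_eq_zero_of_notMem_tsupport hx, image_eq_zero_of_notMem_tsupport hy]
    simp [hx, hy]

end

/-! ### Weak limits in the energy space, and mollification. -/

noncomputable section

section WeakLimit

variable {X V : Type*} [NormedAddCommGroup X] [InnerProductSpace ℝ X] [CompleteSpace X]
  [NormedAddCommGroup V] [InnerProductSpace ℝ V] [CompleteSpace V]

omit [CompleteSpace V] in
/-- If a bounded sequence tests to zero against a dense set then it tends weakly to zero. -/
theorem tendsto_inner_zero_of_dense {v : ℕ → V} {C : ℝ} (hC : ∀ n, ‖v n‖ ≤ C) {D : Set V}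
    (hD : Dense D) (h : ∀ z ∈ D, Tendsto (fun n => inner ℝ (v n) z) atTop (𝓝 0)) (z : V) :
    Tendsto (fun n => inner ℝ (v n) z) atTop (𝓝 0) := by
  have hC0 : 0 ≤ C := (norm_nonneg _).trans (hC 0)
  rw [Metric.tendsto_atTop]
  intro ε hε
  obtain ⟨d, hd, hdz⟩ := Metric.mem_closure_iff.1 (hD z) (ε / (2 * (C + 1))) (by positivity)
  obtain ⟨N, hN⟩ := Metric.tendsto_atTop.1 (h d hd) (ε / 2) (by positivity)
  refine ⟨N, fun n hn => ?_⟩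
  have h1 := hN n hn
  rw [Real.dist_eq, sub_zero] at h1 ⊢
  have h2 : |inner ℝ (v n) (z - d)| ≤ C * (ε / (2 * (C + 1))) := by
    refine (abs_real_inner_le_norm _ _).trans ?_
    rw [dist_eq_norm] at hdz
    exact mul_le_mul (hC n) hdz.le (norm_nonneg _) hC0
  have h3 : C * (ε / (2 * (C + 1))) ≤ ε / 2 := by
    rw [mul_div_assoc', div_le_div_iff₀ (by positivity) (by positivity)]
    nlinarith
  have h4 : inner ℝ (v n) z = inner ℝ (v n) (z - d) + inner ℝ (v n) d := by
    rw [← inner_add_right, sub_add_cancel]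
  rw [h4]
  exact (abs_add_le _ _).trans_lt (by linarith)

theorem dense_adjoint_image (j : V →L[ℝ] X) (hj : Function.Injective j) {D : Set X} (hD : Dense D) :
    Dense (ContinuousLinearMap.adjoint j '' D) := by
  have hr : DenseRange (ContinuousLinearMap.adjoint j) := by
    change Dense ((ContinuousLinearMap.adjoint j : X →ₗ[ℝ] V).range : Set V)
    rw [Submodule.dense_iff_topologicalClosure_eq_top, Submodule.topologicalClosure_eq_top_iff,
      Submodule.eq_bot_iff]
    intro z hz
    have h1 : inner ℝ (j z) (j z) = 0 := by
      rw [← ContinuousLinearMap.adjoint_inner_left]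
      exact (Submodule.mem_orthogonal _ _).1 hz _ ⟨j z, rfl⟩
    exact hj (by rw [map_zero]; exact inner_self_eq_zero.1 h1)
  exact hr.dense_image (ContinuousLinearMap.adjoint j).continuous hD

/-- A closed subspace contains every limit of a bounded sequence that converges weakly in a larger
space. -/
theorem mem_of_weak_limit (j : V →L[ℝ] X) (hj : Function.Injective j) (W : Submodule ℝ V)
    (hW : IsClosed (W : Set V)) {v : ℕ → V} {v₀ : V} {C : ℝ} (hC : ∀ n, ‖v n‖ ≤ C)
    (hv : ∀ n, v n ∈ W) {D : Set X} (hD : Dense D)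
    (h : ∀ k ∈ D, Tendsto (fun n => inner ℝ (j (v n)) k) atTop (𝓝 (inner ℝ (j v₀) k))) :
    v₀ ∈ W := by
  have hcompl : CompleteSpace W := hW.completeSpace_coe
  -- A closed subspace is its double orthogonal, so it suffices to pair `v₀` with `z ⊥ W`. The
  -- pairings of `v n - v₀` with `z` all equal `-⟨z, v₀⟩`, and they tend to zero because the vectors
  -- `j* k` with `k ∈ D` are dense in `V`.
  rw [← Submodule.orthogonal_orthogonal W, Submodule.mem_orthogonal]
  intro z hz
  have h1 := tendsto_inner_zero_of_dense (v := fun n => v n - v₀) (C := C + ‖v₀‖)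
    (fun n => (norm_sub_le _ _).trans (by linarith [hC n])) (dense_adjoint_image j hj hD) (by
      rintro _ ⟨k, hk, rfl⟩
      simp only [ContinuousLinearMap.adjoint_inner_right, map_sub, inner_sub_left]
      simpa using (h k hk).sub_const (inner ℝ (j v₀) k)) z
  have h2 : ∀ n, inner ℝ (v n - v₀) z = - inner ℝ z v₀ := fun n => by
    rw [inner_sub_left, (Submodule.mem_orthogonal _ _).1 hz _ (hv n), real_inner_comm, zero_sub]
  simp only [h2] at h1
  simpa using tendsto_nhds_unique tendsto_const_nhds h1

end WeakLimit

namespace H0Space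

variable {α : ℝ}

theorem exists_of_fun {w : ℝ → ℝ} (hm : Measurable w) (h0 : ∀ x ∉ Omega, w x = 0)
    (h2 : ∫⁻ x, ‖w x‖ₑ ^ 2 < ⊤) (hg : gagSq α w < ⊤) :
    ∃ v : H0Space α, zeroExt (incl α v) =ᵐ[volume] w ∧
      ‖v‖ₑ ^ 2 = (∫⁻ x, ‖w x‖ₑ ^ 2) + gagSq α w := by
  have hL : MemLp w 2 (volume.restrict Omega) := by
    refine MemLp.restrict _ ⟨hm.aestronglyMeasurable, ?_⟩
    have h := eLpNorm_two_sq (volume : Measure ℝ) w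
    by_contra htop
    rw [not_lt, top_le_iff] at htop
    rw [htop] at h
    norm_num at h
    exact h2.ne h.symm
  have hz : zeroExt (hL.toLp w) =ᵐ[volume] w := zeroExt_ae_eq hL.coeFn_toLp h0
  obtain ⟨v, hv⟩ := exists_of_gagSq_lt_top (α := α) (hL.toLp w) (by rwa [gagSq_congr α hz])
  refine ⟨v, by rwa [hv], ?_⟩
  rw [enorm_sq, hv, gagSq_congr α hz, ← lintegral_zeroExt]
  congr 1
  exact lintegral_congr_ae (hz.mono fun x hx => by simp only [hx])

theorem exists_of_isTestFunction (hα₀ : 0 < α) (hα₂ : α < 2) {φ : ℝ → ℝ} (hφ : IsTestFunction φ) :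
    ∃ v : H0Space α, zeroExt (incl α v) =ᵐ[volume] φ := by
  obtain ⟨h1, h2, h3⟩ := hφ
  obtain ⟨v, hv, -⟩ := exists_of_fun (α := α) h1.continuous.measurable
    (fun x hx => image_eq_zero_of_notMem_tsupport fun h => hx (h3 h)) (by
      rw [← eLpNorm_two_sq]
      exact ENNReal.pow_lt_top (h1.continuous.memLp_of_hasCompactSupport h2).2)
    (gagSq_lt_top_of_contDiff hα₀ hα₂ h1 h2)
  exact ⟨v, hv⟩

end H0Space

section Mollify

/-- Mollification of a function on the line by a bump function. -/
def mollify (η : ContDiffBump (0 : ℝ)) (u : ℝ → ℝ) (x : ℝ) : ℝ :=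
  ∫ z, η.normed volume z * u (x - z)

variable (η : ContDiffBump (0 : ℝ))

theorem mollify_eq_convolution (u : ℝ → ℝ) :
    mollify η u = convolution (η.normed volume) u (ContinuousLinearMap.mul ℝ ℝ) volume := rfl

theorem contDiff_mollify {u : ℝ → ℝ} (hu : Integrable u) : ContDiff ℝ ∞ (mollify η u) := by
  rw [mollify_eq_convolution]
  exact η.hasCompactSupport_normed.contDiff_convolution_left _ η.contDiff_normed
    hu.locallyIntegrable

theorem mollify_eq_zero {u : ℝ → ℝ} {r : ℝ} (hu : ∀ x, r ≤ |x| → u x = 0) {x : ℝ}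
    (hx : r + η.rOut ≤ |x|) : mollify η u x = 0 := by
  rw [mollify]
  refine integral_eq_zero_of_ae (ae_of_all _ fun z => ?_)
  by_cases hz : |z| < η.rOut
  · have : r ≤ |x - z| := by linarith [abs_sub_abs_le_abs_sub x z]
    simp [hu _ this]
  · have : z ∉ Function.support (η.normed volume) := by
      rw [η.support_normed_eq]
      simpa using hz
    simp [Function.notMem_support.1 this]

theorem enorm_integral_normed_mul_sq_le {g : ℝ → ℝ} (hg : Measurable g) :
    ‖∫ z, η.normed volume z * g z‖ₑ ^ 2 ≤
      ∫⁻ z, ENNReal.ofReal (η.normed volume z) * ‖g z‖ₑ ^ 2 := by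
  set μ := (volume : Measure ℝ).withDensity fun z => ENNReal.ofReal (η.normed volume z) with hμ
  have hmeas : Measurable fun z => ENNReal.ofReal (η.normed volume z) :=
    η.continuous_normed.measurable.ennreal_ofReal
  have h1 : μ univ = 1 := by
    rw [hμ, withDensity_apply _ MeasurableSet.univ, Measure.restrict_univ,
      ← ofReal_integral_eq_lintegral_ofReal η.integrable_normed (ae_of_all _ η.nonneg_normed),
      η.integral_normed, ENNReal.ofReal_one]
  calc _ ≤ (∫⁻ z, ‖η.normed volume z * g z‖ₑ) ^ 2 := by
        gcongr; exact enorm_integral_le_lintegral_enorm _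
    _ = (∫⁻ z, ‖g z‖ₑ ∂μ) ^ 2 := by
        rw [hμ, lintegral_withDensity_eq_lintegral_mul _ hmeas hg.enorm]
        simp only [Pi.mul_apply, enorm_mul, Real.enorm_of_nonneg (η.nonneg_normed _)]
    _ ≤ μ univ * ∫⁻ z, ‖g z‖ₑ ^ 2 ∂μ := lintegral_sq_le μ hg.enorm.aemeasurable
    _ = _ := by
        rw [h1, one_mul, hμ, lintegral_withDensity_eq_lintegral_mul _ hmeas (hg.enorm.pow_const 2)]
        simp only [Pi.mul_apply]

theorem integrable_normed_mul {u : ℝ → ℝ} (hu : Integrable u) (x : ℝ) :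
    Integrable fun z => η.normed volume z * u (x - z) := by
  obtain ⟨M, hM⟩ := η.hasCompactSupport_normed (μ := volume)
    |>.exists_bound_of_continuous η.continuous_normed
  exact (hu.comp_sub_left x).bdd_mul η.continuous_normed.aestronglyMeasurable (ae_of_all _ hM)

/-- Jensen's inequality for the probability density of the bump, combined with the invariance of the
double integral under diagonal translations. Only boundedness is needed, since the limit is taken
weakly. -/
theorem gagSq_mollify_le (α : ℝ) {u : ℝ → ℝ} (hm : Measurable u) (hu : Integrable u) :
    gagSq α (mollify η u) ≤ gagSq α u := by
  have hpt (p : ℝ × ℝ) : ‖diffQuot α (mollify η u) p‖ₑ ^ 2 ≤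
      ∫⁻ z, ENNReal.ofReal (η.normed volume z) * ‖diffQuot α u (p - (z, z))‖ₑ ^ 2 := by
    have h1 : diffQuot α (mollify η u) p =
        ∫ z, η.normed volume z * diffQuot α u (p - (z, z)) := by
      simp only [diffQuot, mollify]
      rw [← integral_sub (integrable_normed_mul η hu _) (integrable_normed_mul η hu _),
        ← integral_mul_const]
      congr 1 with z
      simp only [Prod.fst_sub, Prod.snd_sub, sub_sub_sub_cancel_right]
      ring
    rw [h1]
    exact enorm_integral_normed_mul_sq_le η ((measurable_diffQuot α hm).comp (by fun_prop))
  have hmd := measurable_diffQuot α hm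
  have hmn : Measurable (η.normed (volume : Measure ℝ)) := η.continuous_normed.measurable
  calc gagSq α (mollify η u)
      ≤ ∫⁻ p : ℝ × ℝ, ∫⁻ z, ENNReal.ofReal (η.normed volume z) *
          ‖diffQuot α u (p - (z, z))‖ₑ ^ 2 := lintegral_mono hpt
    _ = ∫⁻ z, ∫⁻ p : ℝ × ℝ, ENNReal.ofReal (η.normed volume z) *
          ‖diffQuot α u (p - (z, z))‖ₑ ^ 2 := by
        refine lintegral_lintegral_swap (Measurable.aemeasurable ?_)
        unfold Function.uncurry
        fun_prop
    _ = ∫⁻ z, ENNReal.ofReal (η.normed volume z) * gagSq α u := by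
        refine lintegral_congr fun z => ?_
        rw [lintegral_const_mul _ (by fun_prop), gagSq,
          lintegral_sub_right_eq_self (fun p => ‖diffQuot α u p‖ₑ ^ 2) (z, z)]
    _ = gagSq α u := by
        rw [lintegral_mul_const _ (by fun_prop),
          ← ofReal_integral_eq_lintegral_ofReal η.integrable_normed (ae_of_all _ η.nonneg_normed),
          η.integral_normed, ENNReal.ofReal_one, one_mul]

/-- The bump lives on `|z| < rOut` and is at most `2 / rOut` there, so it is bounded by `2 * rOut ^
α` times the kernel `|z| ^ (-1 - α)`. The relation `rOut = 2 * rIn` keeps the height of the bump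
comparable to `1 / rOut`. -/
theorem lintegral_mollify_sub_le {α : ℝ} (hα : 0 < α) {u : ℝ → ℝ} (hm : Measurable u)
    (hu : Integrable u) (hη : η.rOut = 2 * η.rIn) :
    ∫⁻ x, ‖mollify η u x - u x‖ₑ ^ 2 ≤
      ENNReal.ofReal (2 * η.rOut ^ α) * gagSq α u := by
  have hr := η.rOut_pos
  have hpt (x : ℝ) : ‖mollify η u x - u x‖ₑ ^ 2 ≤
      ENNReal.ofReal (2 * η.rOut ^ α) * ∫⁻ y, ‖diffQuot α u (x, y)‖ₑ ^ 2 := by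
    have h1 : mollify η u x - u x = ∫ z, η.normed volume z * (u (x - z) - u x) := by
      simp only [mul_sub]
      rw [integral_sub (integrable_normed_mul η hu _) (η.integrable_normed.mul_const _),
        integral_mul_const, η.integral_normed, one_mul, mollify]
    rw [h1]
    refine (enorm_integral_normed_mul_sq_le η (by fun_prop)).trans ?_
    rw [← lintegral_sub_left_eq_self (fun y => ‖diffQuot α u (x, y)‖ₑ ^ 2) x,
      ← lintegral_const_mul' _ _ ENNReal.ofReal_ne_top]
    refine lintegral_mono fun z => ?_
    rw [enorm_diffQuot_sq, ← ENNReal.ofReal_mul (by positivity), ← ofReal_norm,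
      ← ENNReal.ofReal_pow (norm_nonneg _), ← ENNReal.ofReal_mul (η.nonneg_normed _)]
    refine ENNReal.ofReal_le_ofReal ?_
    rw [Real.norm_eq_abs, sq_abs, sub_sub_cancel]
    rcases eq_or_ne z 0 with rfl | hz0
    · simp
    by_cases hz : |z| < η.rOut
    · have hz' : 0 < |z| := abs_pos.2 hz0
      have h2 : η.normed volume z ≤ 2 / η.rOut := by
        have h3 := η.normed_le_div_measure_closedBall_rIn (μ := volume) z
        have h4 : η.rOut ≤ volume.real (Metric.closedBall (0 : ℝ) η.rIn) := by
          rw [Real.volume_real_closedBall η.rIn_pos.le, hη]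
        refine h3.trans ?_
        have := one_div_le_one_div_of_le hr h4
        refine this.trans ?_
        gcongr; norm_num
      have h5 : |z| ^ (1 + α) ≤ η.rOut ^ (1 + α) :=
        Real.rpow_le_rpow hz'.le hz.le (by linarith)
      calc _ ≤ 2 / η.rOut * (u (x - z) - u x) ^ 2 :=
            mul_le_mul_of_nonneg_right h2 (sq_nonneg _)
        _ = 2 / η.rOut * |z| ^ (1 + α) * ((u x - u (x - z)) ^ 2 / |z| ^ (1 + α)) := by
            field_simp; ring
        _ ≤ 2 / η.rOut * η.rOut ^ (1 + α) * ((u x - u (x - z)) ^ 2 / |z| ^ (1 + α)) := by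
            gcongr
        _ = _ := by
            rw [Real.rpow_add hr, Real.rpow_one]
            field_simp
    · have : z ∉ Function.support (η.normed volume) := by
        rw [η.support_normed_eq]
        simpa using hz
      rw [Function.notMem_support.1 this, zero_mul]
      positivity
  rw [gagSq_eq_lintegral α hm, ← lintegral_const_mul' _ _ ENNReal.ofReal_ne_top]
  exact lintegral_mono hpt

end Mollify

end

/-! ### Density of test functions, and the operator of the energy form. -/

noncomputable section

section Dilation

theorem lintegral_comp_mul_left_le {a : ℝ} (ha : 1 ≤ a) {f : ℝ → ℝ≥0∞} (hf : Measurable f) :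
    ∫⁻ x, f (a * x) ≤ ∫⁻ x, f x := by
  have ha0 : 0 < a := by linarith
  rw [← lintegral_map hf (measurable_const_mul a), Real.map_volume_mul_left ha0.ne',
    lintegral_smul_measure]
  refine mul_le_of_le_one_left zero_le ?_
  rw [ENNReal.ofReal_le_one, abs_of_pos (inv_pos.2 ha0)]
  exact inv_le_one_of_one_le₀ ha

/-- The kernel scales by `a ^ (1 + α)`; the two changes of variable only help, since `a ≥ 1`. -/
theorem gagSq_dilate_le {α a : ℝ} (ha : 1 ≤ a) {u : ℝ → ℝ} (hm : Measurable u) :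
    gagSq α (fun x => u (a * x)) ≤ ENNReal.ofReal (a ^ (1 + α)) * gagSq α u := by
  have ha0 : 0 < a := by linarith
  have hmd := measurable_diffQuot α hm
  have hpt (x y : ℝ) : ‖diffQuot α (fun x => u (a * x)) (x, y)‖ₑ ^ 2 =
      ENNReal.ofReal (a ^ (1 + α)) * ‖diffQuot α u (a * x, a * y)‖ₑ ^ 2 := by
    rw [enorm_diffQuot_sq, enorm_diffQuot_sq, ← ENNReal.ofReal_mul (by positivity), ← mul_sub,
      abs_mul, abs_of_pos ha0, Real.mul_rpow ha0.le (abs_nonneg _)]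
    congr 1
    have : a ^ (1 + α) ≠ 0 := (Real.rpow_pos_of_pos ha0 _).ne'
    field_simp
  rw [gagSq_eq_lintegral α (by fun_prop), gagSq_eq_lintegral α hm]
  simp only [hpt]
  calc ∫⁻ x, ∫⁻ y, ENNReal.ofReal (a ^ (1 + α)) * ‖diffQuot α u (a * x, a * y)‖ₑ ^ 2
      = ENNReal.ofReal (a ^ (1 + α)) * ∫⁻ x, ∫⁻ y, ‖diffQuot α u (a * x, a * y)‖ₑ ^ 2 := by
        rw [← lintegral_const_mul' _ _ ENNReal.ofReal_ne_top]
        simp only [lintegral_const_mul' _ _ ENNReal.ofReal_ne_top]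
    _ ≤ ENNReal.ofReal (a ^ (1 + α)) * ∫⁻ x, ∫⁻ y, ‖diffQuot α u (a * x, y)‖ₑ ^ 2 := by
        refine mul_le_mul_right (lintegral_mono fun x => ?_) _
        exact lintegral_comp_mul_left_le ha (f := fun y => ‖diffQuot α u (a * x, y)‖ₑ ^ 2)
          (by fun_prop)
    _ ≤ _ := by
        refine mul_le_mul_right ?_ _
        exact lintegral_comp_mul_left_le ha (f := fun x => ∫⁻ y, ‖diffQuot α u (x, y)‖ₑ ^ 2)
          (Measurable.lintegral_prod_right' (f := fun p => ‖diffQuot α u p‖ₑ ^ 2) (by fun_prop))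

end Dilation

namespace H0Space

variable {α : ℝ}

theorem enorm_incl_sub_sq {v v' : H0Space α} {w w' : ℝ → ℝ}
    (hv : zeroExt (incl α v) =ᵐ[volume] w) (hv' : zeroExt (incl α v') =ᵐ[volume] w') :
    ‖incl α v - incl α v'‖ₑ ^ 2 = ∫⁻ x, ‖w x - w' x‖ₑ ^ 2 := by
  rw [← lintegral_zeroExt]
  refine lintegral_congr_ae ?_
  have h := zeroExt_smul (-1) (incl α v')
  rw [neg_one_smul] at h
  rw [sub_eq_add_neg]
  filter_upwards [zeroExt_add (incl α v) (-incl α v'), h, hv, hv'] with x h1 h2 h3 h4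
  rw [h1, h2, h3, h4, neg_one_mul, ← sub_eq_add_neg]

theorem norm_sq_le_of_enorm_sq_le {E : Type*} [SeminormedAddCommGroup E] {x : E} {c : ℝ≥0∞}
    (hc : c ≠ ⊤) (h : ‖x‖ₑ ^ 2 ≤ c) : ‖x‖ ^ 2 ≤ c.toReal := by
  rw [← ofReal_norm, ← ENNReal.ofReal_pow (norm_nonneg _)] at h
  exact (ENNReal.ofReal_le_iff_le_toReal hc).1 h

theorem inner_incl_eq (k : L2Omega) {z : H0Space α} {φ : ℝ → ℝ}
    (hz : zeroExt (incl α z) =ᵐ[volume] φ) : inner ℝ k (incl α z) = ∫ x in Omega, k x * φ x := by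
  rw [L2.inner_def]
  refine integral_congr_ae ?_
  filter_upwards [ae_restrict_of_ae hz, ae_restrict_mem measurableSet_Omega] with x hx hm
  rw [← hx, zeroExt_of_mem _ hm]
  simp [mul_comm]

theorem tendsto_integral_dilate {u : ℝ → ℝ} (hi : Integrable u) (b : BoundedContinuousFunction ℝ ℝ) :
    Tendsto (fun n : ℕ => ∫ x, u ((1 + 1 / ((n : ℝ) + 1)) * x) * b x) atTop (𝓝 (∫ x, u x * b x)) := by
  have ha : Tendsto (fun n : ℕ => (1 + 1 / ((n : ℝ) + 1))) atTop (𝓝 1) := by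
    simpa using tendsto_one_div_add_atTop_nhds_zero_nat.const_add (1 : ℝ)
  have ha0 (n : ℕ) : 0 < 1 + 1 / ((n : ℝ) + 1) := by positivity
  have hinv : Tendsto (fun n : ℕ => (1 + 1 / ((n : ℝ) + 1))⁻¹) atTop (𝓝 1) := by
    simpa using ha.inv₀ one_ne_zero
  have h1 (n : ℕ) : ∫ x, u ((1 + 1 / ((n : ℝ) + 1)) * x) * b x =
      (1 + 1 / ((n : ℝ) + 1))⁻¹ * ∫ y, u y * b ((1 + 1 / ((n : ℝ) + 1))⁻¹ * y) := by
    have h2 := Measure.integral_comp_mul_left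
      (fun y => u y * b ((1 + 1 / ((n : ℝ) + 1))⁻¹ * y)) (1 + 1 / ((n : ℝ) + 1))
    rw [abs_of_pos (inv_pos.2 (ha0 n)), smul_eq_mul] at h2
    rw [← h2]
    simp only [inv_mul_cancel_left₀ (ha0 n).ne']
  simp only [h1]
  rw [← one_mul (∫ x, u x * b x)]
  refine hinv.mul ?_
  refine tendsto_integral_of_dominated_convergence (fun x => ‖u x‖ * ‖b‖) (fun n => ?_)
    (hi.norm.mul_const _) (fun n => ae_of_all _ fun x => ?_) (ae_of_all _ fun x => ?_)
  · exact hi.aestronglyMeasurable.mul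
      (b.continuous.comp (continuous_const_mul _)).aestronglyMeasurable
  · rw [norm_mul]
    exact mul_le_mul_of_nonneg_left (b.norm_coe_le_norm _) (norm_nonneg _)
  · refine tendsto_const_nhds.mul ?_
    have : Tendsto (fun n : ℕ => (1 + 1 / ((n : ℝ) + 1))⁻¹ * x) atTop (𝓝 (1 * x)) :=
      hinv.mul_const x
    rw [one_mul] at this
    exact (b.continuous.tendsto x).comp this

section Density

variable {W : Submodule ℝ (H0Space α)}
  (hT : ∀ φ, IsTestFunction φ → ∀ v : H0Space α, zeroExt (incl α v) =ᵐ[volume] φ → v ∈ W)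
include hT

/-- Room between the support and the boundary of `Ω` makes fine mollifications test functions. They
are bounded in the energy space and converge in `L²(Ω)`, which is enough by `mem_of_weak_limit`. -/
theorem mem_of_support_subset (hα₀ : 0 < α) (hα₂ : α < 2) (hW : IsClosed (W : Set (H0Space α)))
    {w : ℝ → ℝ} (hm : Measurable w) (hi : Integrable w) {r : ℝ}
    (hr : r < Real.pi) (h0 : ∀ x, r ≤ |x| → w x = 0) {v : H0Space α}
    (hv : zeroExt (incl α v) =ᵐ[volume] w) : v ∈ W := by
  have hδ : ∀ n : ℕ, 0 < (Real.pi - r) / (n + 2) := fun n => div_pos (by linarith) (by positivity)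
  set η : ℕ → ContDiffBump (0 : ℝ) := fun n =>
    ⟨(Real.pi - r) / (n + 2) / 2, (Real.pi - r) / (n + 2), by linarith [hδ n],
      by linarith [hδ n]⟩ with hη
  have hηr (n : ℕ) : (η n).rOut = 2 * (η n).rIn := by simp only [hη]; ring
  have hηle (n : ℕ) : (η n).rOut ≤ (Real.pi - r) / 2 := by
    simp only [hη]
    exact div_le_div_of_nonneg_left (by linarith) (by norm_num) (by linarith [n.cast_nonneg (α := ℝ)])
  have hηlim : Tendsto (fun n => (η n).rOut) atTop (𝓝 0) := by
    simp only [hη]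
    exact tendsto_const_nhds.div_atTop
      (tendsto_atTop_add_const_right _ _ tendsto_natCast_atTop_atTop)
  have htest (n : ℕ) : IsTestFunction (mollify (η n) w) := by
    have hsub : tsupport (mollify (η n) w) ⊆ {x | |x| ≤ r + (η n).rOut} := by
      refine closure_minimal (fun x hx => ?_) (isClosed_le continuous_abs continuous_const)
      by_contra h
      rw [mem_ofPred_eq, not_le] at h
      exact hx (mollify_eq_zero (η n) h0 h.le)
    refine ⟨contDiff_mollify _ hi, ?_, fun x hx => ?_⟩
    · refine IsCompact.of_isClosed_subset (isCompact_Icc (a := -(r + (η n).rOut))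
        (b := r + (η n).rOut)) (isClosed_tsupport _) fun x hx => ?_
      exact abs_le.1 (hsub hx)
    · have h1 : |x| ≤ r + (η n).rOut := hsub hx
      have h2 := hηle n
      exact abs_lt.1 (by linarith)
  have hg : gagSq α w = gagSq α (zeroExt (incl α v)) := (gagSq_congr α hv).symm
  have hgt : gagSq α w ≠ ⊤ := by
    rw [hg, ← enorm_diff_sq]
    exact ENNReal.pow_ne_top enorm_ne_top
  choose z hz using fun n => exists_of_isTestFunction hα₀ hα₂ (htest n)
  set G := (gagSq α w).toReal
  have hdist (n : ℕ) : ‖incl α (z n) - incl α v‖ ^ 2 ≤ 2 * (η n).rOut ^ α * G := by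
    have hpos : 0 ≤ 2 * (η n).rOut ^ α := by have := (η n).rOut_pos; positivity
    have h1 : ‖incl α (z n) - incl α v‖ₑ ^ 2 ≤ ENNReal.ofReal (2 * (η n).rOut ^ α) * gagSq α w := by
      rw [enorm_incl_sub_sq (hz n) hv]
      exact lintegral_mollify_sub_le (η n) hα₀ hm hi (hηr n)
    have h2 := norm_sq_le_of_enorm_sq_le (ENNReal.mul_ne_top ENNReal.ofReal_ne_top hgt) h1
    rwa [ENNReal.toReal_mul, ENNReal.toReal_ofReal hpos] at h2
  have hlim : Tendsto (fun n => incl α (z n)) atTop (𝓝 (incl α v)) := by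
    rw [tendsto_iff_norm_sub_tendsto_zero]
    have h1 : Tendsto (fun n => √(2 * (η n).rOut ^ α * G)) atTop (𝓝 0) := by
      have h2 := ((hηlim.rpow_const (p := α) (Or.inr hα₀.le)).const_mul 2).mul_const G
      rw [Real.zero_rpow hα₀.ne', mul_zero, zero_mul] at h2
      simpa using h2.sqrt
    exact squeeze_zero (fun _ => norm_nonneg _) (fun n => Real.le_sqrt_of_sq_le (hdist n)) h1
  have hdiff (n : ℕ) : ‖diff α (z n)‖ ^ 2 ≤ G := by
    refine norm_sq_le_of_enorm_sq_le hgt ?_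
    rw [enorm_diff_sq, gagSq_congr α (hz n)]
    exact gagSq_mollify_le (η n) α hm hi
  obtain ⟨B, hB⟩ := hlim.norm.bddAbove_range
  have hbound (n : ℕ) : ‖z n‖ ≤ √(B ^ 2 + G) := by
    refine Real.le_sqrt_of_sq_le ?_
    rw [norm_sq]
    have := hB (mem_range_self n)
    exact add_le_add (pow_le_pow_left₀ (norm_nonneg _) this 2) (hdiff n)
  exact mem_of_weak_limit (incl α) incl_injective W hW hbound (fun n => hT _ (htest n) _ (hz n))
    dense_univ fun k _ => hlim.inner tendsto_const_nhds

/-- Test functions are dense in `H₀^{α/2}(Ω)`. -/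
theorem mem_of_forall_test_mem (hα₀ : 0 < α) (hα₂ : α < 2) (hW : IsClosed (W : Set (H0Space α)))
    (v : H0Space α) : v ∈ W := by
  set u := zeroExt (incl α v) with hu
  have hm : Measurable u := measurable_zeroExt _
  have hi : Integrable u := integrable_zeroExt _
  -- Composing with dilations of factor `a n > 1` shrinks the support strictly into `Ω`. As `a n →
  -- 1` the dilated functions stay bounded in the energy space; their convergence is tested against
  -- bounded continuous functions only.
  set a : ℕ → ℝ := fun n => 1 + 1 / ((n : ℝ) + 1) with ha
  have ha1 (n : ℕ) : 1 < a n := by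
    have : 0 < 1 / ((n : ℝ) + 1) := by positivity
    simp only [ha]; linarith
  have ha0 (n : ℕ) : 0 < a n := by linarith [ha1 n]
  have ha2 (n : ℕ) : a n ≤ 2 := by
    have : 1 / ((n : ℝ) + 1) ≤ 1 := by
      rw [div_le_one (by positivity)]; linarith [n.cast_nonneg (α := ℝ)]
    simp only [ha]; linarith
  have h0 (n : ℕ) (x : ℝ) (hx : Real.pi / a n ≤ |x|) : u (a n * x) = 0 := by
    refine zeroExt_of_notMem _ fun h => ?_
    have h1 : |a n * x| < Real.pi := abs_lt.2 h
    rw [abs_mul, abs_of_pos (ha0 n)] at h1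
    rw [div_le_iff₀' (ha0 n)] at hx
    linarith
  have hlt (n : ℕ) : Real.pi / a n < Real.pi := div_lt_self Real.pi_pos (ha1 n)
  have hgt : gagSq α u ≠ ⊤ := by
    rw [hu, ← enorm_diff_sq]; exact ENNReal.pow_ne_top enorm_ne_top
  have hut : ∫⁻ x, ‖u x‖ₑ ^ 2 ≠ ⊤ := by
    rw [hu, lintegral_zeroExt]; exact ENNReal.pow_ne_top enorm_ne_top
  have hL (n : ℕ) : ∫⁻ x, ‖u (a n * x)‖ₑ ^ 2 ≤ ∫⁻ x, ‖u x‖ₑ ^ 2 :=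
    lintegral_comp_mul_left_le (ha1 n).le (f := fun x => ‖u x‖ₑ ^ 2) (by fun_prop)
  have hG (n : ℕ) : gagSq α (fun x => u (a n * x)) ≤ ENNReal.ofReal (2 ^ (1 + α)) * gagSq α u := by
    refine (gagSq_dilate_le (ha1 n).le hm).trans ?_
    gcongr
    exact ha2 n
  have hct : ENNReal.ofReal (2 ^ (1 + α)) * gagSq α u ≠ ⊤ :=
    ENNReal.mul_ne_top ENNReal.ofReal_ne_top hgt
  choose z hz hzn using fun n => exists_of_fun (α := α) (w := fun x => u (a n * x))
    (hm.comp (measurable_const_mul _))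
    (fun x hx => h0 n x (by
      by_contra h
      exact hx (abs_lt.1 ((not_le.1 h).trans (hlt n)))))
    ((hL n).trans_lt hut.lt_top) ((hG n).trans_lt hct.lt_top)
  have hbound (n : ℕ) : ‖z n‖ ≤
      √((∫⁻ x, ‖u x‖ₑ ^ 2) + ENNReal.ofReal (2 ^ (1 + α)) * gagSq α u).toReal := by
    refine Real.le_sqrt_of_sq_le (norm_sq_le_of_enorm_sq_le (ENNReal.add_ne_top.2 ⟨hut, hct⟩) ?_)
    rw [hzn]
    exact add_le_add (hL n) (hG n)
  have hfin : IsFiniteMeasure (volume.restrict Omega) := by rw [Omega]; infer_instance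
  refine mem_of_weak_limit (incl α) incl_injective W hW hbound (fun n =>
    mem_of_support_subset hT hα₀ hα₂ hW (hm.comp (measurable_const_mul _))
      (hi.comp_mul_left' (ha0 n).ne') (hlt n) (h0 n) (hz n))
    (BoundedContinuousFunction.toLp_denseRange (p := 2) (μ := volume.restrict Omega) (E := ℝ)
      ℝ (by norm_num)) ?_
  rintro _ ⟨b, rfl⟩
  have hb : ∀ (y : H0Space α) (w : ℝ → ℝ), zeroExt (incl α y) =ᵐ[volume] w → (∀ x ∉ Omega, w x = 0) →
      inner ℝ (incl α y) (BoundedContinuousFunction.toLp 2 (volume.restrict Omega) ℝ b) =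
        ∫ x, w x * b x := by
    intro y w hy hw
    rw [real_inner_comm, inner_incl_eq _ hy, eq_comm,
      ← setIntegral_eq_integral_of_forall_compl_eq_zero (s := Omega)
        (fun x hx => by rw [hw x hx, zero_mul])]
    refine integral_congr_ae ?_
    filter_upwards [BoundedContinuousFunction.coeFn_toLp (volume.restrict Omega) ℝ b (p := 2)]
      with x hx
    rw [hx, mul_comm]
  rw [hb v u (ae_of_all _ fun _ => rfl) fun x hx => zeroExt_of_notMem _ hx]
  refine (tendsto_integral_dilate hi b).congr fun n => ?_
  rw [hb (z n) _ (hz n) fun x hx => h0 n x (by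
      by_contra h
      exact hx (abs_lt.1 ((not_le.1 h).trans (hlt n))))]

end Density

theorem inner_diff_eq (hα₀ : 0 < α) (hα₂ : α < 2) {φ : ℝ → ℝ} (hφ : IsTestFunction φ)
    (v : H0Space α) {z : H0Space α} (hz : zeroExt (incl α z) =ᵐ[volume] φ) :
    fracLapConst α / 2 * inner ℝ (diff α v) (diff α z) =
      ∫ x in Omega, incl α v x * fracLap α φ x := by
  obtain ⟨h1, h2, -⟩ := hφ
  have hae : (fun p : ℝ × ℝ => inner ℝ (diff α v p) (diff α z p)) =ᵐ[volume]
      fun p => diffQuot α (zeroExt (incl α v)) p * diffQuot α φ p := by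
    filter_upwards [diff_ae_eq v, diff_ae_eq z, diffQuot_congr α hz] with p ha hb hc
    rw [ha, hb, hc]; simp [mul_comm]
  have hint : Integrable fun p => diffQuot α (zeroExt (incl α v)) p * diffQuot α φ p :=
    (L2.integrable_inner (𝕜 := ℝ) (diff α v) (diff α z)).congr hae
  rw [L2.inner_def, integral_congr_ae hae,
    integral_diffQuot_mul hα₀ hα₂ h1 h2 (integrable_zeroExt _) hint, ← mul_assoc,
    div_mul_cancel₀ _ two_ne_zero, ← integral_const_mul,
    ← setIntegral_eq_integral_of_forall_compl_eq_zero (s := Omega)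
        (fun x hx => by rw [zeroExt_of_notMem _ hx, zero_mul, mul_zero])]
  refine setIntegral_congr_fun measurableSet_Omega fun x hx => ?_
  rw [zeroExt_of_mem _ hx, fracLap_eq hα₀ hα₂ h1 h2]
  ring

/-- The distributional fractional Laplacian is the operator associated with the energy form. -/
theorem hasFracLap_iff (hα₀ : 0 < α) (hα₂ : α < 2) (u h : L2Omega) :
    HasFracLap α u h ↔ ∃ v : H0Space α, incl α v = u ∧
      ∀ z, fracLapConst α / 2 * inner ℝ (diff α v) (diff α z) = inner ℝ h (incl α z) := by
  rw [HasFracLap, memH0_iff]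
  constructor
  · rintro ⟨⟨v, rfl⟩, hv⟩
    refine ⟨v, rfl, fun z => ?_⟩
    -- The defect of the weak equation is a continuous functional. Its kernel is closed and contains
    -- the test functions, hence is the whole space.
    set ℓ : H0Space α →L[ℝ] ℝ := (fracLapConst α / 2) • (innerSL ℝ (diff α v)).comp (diff α) -
      (innerSL ℝ h).comp (incl α) with hℓ
    have hmem : z ∈ (ℓ : H0Space α →ₗ[ℝ] ℝ).ker := by
      refine mem_of_forall_test_mem (W := (ℓ : H0Space α →ₗ[ℝ] ℝ).ker) (fun φ hφ y hy => ?_) hα₀ hα₂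
        ℓ.isClosed_ker z
      have h1 := inner_diff_eq hα₀ hα₂ hφ v hy
      rw [hv φ hφ, ← inner_incl_eq h hy] at h1
      simp [hℓ, h1]
    have : ℓ z = 0 := hmem
    simpa [hℓ, sub_eq_zero] using this
  · rintro ⟨v, rfl, hv⟩
    refine ⟨⟨v, rfl⟩, fun φ hφ => ?_⟩
    obtain ⟨z, hz⟩ := exists_of_isTestFunction hα₀ hα₂ hφ
    rw [← inner_diff_eq hα₀ hα₂ hφ v hz, hv, inner_incl_eq h hz]

end H0Space

end

/-! ### Calculus in a Hilbert basis, and the spectral resolution of the fractional Laplacian. -/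

noncomputable section

namespace HilbertBasis

variable {ι X : Type*} [NormedAddCommGroup X] [InnerProductSpace ℝ X]
  (e : HilbertBasis ι ℝ X)

theorem ext_inner {x y : X} (h : ∀ i, inner ℝ (e i) x = inner ℝ (e i) y) : x = y := by
  apply e.repr.injective
  ext i
  rw [e.repr_apply_apply, e.repr_apply_apply, h]

theorem hasSum_inner_sq (x : X) : HasSum (fun i => inner ℝ (e i) x ^ 2) (‖x‖ ^ 2) := by
  have h := e.hasSum_inner_mul_inner x x
  rw [real_inner_self_eq_norm_sq] at h
  refine h.congr_fun fun i => ?_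
  rw [sq, real_inner_comm]

theorem sum_inner_sq_le (x : X) (F : Finset ι) : ∑ i ∈ F, inner ℝ (e i) x ^ 2 ≤ ‖x‖ ^ 2 :=
  sum_le_hasSum F (fun _ _ => sq_nonneg _) (e.hasSum_inner_sq x)

theorem exists_inner_eq {a : ι → ℝ} (ha : Summable fun i => a i ^ 2) :
    ∃ x : X, ∀ i, inner ℝ (e i) x = a i := by
  have hm : Memℓp a 2 := by
    refine memℓp_gen ?_
    simpa using ha
  refine ⟨e.repr.symm ⟨a, hm⟩, fun i => ?_⟩
  rw [← e.repr_apply_apply, LinearIsometryEquiv.apply_symm_apply]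

/-- Convergence of the coefficients with a square summable bound gives convergence in norm. -/
theorem tendsto_of_inner {κ : Type*} {l : Filter κ} {x : κ → X} {y : X} {M : ι → ℝ}
    (hM : Summable M) (hb : ∀ᶠ a in l, ∀ i, inner ℝ (e i) (x a) ^ 2 ≤ M i)
    (h : ∀ i, Tendsto (fun a => inner ℝ (e i) (x a)) l (𝓝 (inner ℝ (e i) y))) :
    Tendsto x l (𝓝 y) := by
  rw [tendsto_iff_norm_sub_tendsto_zero]
  have h1 : Tendsto (fun a => ∑' i, (inner ℝ (e i) (x a) - inner ℝ (e i) y) ^ 2) l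
      (𝓝 (∑' _ : ι, (0 : ℝ))) := by
    refine tendsto_tsum_of_dominated_convergence
      (bound := fun i => 2 * M i + 2 * inner ℝ (e i) y ^ 2)
      ((hM.mul_left 2).add ((e.hasSum_inner_sq y).summable.mul_left 2)) (fun i => ?_) ?_
    · have := ((h i).sub_const (inner ℝ (e i) y)).pow 2
      simpa using this
    · filter_upwards [hb] with a ha i
      rw [Real.norm_of_nonneg (sq_nonneg _)]
      nlinarith [ha i, sq_nonneg (inner ℝ (e i) (x a) + inner ℝ (e i) y)]
  rw [tsum_zero] at h1
  have h2 := h1.sqrt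
  rw [Real.sqrt_zero] at h2
  refine h2.congr fun a => ?_
  rw [← Real.sqrt_sq (norm_nonneg (x a - y)), ← (e.hasSum_inner_sq (x a - y)).tsum_eq]
  simp only [inner_sub_right]

theorem continuousOn_of_inner {Y : Type*} [TopologicalSpace Y] {s : Set Y} {x : Y → X} {M : ι → ℝ}
    (hM : Summable M) (hb : ∀ a ∈ s, ∀ i, inner ℝ (e i) (x a) ^ 2 ≤ M i)
    (h : ∀ i, ContinuousOn (fun a => inner ℝ (e i) (x a)) s) : ContinuousOn x s := fun a ha =>
  e.tendsto_of_inner hM (eventually_mem_nhdsWithin.mono hb) fun i => h i a ha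

theorem exists_diagonal {m : ι → ℝ} {C : ℝ} (hm : ∀ i, |m i| ≤ C) :
    ∃ D : X →L[ℝ] X, ∀ w i, inner ℝ (e i) (D w) = m i * inner ℝ (e i) w := by
  have hbd (w : X) (i : ι) : (m i * inner ℝ (e i) w) ^ 2 ≤ C ^ 2 * inner ℝ (e i) w ^ 2 := by
    rw [mul_pow, ← sq_abs (m i)]
    exact mul_le_mul_of_nonneg_right (pow_le_pow_left₀ (abs_nonneg _) (hm i) 2) (sq_nonneg _)
  have hs (w : X) : Summable fun i => (m i * inner ℝ (e i) w) ^ 2 :=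
    Summable.of_nonneg_of_le (fun i => sq_nonneg _) (hbd w)
      ((e.hasSum_inner_sq w).summable.mul_left _)
  choose D hD using fun w => e.exists_inner_eq (hs w)
  refine ⟨LinearMap.mkContinuous
    { toFun := D
      map_add' := fun x y => e.ext_inner fun i => by
        rw [hD, inner_add_right, inner_add_right, hD, hD, mul_add]
      map_smul' := fun c x => e.ext_inner fun i => by
        rw [hD, inner_smul_right, RingHom.id_apply, inner_smul_right, hD]; ring } |C| fun w => ?_,
    hD⟩
  refine le_of_sq_le_sq ?_ (by positivity)
  rw [mul_pow, sq_abs]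
  refine hasSum_le (fun i => ?_) (e.hasSum_inner_sq (D w)) ((e.hasSum_inner_sq w).mul_left (C ^ 2))
  rw [hD]
  exact hbd w i

end HilbertBasis

theorem fracLapConst_pos {α : ℝ} (hα₀ : 0 < α) (hα₂ : α < 2) : 0 < fracLapConst α := by
  unfold fracLapConst
  have h1 : 0 < Real.Gamma ((1 + α) / 2) := Real.Gamma_pos_of_pos (by linarith)
  have h2 : 0 < Real.Gamma (1 - α / 2) := Real.Gamma_pos_of_pos (by linarith)
  have := Real.pi_pos
  positivity

/-- A spectral resolution of the fractional Laplacian in `L²(Ω)`: the basis `e` consists of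
eigenvectors with eigenvalues `γ (ν i - 1)`, and `B` is a unitary map of `L²(Ω)` onto
`H₀^{α/2}(Ω)`, diagonal in this basis. -/
structure FracSpectrum (α : ℝ) where
  ι : Type
  e : HilbertBasis ι ℝ L2Omega
  ν : ι → ℝ
  γ : ℝ
  B : L2Omega →L[ℝ] L2Omega
  one_le : ∀ i, 1 ≤ ν i
  γ_pos : 0 < γ
  inner_B : ∀ w i, inner ℝ (e i) (B w) = (√(ν i))⁻¹ * inner ℝ (e i) w
  memH0_iff : ∀ u, MemH0 α u ↔ ∃ w, B w = u
  eH0Norm_B : ∀ w, eH0Norm α (B w) = ‖w‖ₑ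
  hasFracLap_iff : ∀ u h, HasFracLap α u h ↔
    ∀ i, inner ℝ (e i) h = γ * (ν i - 1) * inner ℝ (e i) u

/-- Density of the energy space in `L²(Ω)`, by the fundamental lemma of the calculus of variations
on test functions. -/
theorem inner_incl_eq_zero {α : ℝ} (hα₀ : 0 < α) (hα₂ : α < 2) {h : L2Omega}
    (hh : ∀ v : H0Space α, inner ℝ h (H0Space.incl α v) = 0) : h = 0 := by
  have hfin : IsFiniteMeasure (volume.restrict Omega) := by rw [Omega]; infer_instance
  have h1 : ∀ᵐ x ∂(volume : Measure ℝ), x ∈ Omega → h x = 0 := by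
    refine IsOpen.ae_eq_zero_of_integral_contDiff_smul_eq_zero isOpen_Ioo ?_ fun φ h1 h2 h3 => ?_
    · have : IntegrableOn h Omega := (Lp.memLp h).integrable (by norm_num)
      exact this.locallyIntegrableOn
    · obtain ⟨v, hv⟩ := H0Space.exists_of_isTestFunction hα₀ hα₂ (φ := φ) ⟨h1, h2, h3⟩
      have h4 := hh v
      rw [H0Space.inner_incl_eq h hv] at h4
      rw [← h4, ← setIntegral_eq_integral_of_forall_compl_eq_zero (s := Omega)
        (fun x hx => by
          rw [image_eq_zero_of_notMem_tsupport fun h => hx (h3 h), zero_smul])]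
      simp only [smul_eq_mul, mul_comm]
  refine Lp.ext ?_
  filter_upwards [(ae_restrict_iff' measurableSet_Omega).2 h1,
    Lp.coeFn_zero ℝ 2 (volume.restrict Omega)] with x hx hx'
  rw [hx, hx']; rfl

/-- The Gagliardo form is the inner product of the energy space minus that of `L²(Ω)`, so in the
basis diagonalising the embedding it acts as `ν i - 1`. The factor `γ` is half of `fracLapConst α`,
because the double integral counts each pair of points twice. -/
theorem nonempty_fracSpectrum {α : ℝ} (hα₀ : 0 < α) (hα₂ : α < 2) : Nonempty (FracSpectrum α) := by
  obtain ⟨ι, e, ν, W, hν, hB⟩ := exists_hilbertBasis_of_compact_embedding (H0Space.incl α)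
    (isCompactOperator_incl hα₀) H0Space.incl_injective
    (fun h hh => inner_incl_eq_zero hα₀ hα₂ hh) H0Space.norm_incl_le
  have hγ : 0 < fracLapConst α / 2 := half_pos (fracLapConst_pos hα₀ hα₂)
  set γ := fracLapConst α / 2 with hγd
  set B : L2Omega →L[ℝ] L2Omega :=
    (H0Space.incl α).comp (W.toContinuousLinearEquiv : L2Omega →L[ℝ] H0Space α) with hBd
  have hBapp (w) : B w = H0Space.incl α (W w) := rfl
  have hBi (w i) : inner ℝ (e i) (B w) = (√(ν i))⁻¹ * inner ℝ (e i) w := hB w i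
  have hsq (i) : 0 < √(ν i) := Real.sqrt_pos.2 (by linarith [hν i])
  have hBe (i) : B (e i) = (√(ν i))⁻¹ • e i := by
    refine e.ext_inner fun k => ?_
    rw [hBi, inner_smul_right]
    rcases eq_or_ne k i with rfl | hki
    · rfl
    · rw [e.orthonormal.2 hki, mul_zero, mul_zero]
  have hsymm (k y : L2Omega) : inner ℝ (B k) y = inner ℝ k (B y) := by
    rw [← e.tsum_inner_mul_inner (B k) y, ← e.tsum_inner_mul_inner k (B y)]
    refine tsum_congr fun i => ?_
    rw [hBi, real_inner_comm, hBi, real_inner_comm (e i) k]; ring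
  have hform (u h : L2Omega) (w y : L2Omega) (hw : B w = u) :
      γ * inner ℝ (H0Space.diff α (W w)) (H0Space.diff α (W y)) =
        γ * (inner ℝ w y - inner ℝ u (B y)) := by
    have := H0Space.inner_eq (W w) (W y)
    rw [W.inner_map_map, ← hBapp, ← hBapp, hw] at this
    rw [this]; ring
  refine ⟨⟨ι, e, ν, γ, B, hν, hγ, hBi, fun u => ?_, fun w => ?_, fun u h => ?_⟩⟩
  · rw [H0Space.memH0_iff]
    exact ⟨fun ⟨v, hv⟩ => ⟨W.symm v, by simpa [hBapp] using hv⟩, fun ⟨w, hw⟩ => ⟨W w, hw⟩⟩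
  · rw [hBapp, H0Space.eH0Norm_incl]
    simp
  · rw [H0Space.hasFracLap_iff hα₀ hα₂]
    constructor
    · rintro ⟨v, hv, hz⟩ i
      have hwu : B (W.symm v) = u := by simpa [hBapp] using hv
      have h1 := hz (W (e i))
      rw [← hγd, ← W.apply_symm_apply v, hform u h _ _ hwu, ← hBapp, hBe, inner_smul_right,
        inner_smul_right] at h1
      have h2 := hBi (W.symm v) i
      rw [hwu] at h2
      rw [real_inner_comm (e i) (W.symm v), real_inner_comm (e i) u, real_inner_comm (e i) h] at h1
      have h3 := (hsq i).ne'
      have h4 : √(ν i) ^ 2 = ν i := Real.sq_sqrt (by linarith [hν i])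
      rw [h2] at h1 ⊢
      field_simp at h1 ⊢
      rw [h4] at h1
      linarith
    · intro hi
      -- The coefficients of `k` are `ν i` times those of `u`, so `u = B (B k)`; this puts `u` in
      -- the energy space, with `B k` as its representative.
      set k : L2Omega := γ⁻¹ • h + u with hk
      have hki (i) : inner ℝ (e i) k = ν i * inner ℝ (e i) u := by
        rw [hk, inner_add_right, inner_smul_right, hi]
        field_simp; ring
      have hu : B (B k) = u := by
        refine e.ext_inner fun i => ?_
        have h4 : √(ν i) * √(ν i) = ν i := Real.mul_self_sqrt (by linarith [hν i])
        rw [hBi, hBi, hki, ← mul_assoc, ← mul_assoc, ← mul_inv, h4,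
          inv_mul_cancel₀ (by linarith [hν i]), one_mul]
      refine ⟨W (B k), hu, fun z => ?_⟩
      rw [← W.apply_symm_apply z, ← hγd, hform u h _ _ hu, hsymm, ← hBapp, hk, inner_add_left,
        inner_smul_left]
      simp only [map_inv₀, RCLike.conj_to_real, add_sub_cancel_right]
      field_simp

end

/-! ### The semigroup, and its determination by the generator. -/

noncomputable section

namespace FracSpectrum

variable {α : ℝ} (Φ : FracSpectrum α)

/-- The eigenvalues of the fractional Laplacian. -/
def eig (i : Φ.ι) : ℝ := Φ.γ * (Φ.ν i - 1)

theorem eig_nonneg (i : Φ.ι) : 0 ≤ Φ.eig i :=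
  mul_nonneg Φ.γ_pos.le (by linarith [Φ.one_le i])

theorem ν_pos (i : Φ.ι) : 0 < Φ.ν i := by linarith [Φ.one_le i]

theorem sq_sqrt_ν (i : Φ.ι) : √(Φ.ν i) ^ 2 = Φ.ν i := Real.sq_sqrt (Φ.ν_pos i).le

theorem sqrt_ν_pos (i : Φ.ι) : 0 < √(Φ.ν i) := Real.sqrt_pos.2 (Φ.ν_pos i)

theorem exists_heat (t : ℝ) : ∃ D : L2Omega →L[ℝ] L2Omega, ∀ w i,
    inner ℝ (Φ.e i) (D w) = Real.exp (-(Φ.eig i * max t 0)) * inner ℝ (Φ.e i) w := by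
  refine Φ.e.exists_diagonal (C := 1) fun i => ?_
  rw [abs_of_pos (Real.exp_pos _), Real.exp_le_one_iff, neg_nonpos]
  exact mul_nonneg (Φ.eig_nonneg i) (le_max_right _ _)

/-- The heat semigroup, diagonal in the basis of eigenvectors. -/
def heat (t : ℝ) : L2Omega →L[ℝ] L2Omega := (Φ.exists_heat t).choose

theorem inner_heat {t : ℝ} (ht : 0 ≤ t) (w : L2Omega) (i : Φ.ι) :
    inner ℝ (Φ.e i) (Φ.heat t w) = Real.exp (-(Φ.eig i * t)) * inner ℝ (Φ.e i) w := by
  have h : inner ℝ (Φ.e i) (Φ.heat t w) =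
    Real.exp (-(Φ.eig i * max t 0)) * inner ℝ (Φ.e i) w := (Φ.exists_heat t).choose_spec w i
  rwa [max_eq_left ht] at h

theorem inner_heat_sq_le {t : ℝ} (ht : 0 ≤ t) (w : L2Omega) (i : Φ.ι) :
    inner ℝ (Φ.e i) (Φ.heat t w) ^ 2 ≤ inner ℝ (Φ.e i) w ^ 2 := by
  rw [Φ.inner_heat ht, mul_pow]
  refine mul_le_of_le_one_left (sq_nonneg _) (pow_le_one₀ (Real.exp_pos _).le ?_)
  rw [Real.exp_le_one_iff, neg_nonpos]
  exact mul_nonneg (Φ.eig_nonneg i) ht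

theorem norm_heat_le {t : ℝ} (ht : 0 ≤ t) (w : L2Omega) : ‖Φ.heat t w‖ ≤ ‖w‖ :=
  le_of_sq_le_sq (hasSum_le (Φ.inner_heat_sq_le ht w) (Φ.e.hasSum_inner_sq _)
    (Φ.e.hasSum_inner_sq w)) (norm_nonneg _)

theorem continuousOn_heat (w : L2Omega) : ContinuousOn (fun t => Φ.heat t w) (Ici 0) := by
  refine Φ.e.continuousOn_of_inner (Φ.e.hasSum_inner_sq w).summable
    (fun t ht i => Φ.inner_heat_sq_le ht w i) fun i => ?_
  have : ContinuousOn (fun t => Real.exp (-(Φ.eig i * t)) * inner ℝ (Φ.e i) w) (Ici 0) := by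
    fun_prop
  exact this.congr fun t ht => Φ.inner_heat ht w i

theorem tendsto_exp_quotient (m : ℝ) :
    Tendsto (fun t : ℝ => t⁻¹ * (Real.exp (-(m * t)) - 1)) (𝓝[>] 0) (𝓝 (-m)) := by
  have h : HasDerivAt (fun t : ℝ => Real.exp (-(m * t))) (-m) 0 := by
    have h1 : HasDerivAt (fun t : ℝ => -(m * t)) (-m) 0 := by
      simpa using! ((hasDerivAt_id (0 : ℝ)).const_mul m).neg
    simpa using h1.exp
  have h2 := h.tendsto_slope_zero_right
  refine h2.congr fun t => ?_
  simp

theorem heat_generator (w h : L2Omega) :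
    Tendsto (fun t : ℝ => t⁻¹ • (Φ.heat t w - w)) (𝓝[>] 0) (𝓝 h) ↔ HasFracLap α w (-h) := by
  rw [Φ.hasFracLap_iff]
  have hco {t : ℝ} (ht : t ∈ Ioi (0 : ℝ)) (i : Φ.ι) :
      inner ℝ (Φ.e i) (t⁻¹ • (Φ.heat t w - w)) =
        t⁻¹ * (Real.exp (-(Φ.eig i * t)) - 1) * inner ℝ (Φ.e i) w := by
    rw [inner_smul_right, inner_sub_right, Φ.inner_heat (le_of_lt ht)]; ring
  have hlim (i : Φ.ι) : Tendsto (fun t : ℝ => inner ℝ (Φ.e i) (t⁻¹ • (Φ.heat t w - w))) (𝓝[>] 0)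
      (𝓝 (-Φ.eig i * inner ℝ (Φ.e i) w)) := by
    refine ((tendsto_exp_quotient (Φ.eig i)).mul_const _).congr' ?_
    filter_upwards [self_mem_nhdsWithin] with t ht
    exact (hco ht i).symm
  constructor
  · intro ht i
    have h1 := tendsto_nhds_unique (hlim i) ((tendsto_const_nhds (x := Φ.e i)).inner ht)
    rw [inner_neg_right, ← h1, eig]; ring
  · intro hi
    refine Φ.e.tendsto_of_inner (M := fun i => inner ℝ (Φ.e i) h ^ 2)
      (Φ.e.hasSum_inner_sq h).summable ?_ fun i => ?_
    · filter_upwards [self_mem_nhdsWithin] with t ht i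
      have ht0 : 0 < t := ht
      have h1 : inner ℝ (Φ.e i) h = -(Φ.eig i * inner ℝ (Φ.e i) w) := by
        have := hi i
        rw [inner_neg_right] at this
        rw [eig]; linarith
      rw [hco ht, h1, neg_sq, mul_pow, mul_pow (Φ.eig i), ← sq_abs (t⁻¹ * _)]
      refine mul_le_mul_of_nonneg_right (pow_le_pow_left₀ (abs_nonneg _) ?_ 2) (sq_nonneg _)
      -- Since `1 - exp (-λ t) ≤ λ t`, the difference quotients are dominated mode by mode by the
      -- coefficients of `h`, which are square summable.
      rw [abs_mul, abs_of_pos (inv_pos.2 ht0), inv_mul_le_iff₀ ht0, abs_of_nonpos]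
      · have := Real.add_one_le_exp (-(Φ.eig i * t))
        linarith
      · rw [sub_nonpos, Real.exp_le_one_iff, neg_nonpos]
        exact mul_nonneg (Φ.eig_nonneg i) ht0.le
    · have h1 := hi i
      rw [inner_neg_right] at h1
      have h2 := hlim i
      rwa [show -Φ.eig i * inner ℝ (Φ.e i) w = inner ℝ (Φ.e i) h by rw [eig]; linarith] at h2

theorem isFracHeatSemigroup_heat : IsFracHeatSemigroup α Φ.heat where
  zero := by
    ext1 w
    refine Φ.e.ext_inner fun i => ?_
    rw [Φ.inner_heat le_rfl]; simp
  add s t hs ht := by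
    ext1 w
    refine Φ.e.ext_inner fun i => ?_
    rw [ContinuousLinearMap.comp_apply, Φ.inner_heat (add_nonneg hs ht), Φ.inner_heat hs,
      Φ.inner_heat ht, ← mul_assoc, ← Real.exp_add]
    congr 2; ring
  continuousOn := Φ.continuousOn_heat
  generator := Φ.heat_generator

theorem hasFracLap_basis (i : Φ.ι) : HasFracLap α (Φ.e i) (Φ.eig i • Φ.e i) := by
  rw [Φ.hasFracLap_iff]
  intro k
  rw [inner_smul_right]
  rcases eq_or_ne k i with rfl | hki
  · rfl
  · rw [Φ.e.orthonormal.2 hki, mul_zero, mul_zero]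

/-- The generator acts on `e i` by the scalar `-m`, `m` being the eigenvalue. By the semigroup law
`exp (m t) • S t (e i)` then has right derivative zero everywhere, so it is constant. -/
theorem semigroup_apply_basis {S : ℝ → L2Omega →L[ℝ] L2Omega} (hS : IsFracHeatSemigroup α S)
    {T : ℝ} (hT : 0 ≤ T) (i : Φ.ι) : S T (Φ.e i) = Real.exp (-(Φ.eig i * T)) • Φ.e i := by
  set m := Φ.eig i with hm
  have hgen : Tendsto (fun t : ℝ => t⁻¹ • (S t (Φ.e i) - Φ.e i)) (𝓝[>] 0) (𝓝 (-(m • Φ.e i))) :=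
    (hS.generator _ _).2 (by rw [neg_neg]; exact Φ.hasFracLap_basis i)
  have hcont : ContinuousOn (fun t => Real.exp (m * t) • S t (Φ.e i)) (Icc 0 T) :=
    ContinuousOn.smul (f := fun t => Real.exp (m * t)) (by fun_prop) ((hS.continuousOn _).mono Icc_subset_Ici_self)
  have hder : ∀ t ∈ Ico 0 T, HasDerivWithinAt (fun t => Real.exp (m * t) • S t (Φ.e i)) 0 (Ici t) t := by
    intro t ht
    have h1 : HasDerivWithinAt (fun t => S t (Φ.e i)) (-(m • S t (Φ.e i))) (Ici t) t := by
      rw [← hasDerivWithinAt_Ioi_iff_Ici, hasDerivWithinAt_iff_tendsto_slope' self_notMem_Ioi]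
      have h2 := ((S t).continuous.tendsto _).comp hgen
      have h3 : Tendsto (fun s : ℝ => s - t) (𝓝[>] t) (𝓝[>] 0) := by
        refine tendsto_nhdsWithin_iff.2 ⟨?_, ?_⟩
        · have : Tendsto (fun s : ℝ => s - t) (𝓝 t) (𝓝 (t - t)) := tendsto_id.sub_const t
          rw [sub_self] at this
          exact this.mono_left nhdsWithin_le_nhds
        · filter_upwards [self_mem_nhdsWithin] with s hs
          exact sub_pos.2 (mem_Ioi.1 hs)
      have h4 := h2.comp h3
      rw [map_neg, map_smul] at h4
      refine h4.congr' ?_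
      filter_upwards [self_mem_nhdsWithin] with s hs
      have hst : 0 ≤ s - t := (sub_pos.2 (mem_Ioi.1 hs)).le
      simp only [Function.comp_apply, map_smul, map_sub, slope, vsub_eq_sub]
      rw [← ContinuousLinearMap.comp_apply, ← hS.add t (s - t) ht.1 hst, add_sub_cancel]
    have h5 : HasDerivWithinAt (fun t => Real.exp (m * t)) (Real.exp (m * t) * m) (Ici t) t := by
      have : HasDerivAt (fun t : ℝ => m * t) m t := by simpa using (hasDerivAt_id t).const_mul m
      exact this.exp.hasDerivWithinAt
    have h6 := h5.smul h1
    rwa [smul_neg, smul_smul, neg_add_cancel] at h6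
  have h := constant_of_has_deriv_right_zero hcont hder T (right_mem_Icc.2 hT)
  simp only [mul_zero, Real.exp_zero, one_smul, hS.zero, ContinuousLinearMap.id_apply] at h
  nth_rewrite 2 [← h]
  rw [smul_smul, ← Real.exp_add, neg_add_cancel, Real.exp_zero, one_smul]

/-- The generator determines the semigroup. -/
theorem semigroup_eq_heat {S : ℝ → L2Omega →L[ℝ] L2Omega} (hS : IsFracHeatSemigroup α S)
    {t : ℝ} (ht : 0 ≤ t) : S t = Φ.heat t := by
  refine ContinuousLinearMap.ext_on
    (Submodule.dense_iff_topologicalClosure_eq_top.2 Φ.e.dense_span) ?_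
  rintro _ ⟨i, rfl⟩
  rw [Φ.semigroup_apply_basis hS ht, Φ.semigroup_apply_basis Φ.isFracHeatSemigroup_heat ht]

theorem continuousOn_heat_comp {h : ℝ → L2Omega} {t : ℝ} (hh : ContinuousOn h (Icc 0 t)) :
    ContinuousOn (fun s => Φ.heat (t - s) (h s)) (Icc 0 t) := by
  intro s₀ hs₀
  have h1 : Tendsto (fun s => Φ.heat (t - s) (h s₀)) (𝓝[Icc 0 t] s₀)
      (𝓝 (Φ.heat (t - s₀) (h s₀))) := by
    have := (Φ.continuousOn_heat (h s₀)).comp (f := fun s => t - s) (s := Icc 0 t) (by fun_prop)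
      (fun s hs => sub_nonneg.2 hs.2)
    exact this s₀ hs₀
  have h2 : Tendsto (fun s => Φ.heat (t - s) (h s - h s₀)) (𝓝[Icc 0 t] s₀) (𝓝 0) := by
    refine squeeze_zero_norm' (a := fun s => ‖h s - h s₀‖) ?_ ?_
    · filter_upwards [self_mem_nhdsWithin] with s hs
      exact Φ.norm_heat_le (sub_nonneg.2 hs.2) _
    · exact tendsto_iff_norm_sub_tendsto_zero.1 (hh s₀ hs₀)
  have h3 := h2.add h1
  rw [zero_add] at h3
  refine h3.congr fun s => ?_
  rw [← map_add, sub_add_cancel]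

theorem inner_duhamel {h : ℝ → L2Omega} {t : ℝ} (ht : 0 ≤ t) (hh : ContinuousOn h (Icc 0 t))
    (i : Φ.ι) : inner ℝ (Φ.e i) (∫ s in (0 : ℝ)..t, Φ.heat (t - s) (h s)) =
      ∫ s in (0 : ℝ)..t, Real.exp (-(Φ.eig i * (t - s))) * inner ℝ (Φ.e i) (h s) := by
  have hi : IntervalIntegrable (fun s => Φ.heat (t - s) (h s)) volume 0 t :=
    ContinuousOn.intervalIntegrable_of_Icc ht (Φ.continuousOn_heat_comp hh)
  have h1 := (innerSL ℝ (Φ.e i)).intervalIntegral_comp_comm hi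
  simp only [innerSL_apply_apply] at h1
  rw [← h1]
  refine intervalIntegral.integral_congr fun s hs => ?_
  rw [uIcc_of_le ht] at hs
  exact Φ.inner_heat (sub_nonneg.2 hs.2) _ i

end FracSpectrum

end

/-! ### Linear estimates: the loss `√ν` is recovered by integration in time. -/

noncomputable section

theorem intervalIntegral_mul_sq_le {a b : ℝ → ℝ} (ha : Continuous a) (hb : Continuous b) {t : ℝ}
    (ht : 0 ≤ t) : (∫ s in (0 : ℝ)..t, a s * b s) ^ 2 ≤
      (∫ s in (0 : ℝ)..t, a s ^ 2) * ∫ s in (0 : ℝ)..t, b s ^ 2 := by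
  have h : ∀ x : ℝ, 0 ≤ (∫ s in (0 : ℝ)..t, a s ^ 2) * (x * x) +
      (2 * ∫ s in (0 : ℝ)..t, a s * b s) * x + ∫ s in (0 : ℝ)..t, b s ^ 2 := by
    intro x
    have h1 : 0 ≤ ∫ s in (0 : ℝ)..t, (x * a s + b s) ^ 2 :=
      intervalIntegral.integral_nonneg ht fun s _ => sq_nonneg _
    have h2 : ∫ s in (0 : ℝ)..t, (x * a s + b s) ^ 2 = ∫ s in (0 : ℝ)..t,
        ((x * x) * a s ^ 2 + (2 * x) * (a s * b s) + b s ^ 2) := by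
      congr 1 with s; ring
    rw [h2, intervalIntegral.integral_add, intervalIntegral.integral_add,
      intervalIntegral.integral_const_mul, intervalIntegral.integral_const_mul] at h1
    · linarith
    all_goals exact Continuous.intervalIntegrable (by fun_prop) _ _
  have := discrim_le_zero h
  rw [discrim] at this
  linarith

/-- The maximal regularity estimate for a scalar linear equation. -/
theorem mul_integral_exp_sq_le {γ ν l : ℝ} (hγ : 0 < γ) (hν : 1 ≤ ν) (hl : 2 * γ ≤ l) {k : ℝ → ℝ}
    (hk : Continuous k) {t : ℝ} (ht : 0 ≤ t) :
    ν * (∫ s in (0 : ℝ)..t, Real.exp (-(γ * (ν - 1) * (t - s))) * k s) ^ 2 ≤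
      1 / (2 * γ) * ∫ s in (0 : ℝ)..t, Real.exp (l * (t - s)) * k s ^ 2 := by
  -- The kernel is split as `exp (-(m/2) (t - s))` times `exp ((l/2) (t - s))`. The first factor has
  -- squared integral at most `1 / m`, and `l ≥ 2 γ` gives `ν / m ≤ 1 / (2 γ)` also for `ν = 1`,
  -- where the equation itself has no decay.
  set m := 2 * (γ * (ν - 1)) + l with hm
  have hm0 : 2 * γ * ν ≤ m := by rw [hm]; nlinarith
  have hmpos : 0 < m := by nlinarith
  have h1 := intervalIntegral_mul_sq_le (a := fun s => Real.exp (-(m / 2 * (t - s))))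
    (b := fun s => Real.exp (l / 2 * (t - s)) * k s) (by fun_prop) (by fun_prop) ht
  have h2 : ∀ s, Real.exp (-(m / 2 * (t - s))) * (Real.exp (l / 2 * (t - s)) * k s) =
      Real.exp (-(γ * (ν - 1) * (t - s))) * k s := fun s => by
    rw [← mul_assoc, ← Real.exp_add]
    congr 2; rw [hm]; ring
  have h3 : ∀ s, (Real.exp (l / 2 * (t - s)) * k s) ^ 2 = Real.exp (l * (t - s)) * k s ^ 2 :=
    fun s => by
    rw [mul_pow, ← Real.exp_nat_mul]; congr 2; push_cast; ring
  have h4 : ∫ s in (0 : ℝ)..t, Real.exp (-(m / 2 * (t - s))) ^ 2 ≤ 1 / m := by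
    have h5 : ∀ s ∈ uIcc 0 t, HasDerivAt (fun s => Real.exp (-(m * (t - s))) / m)
        (Real.exp (-(m / 2 * (t - s))) ^ 2) s := by
      intro s _
      have h6 : HasDerivAt (fun s => -(m * (t - s))) m s := by
        simpa using! (((hasDerivAt_id s).const_sub t).const_mul m).neg
      have h7 := h6.exp.div_const m
      rw [mul_div_cancel_right₀ _ hmpos.ne'] at h7
      rw [← Real.exp_nat_mul]
      convert! h7 using 2; push_cast; ring
    rw [intervalIntegral.integral_eq_sub_of_hasDerivAt h5
      (Continuous.intervalIntegrable (by fun_prop) _ _)]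
    have := Real.exp_pos (-(m * (t - 0)))
    simp only [sub_self, mul_zero, neg_zero, Real.exp_zero]
    have : 0 ≤ Real.exp (-(m * (t - 0))) / m := by positivity
    linarith
  simp only [h2, h3] at h1
  have hI : 0 ≤ ∫ s in (0 : ℝ)..t, Real.exp (l * (t - s)) * k s ^ 2 :=
    intervalIntegral.integral_nonneg ht fun s _ => by positivity
  calc _ ≤ ν * (1 / m * ∫ s in (0 : ℝ)..t, Real.exp (l * (t - s)) * k s ^ 2) := by
        refine mul_le_mul_of_nonneg_left (h1.trans ?_) (by linarith)
        exact mul_le_mul_of_nonneg_right h4 hI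
    _ ≤ _ := by
        rw [← mul_assoc]
        refine mul_le_mul_of_nonneg_right ?_ hI
        rw [mul_one_div, div_le_div_iff₀ hmpos (by positivity)]
        linarith

/-- The integral form of Grönwall's inequality with zero initial value. -/
theorem eq_zero_of_le_integral {δ : ℝ → ℝ} (hδ : Continuous δ) (h0 : ∀ t, 0 ≤ δ t) {K T : ℝ}
    (h : ∀ t ∈ Icc 0 T, δ t ≤ K * ∫ s in (0 : ℝ)..t, δ s) : ∀ t ∈ Icc 0 T, δ t = 0 := by
  have hder (t : ℝ) : HasDerivAt (fun t => ∫ s in (0 : ℝ)..t, δ s) (δ t) t :=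
    intervalIntegral.integral_hasDerivAt_right (hδ.intervalIntegrable _ _)
      (hδ.stronglyMeasurableAtFilter _ _) hδ.continuousAt
  have hpos : ∀ t ∈ Icc 0 T, 0 ≤ ∫ s in (0 : ℝ)..t, δ s := fun t ht =>
    intervalIntegral.integral_nonneg ht.1 fun s _ => h0 s
  have h1 := norm_le_gronwallBound_of_norm_deriv_right_le (f := fun t => ∫ s in (0 : ℝ)..t, δ s)
    (f' := δ) (δ := 0) (K := K) (ε := 0) (a := 0) (b := T)
    (fun t _ => (hder t).continuousAt.continuousWithinAt) (fun t _ => (hder t).hasDerivWithinAt)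
    (by simp) (fun t ht => by
      rw [Real.norm_of_nonneg (h0 t), Real.norm_of_nonneg (hpos t ⟨ht.1, ht.2.le⟩), add_zero]
      exact h t ⟨ht.1, ht.2.le⟩)
  intro t ht
  have h2 := h1 t ht
  rw [gronwallBound_ε0_δ0, norm_le_zero_iff] at h2
  have h3 := h t ht
  rw [h2, mul_zero] at h3
  exact le_antisymm h3 (h0 t)

namespace FracSpectrum

variable {α : ℝ} (Φ : FracSpectrum α)

/-- The coefficients of the mild solution of the linear equation with source `h`, measured in
`H₀^{α/2}(Ω)`. -/
def coeff (w₀ : L2Omega) (h : ℝ → L2Omega) (i : Φ.ι) (t : ℝ) : ℝ :=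
  Real.exp (-(Φ.eig i * t)) * inner ℝ (Φ.e i) w₀ +
    √(Φ.ν i) * ∫ s in (0 : ℝ)..t, Real.exp (-(Φ.eig i * (t - s))) * inner ℝ (Φ.e i) (h s)

theorem coeff_congr (w₀ : L2Omega) {h h' : ℝ → L2Omega} (i : Φ.ι) {t : ℝ} (ht : 0 ≤ t)
    (hh : ∀ s ∈ Icc 0 t, h s = h' s) : Φ.coeff w₀ h i t = Φ.coeff w₀ h' i t := by
  rw [coeff, coeff]
  congr 2
  refine intervalIntegral.integral_congr fun s hs => ?_
  rw [uIcc_of_le ht] at hs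
  simp only [hh s hs]

theorem continuous_inner_comp {h : ℝ → L2Omega} (hh : Continuous h) (i : Φ.ι) :
    Continuous fun s => inner ℝ (Φ.e i) (h s) := continuous_const.inner hh

theorem hasDerivAt_coeff (w₀ : L2Omega) {h : ℝ → L2Omega} (hh : Continuous h) (i : Φ.ι) (t : ℝ) :
    HasDerivAt (Φ.coeff w₀ h i)
      (-(Φ.eig i) * Φ.coeff w₀ h i t + √(Φ.ν i) * inner ℝ (Φ.e i) (h t)) t := by
  have hk := Φ.continuous_inner_comp hh i
  set k := fun s => inner ℝ (Φ.e i) (h s)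
  set m := Φ.eig i
  have hrepr : Φ.coeff w₀ h i = fun t => Real.exp (-(m * t)) *
      (inner ℝ (Φ.e i) w₀ + √(Φ.ν i) * ∫ s in (0 : ℝ)..t, Real.exp (m * s) * k s) := by
    funext t
    rw [coeff, mul_add, mul_left_comm (Real.exp _) (√_),
      ← intervalIntegral.integral_const_mul (Real.exp _)]
    congr 3 with s
    rw [← mul_assoc, ← Real.exp_add]
    congr 2; ring
  have hc : Continuous fun s => Real.exp (m * s) * k s := by fun_prop
  have h1 : HasDerivAt (fun t => ∫ s in (0 : ℝ)..t, Real.exp (m * s) * k s)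
      (Real.exp (m * t) * k t) t :=
    intervalIntegral.integral_hasDerivAt_right (hc.intervalIntegrable _ _)
      (hc.stronglyMeasurableAtFilter _ _) hc.continuousAt
  have h2 : HasDerivAt (fun t => Real.exp (-(m * t))) (Real.exp (-(m * t)) * -m) t := by
    have : HasDerivAt (fun t : ℝ => -(m * t)) (-m) t := by
      simpa using! ((hasDerivAt_id t).const_mul m).neg
    exact this.exp
  have h3 := h2.mul ((h1.const_mul (√(Φ.ν i))).const_add (inner ℝ (Φ.e i) w₀))
  rw [hrepr]
  refine h3.congr_deriv ?_
  have h4 : Real.exp (-(m * t)) * Real.exp (m * t) = 1 := by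
    rw [← Real.exp_add, neg_add_cancel, Real.exp_zero]
  linear_combination (√(Φ.ν i) * k t) * h4

theorem continuous_coeff (w₀ : L2Omega) {h : ℝ → L2Omega} (hh : Continuous h) (i : Φ.ι) :
    Continuous (Φ.coeff w₀ h i) :=
  continuous_iff_continuousAt.2 fun t => (Φ.hasDerivAt_coeff w₀ hh i t).continuousAt

theorem source_coeff_sq_le {l : ℝ} (hl : 2 * Φ.γ ≤ l) {h : ℝ → L2Omega} (hh : Continuous h)
    (i : Φ.ι) {t : ℝ} (ht : 0 ≤ t) :
    (√(Φ.ν i) * ∫ s in (0 : ℝ)..t, Real.exp (-(Φ.eig i * (t - s))) * inner ℝ (Φ.e i) (h s)) ^ 2 ≤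
      1 / (2 * Φ.γ) * ∫ s in (0 : ℝ)..t, Real.exp (l * (t - s)) * inner ℝ (Φ.e i) (h s) ^ 2 := by
  rw [mul_pow, Φ.sq_sqrt_ν]
  exact mul_integral_exp_sq_le Φ.γ_pos (Φ.one_le i) hl (Φ.continuous_inner_comp hh i) ht

theorem sum_integral_le {ρ : ℝ → ℝ} (hρ : Continuous ρ) (hρ0 : ∀ s, 0 ≤ ρ s) {h : ℝ → L2Omega}
    (hh : Continuous h) (F : Finset Φ.ι) {t : ℝ} (ht : 0 ≤ t) :
    ∑ i ∈ F, ∫ s in (0 : ℝ)..t, ρ s * inner ℝ (Φ.e i) (h s) ^ 2 ≤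
      ∫ s in (0 : ℝ)..t, ρ s * ‖h s‖ ^ 2 := by
  have hc (i) : Continuous fun s => ρ s * inner ℝ (Φ.e i) (h s) ^ 2 :=
    hρ.mul ((Φ.continuous_inner_comp hh i).pow 2)
  rw [← intervalIntegral.integral_finsetSum
    fun i _ => (hc i).intervalIntegrable _ _]
  refine intervalIntegral.integral_mono_on ht
    (Continuous.intervalIntegrable
      (continuous_finsetSum _ fun i _ => hc i) _ _)
    (Continuous.intervalIntegrable (by fun_prop) _ _) fun s _ => ?_
  rw [← Finset.mul_sum]
  exact mul_le_mul_of_nonneg_left (Φ.e.sum_inner_sq_le _ F) (hρ0 s)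

theorem summable_integral_sq {h : ℝ → L2Omega} (hh : Continuous h) {t : ℝ} (ht : 0 ≤ t) :
    Summable fun i => ∫ s in (0 : ℝ)..t, inner ℝ (Φ.e i) (h s) ^ 2 := by
  refine summable_of_sum_le (c := ∫ s in (0 : ℝ)..t, ‖h s‖ ^ 2)
    (fun i => intervalIntegral.integral_nonneg ht fun s _ => sq_nonneg _) fun F => ?_
  simpa using Φ.sum_integral_le (ρ := fun _ => 1) continuous_const (fun _ => zero_le_one) hh F ht

theorem norm_sq_le_of_source {l : ℝ} (hl : 2 * Φ.γ ≤ l) {h : ℝ → L2Omega} (hh : Continuous h)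
    {t : ℝ} (ht : 0 ≤ t) {x : L2Omega} (hx : ∀ i, inner ℝ (Φ.e i) x =
      √(Φ.ν i) * ∫ s in (0 : ℝ)..t, Real.exp (-(Φ.eig i * (t - s))) * inner ℝ (Φ.e i) (h s)) :
    ‖x‖ ^ 2 ≤ 1 / (2 * Φ.γ) * ∫ s in (0 : ℝ)..t, Real.exp (l * (t - s)) * ‖h s‖ ^ 2 := by
  have hγ := Φ.γ_pos
  rw [← (Φ.e.hasSum_inner_sq x).tsum_eq]
  refine Real.tsum_le_of_sum_le (fun i => sq_nonneg _) fun F => ?_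
  calc ∑ i ∈ F, inner ℝ (Φ.e i) x ^ 2
      ≤ ∑ i ∈ F, 1 / (2 * Φ.γ) *
          ∫ s in (0 : ℝ)..t, Real.exp (l * (t - s)) * inner ℝ (Φ.e i) (h s) ^ 2 := by
        refine Finset.sum_le_sum fun i _ => ?_
        rw [hx]
        exact Φ.source_coeff_sq_le hl hh i ht
    _ ≤ _ := by
        rw [← Finset.mul_sum]
        refine mul_le_mul_of_nonneg_left ?_ (by positivity)
        exact Φ.sum_integral_le (ρ := fun s => Real.exp (l * (t - s))) (by fun_prop)
          (fun s => (Real.exp_pos _).le) hh F ht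

/-- A bound for the squared coefficients on `[0, T]`, summable over the modes. -/
def coeffBound (w₀ : L2Omega) (h : ℝ → L2Omega) (T : ℝ) (i : Φ.ι) : ℝ :=
  2 * inner ℝ (Φ.e i) w₀ ^ 2 + 2 * (1 / (2 * Φ.γ) * (Real.exp (2 * Φ.γ * T) *
    ∫ s in (0 : ℝ)..T, inner ℝ (Φ.e i) (h s) ^ 2))

theorem summable_coeffBound (w₀ : L2Omega) {h : ℝ → L2Omega} (hh : Continuous h) {T : ℝ}
    (hT : 0 ≤ T) : Summable (Φ.coeffBound w₀ h T) :=
  ((Φ.e.hasSum_inner_sq w₀).summable.mul_left 2).add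
    ((((Φ.summable_integral_sq hh hT).mul_left _).mul_left _).mul_left 2)

theorem coeff_sq_le (w₀ : L2Omega) {h : ℝ → L2Omega} (hh : Continuous h) {T t : ℝ}
    (ht : t ∈ Icc 0 T) (i : Φ.ι) : Φ.coeff w₀ h i t ^ 2 ≤ Φ.coeffBound w₀ h T i := by
  have hγ := Φ.γ_pos
  have hk := Φ.continuous_inner_comp hh i
  have h1 := Φ.source_coeff_sq_le le_rfl hh i ht.1
  have h2 : (Real.exp (-(Φ.eig i * t)) * inner ℝ (Φ.e i) w₀) ^ 2 ≤ inner ℝ (Φ.e i) w₀ ^ 2 := by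
    rw [← Φ.inner_heat ht.1]
    exact Φ.inner_heat_sq_le ht.1 w₀ i
  have h3 : ∫ s in (0 : ℝ)..t, Real.exp (2 * Φ.γ * (t - s)) * inner ℝ (Φ.e i) (h s) ^ 2 ≤
      Real.exp (2 * Φ.γ * T) * ∫ s in (0 : ℝ)..T, inner ℝ (Φ.e i) (h s) ^ 2 := by
    calc _ ≤ ∫ s in (0 : ℝ)..t, Real.exp (2 * Φ.γ * T) * inner ℝ (Φ.e i) (h s) ^ 2 := by
          refine intervalIntegral.integral_mono_on ht.1
            (Continuous.intervalIntegrable (by fun_prop) _ _)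
            (Continuous.intervalIntegrable (by fun_prop) _ _) fun s hs => ?_
          refine mul_le_mul_of_nonneg_right (Real.exp_le_exp.2 ?_) (sq_nonneg _)
          exact mul_le_mul_of_nonneg_left (by linarith [hs.1, ht.2]) (by positivity)
      _ = Real.exp (2 * Φ.γ * T) * ∫ s in (0 : ℝ)..t, inner ℝ (Φ.e i) (h s) ^ 2 :=
          intervalIntegral.integral_const_mul _ _
      _ ≤ _ := by
          refine mul_le_mul_of_nonneg_left ?_ (Real.exp_pos _).le
          exact intervalIntegral.integral_mono_interval le_rfl ht.1 ht.2
            (ae_of_all _ fun s => sq_nonneg _)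
            (Continuous.intervalIntegrable (by fun_prop) _ _)
  have h4 : 1 / (2 * Φ.γ) * (∫ s in (0 : ℝ)..t,
      Real.exp (2 * Φ.γ * (t - s)) * inner ℝ (Φ.e i) (h s) ^ 2) ≤ 1 / (2 * Φ.γ) *
      (Real.exp (2 * Φ.γ * T) * ∫ s in (0 : ℝ)..T, inner ℝ (Φ.e i) (h s) ^ 2) :=
    mul_le_mul_of_nonneg_left h3 (by positivity)
  rw [coeff, coeffBound]
  refine add_sq_le.trans ?_
  linarith

/-- The coefficients are continuous in time and, on each `[0, T]`, their squares have a summable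
bound independent of time; so they assemble into a continuous curve. It is frozen for negative
times. -/
theorem exists_mild (w₀ : L2Omega) {h : ℝ → L2Omega} (hh : Continuous h) :
    ∃ w : ℝ → L2Omega, Continuous w ∧ ∀ t, 0 ≤ t → ∀ i,
      inner ℝ (Φ.e i) (w t) = Φ.coeff w₀ h i t := by
  have hex : ∀ t : ℝ, ∃ x : L2Omega, 0 ≤ t → ∀ i, inner ℝ (Φ.e i) x = Φ.coeff w₀ h i t := by
    intro t
    by_cases ht : 0 ≤ t
    · obtain ⟨x, hx⟩ := Φ.e.exists_inner_eq (a := fun i => Φ.coeff w₀ h i t)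
        (Summable.of_nonneg_of_le (fun i => sq_nonneg _)
          (fun i => Φ.coeff_sq_le w₀ hh (right_mem_Icc.2 ht) i) (Φ.summable_coeffBound w₀ hh ht))
      exact ⟨x, fun _ => hx⟩
    · exact ⟨0, fun h => absurd h ht⟩
  choose w hw using hex
  have hcont : ContinuousOn w (Ici 0) := by
    intro t ht
    have h1 : ContinuousOn w (Icc 0 (t + 1)) := by
      refine Φ.e.continuousOn_of_inner
        (Φ.summable_coeffBound w₀ hh (T := t + 1) (by linarith [mem_Ici.1 ht]))
        (fun s hs i => ?_) fun i => ?_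
      · rw [hw s hs.1]; exact Φ.coeff_sq_le w₀ hh hs i
      · exact (Φ.continuous_coeff w₀ hh i).continuousOn.congr fun s hs => hw s hs.1 i
    refine (h1 t ⟨ht, by linarith⟩).mono_of_mem_nhdsWithin ?_
    filter_upwards [self_mem_nhdsWithin, mem_nhdsWithin_of_mem_nhds (Iio_mem_nhds (lt_add_one t))]
      with s hs hs'
    exact ⟨hs, le_of_lt hs'⟩
  refine ⟨fun t => w (max t 0), ?_, fun t ht i => ?_⟩
  · exact hcont.comp_continuous (by fun_prop) fun t => mem_Ici.2 (le_max_right _ _)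
  · simp only [max_eq_left ht]
    exact hw t ht i

end FracSpectrum

end

/-! ### Locally Lipschitz sources: cutoff, uniqueness, and global solutions for bounded Lipschitz
sources. -/

noncomputable section

/-- Lipschitz continuity on every ball. -/
def LipschitzOnBalls {X Y : Type*} [SeminormedAddCommGroup X] [SeminormedAddCommGroup Y]
    (N : X → Y) : Prop :=
  ∀ R : ℝ, ∃ L : ℝ, 0 ≤ L ∧ ∀ x y, ‖x‖ ≤ R → ‖y‖ ≤ R → ‖N x - N y‖ ≤ L * ‖x - y‖

namespace LipschitzOnBalls

variable {X Y : Type*} [NormedAddCommGroup X] [NormedAddCommGroup Y] {N : X → Y}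

theorem continuous (hN : LipschitzOnBalls N) : Continuous N := by
  refine continuous_iff_continuousAt.2 fun x => ?_
  obtain ⟨L, hL0, hL⟩ := hN (‖x‖ + 1)
  rw [ContinuousAt, tendsto_iff_norm_sub_tendsto_zero]
  have h1 : Tendsto (fun y => L * ‖y - x‖) (𝓝 x) (𝓝 0) := by
    have := (tendsto_iff_norm_sub_tendsto_zero.1 (tendsto_id (x := 𝓝 x))).const_mul L
    simpa using this
  refine squeeze_zero' (Eventually.of_forall fun _ => norm_nonneg _) ?_ h1
  filter_upwards [Metric.ball_mem_nhds x one_pos] with y hy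
  rw [Metric.mem_ball, dist_eq_norm] at hy
  refine hL y x ?_ (by linarith)
  have := norm_sub_norm_le y x
  linarith

theorem exists_norm_le (hN : LipschitzOnBalls N) (R : ℝ) :
    ∃ C, 0 ≤ C ∧ ∀ x, ‖x‖ ≤ R → ‖N x‖ ≤ C := by
  obtain ⟨L, hL0, hL⟩ := hN |R|
  refine ⟨‖N 0‖ + L * |R|, by positivity, fun x hx => ?_⟩
  have hx' : ‖x‖ ≤ |R| := hx.trans (le_abs_self R)
  have h1 := hL x 0 hx' (by simp)
  rw [sub_zero] at h1
  have h2 := norm_sub_norm_le (N x) (N 0)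
  have h3 := mul_le_mul_of_nonneg_left hx' hL0
  linarith

/-- A locally Lipschitz map agrees on a given ball with a bounded, globally Lipschitz map. -/
theorem exists_cutoff [NormedSpace ℝ Y] (hN : LipschitzOnBalls N) (R : ℝ) :
    ∃ (N' : X → Y) (L C : ℝ), 0 ≤ L ∧ 0 ≤ C ∧ (∀ x y, ‖N' x - N' y‖ ≤ L * ‖x - y‖) ∧
      (∀ x, ‖N' x‖ ≤ C) ∧ ∀ x, ‖x‖ ≤ R → N' x = N x := by
  obtain ⟨L, hL0, hL⟩ := hN (R + 1)
  obtain ⟨C, hC0, hC⟩ := hN.exists_norm_le (R + 1)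
  -- A cutoff with Lipschitz constant `1`, equal to `1` on the ball of radius `R` and to `0` outside
  -- that of radius `R + 1`. When only one point lies in the larger ball, the bound `C` on `N` there
  -- is what controls the difference.
  set χ : X → ℝ := fun x => max 0 (min 1 (R + 1 - ‖x‖)) with hχ
  have hχ0 (x) : 0 ≤ χ x := le_max_left _ _
  have hχ1 (x) : χ x ≤ 1 := max_le zero_le_one (min_le_left _ _)
  have hχout {x} (hx : ¬ ‖x‖ ≤ R + 1) : χ x = 0 := by
    rw [not_le] at hx
    exact max_eq_left ((min_le_right _ _).trans (by linarith))
  have hχL (x y) : |χ x - χ y| ≤ ‖x - y‖ := by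
    refine (abs_max_sub_max_le_max _ _ _ _).trans (max_le (by simp) ?_)
    refine (abs_min_sub_min_le_max _ _ _ _).trans (max_le (by simp) ?_)
    rw [sub_sub_sub_cancel_left, abs_sub_comm]
    exact abs_norm_sub_norm_le x y
  have hin {x y} (hx : ‖x‖ ≤ R + 1) (hy : ¬ ‖y‖ ≤ R + 1) : ‖χ x • N x‖ ≤ C * ‖x - y‖ := by
    have h1 := hχL x y
    rw [hχout hy, sub_zero, abs_of_nonneg (hχ0 x)] at h1
    rw [norm_smul, Real.norm_of_nonneg (hχ0 x), mul_comm]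
    exact mul_le_mul (hC x hx) h1 (hχ0 x) hC0
  refine ⟨fun x => χ x • N x, L + C, C, by positivity, hC0, fun x y => ?_, fun x => ?_,
    fun x hx => ?_⟩
  · have hnn : 0 ≤ L * ‖x - y‖ := by positivity
    by_cases hx : ‖x‖ ≤ R + 1 <;> by_cases hy : ‖y‖ ≤ R + 1
    · have h1 : χ x • N x - χ y • N y = (χ x - χ y) • N x + χ y • (N x - N y) := by
        rw [sub_smul, smul_sub]; abel
      rw [h1]
      refine (norm_add_le _ _).trans ?_
      rw [norm_smul, norm_smul, Real.norm_eq_abs, Real.norm_of_nonneg (hχ0 y)]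
      have h2 := mul_le_mul (hχL x y) (hC x hx) (norm_nonneg _) (norm_nonneg _)
      have h3 := mul_le_mul (hχ1 y) (hL x y hx hy) (norm_nonneg _) zero_le_one
      linarith
    · simp only [hχout hy, zero_smul, sub_zero]
      linarith [hin hx hy]
    · simp only [hχout hx, zero_smul, zero_sub, norm_neg]
      rw [norm_sub_rev x y] at *
      linarith [hin hy hx]
    · simp only [hχout hx, hχout hy, zero_smul, sub_zero, norm_zero]
      positivity
  · by_cases hx : ‖x‖ ≤ R + 1
    · rw [norm_smul, Real.norm_of_nonneg (hχ0 x)]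
      exact (mul_le_of_le_one_left (norm_nonneg _) (hχ1 x)).trans (hC x hx)
    · simp only [hχout hx, zero_smul, norm_zero, hC0]
  · have : χ x = 1 := by
      simp only [hχ]
      rw [min_eq_left (by linarith)]; exact max_eq_right zero_le_one
    simp only [this, one_smul]

end LipschitzOnBalls

namespace FracSpectrum

variable {α : ℝ} (Φ : FracSpectrum α)

/-- `w` represents (through `B`) a mild solution on `[0, T]` of the evolution equation with
nonlinear source `N`. -/
structure IsMild (N : L2Omega → L2Omega) (w₀ : L2Omega) (T : ℝ) (w : ℝ → L2Omega) : Prop where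
  continuous : Continuous w
  inner_eq : ∀ t ∈ Icc 0 T, ∀ i, inner ℝ (Φ.e i) (w t) = Φ.coeff w₀ (fun s => N (w s)) i t

variable {Φ} {N : L2Omega → L2Omega} {w₀ : L2Omega} {T : ℝ} {w : ℝ → L2Omega}

theorem IsMild.zero (h : Φ.IsMild N w₀ T w) (hT : 0 ≤ T) : w 0 = w₀ :=
  Φ.e.ext_inner fun i => by rw [h.inner_eq 0 (left_mem_Icc.2 hT)]; simp [coeff]

/-- Both curves stay in one ball on the compact interval, so the linear estimate applied to the
difference gives a Grönwall inequality for `‖w - w'‖ ^ 2`. -/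
theorem IsMild.unique (hN : LipschitzOnBalls N) {w' : ℝ → L2Omega} (h : Φ.IsMild N w₀ T w)
    (h' : Φ.IsMild N w₀ T w') : ∀ t ∈ Icc 0 T, w t = w' t := by
  have hγ := Φ.γ_pos
  obtain ⟨R₁, hR₁⟩ := isCompact_Icc.exists_bound_of_continuousOn (h.continuous.continuousOn
    (s := Icc 0 T))
  obtain ⟨R₂, hR₂⟩ := isCompact_Icc.exists_bound_of_continuousOn (h'.continuous.continuousOn
    (s := Icc 0 T))
  obtain ⟨L, hL0, hL⟩ := hN (max R₁ R₂)
  have hc := hN.continuous.comp h.continuous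
  have hc' := hN.continuous.comp h'.continuous
  have hd : Continuous fun s => N (w s) - N (w' s) := hc.sub hc'
  have hδ : Continuous fun s => ‖w s - w' s‖ ^ 2 := (h.continuous.sub h'.continuous).norm.pow 2
  have key := eq_zero_of_le_integral (δ := fun s => ‖w s - w' s‖ ^ 2) (T := T)
    (K := 1 / (2 * Φ.γ) * (Real.exp (2 * Φ.γ * T) * L ^ 2)) hδ (fun t => sq_nonneg _)
    (fun t ht => by
      have h1 := Φ.norm_sq_le_of_source le_rfl hd ht.1 (x := w t - w' t) fun i => by
        have e1 := (Φ.continuous_inner_comp hc i)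
        have e2 := (Φ.continuous_inner_comp hc' i)
        simp only [Function.comp_def] at e1 e2
        rw [inner_sub_right, h.inner_eq t ht, h'.inner_eq t ht, coeff, coeff,
          add_sub_add_left_eq_sub, ← mul_sub, ← intervalIntegral.integral_sub]
        · simp only [inner_sub_right, mul_sub]
        · exact Continuous.intervalIntegrable (by fun_prop) _ _
        · exact Continuous.intervalIntegrable (by fun_prop) _ _
      refine h1.trans ?_
      rw [mul_assoc (1 / (2 * Φ.γ))]
      refine mul_le_mul_of_nonneg_left ?_ (by positivity)
      rw [← intervalIntegral.integral_const_mul]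
      refine intervalIntegral.integral_mono_on ht.1
        (Continuous.intervalIntegrable (by fun_prop) _ _)
        (Continuous.intervalIntegrable (by fun_prop) _ _) fun s hs => ?_
      have hs' : s ∈ Icc 0 T := ⟨hs.1, hs.2.trans ht.2⟩
      have h2 := hL (w s) (w' s) ((hR₁ s hs').trans (le_max_left _ _))
        ((hR₂ s hs').trans (le_max_right _ _))
      have h3 := pow_le_pow_left₀ (norm_nonneg _) h2 2
      rw [mul_pow] at h3
      rw [mul_assoc (Real.exp (2 * Φ.γ * T))]
      refine mul_le_mul (Real.exp_le_exp.2 ?_) h3 (sq_nonneg _) (Real.exp_pos _).le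
      exact mul_le_mul_of_nonneg_left (by linarith [hs.1, ht.2]) (by positivity))
  intro t ht
  have := key t ht
  rw [sq_eq_zero_iff, norm_eq_zero, sub_eq_zero] at this
  exact this

theorem integral_exp_mul_exp_le {l t C : ℝ} (hl : 0 < l) {f : ℝ → ℝ}
    (hf : Continuous f) (ht : 0 ≤ t) (hC0 : 0 ≤ C)
    (hC : ∀ s ∈ Icc 0 t, f s ≤ C * Real.exp (2 * l * s)) :
    ∫ s in (0 : ℝ)..t, Real.exp (l * (t - s)) * f s ≤ C / l * Real.exp (2 * l * t) := by
  calc ∫ s in (0 : ℝ)..t, Real.exp (l * (t - s)) * f s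
      ≤ ∫ s in (0 : ℝ)..t, C * Real.exp (l * t) * Real.exp (l * s) := by
        refine intervalIntegral.integral_mono_on ht
          (Continuous.intervalIntegrable (by fun_prop) _ _)
          (Continuous.intervalIntegrable (by fun_prop) _ _) fun s hs => ?_
        refine (mul_le_mul_of_nonneg_left (hC s hs) (Real.exp_pos _).le).trans (le_of_eq ?_)
        rw [mul_left_comm, mul_assoc C, ← Real.exp_add, ← Real.exp_add]
        congr 2; ring
    _ = C * Real.exp (l * t) * ((Real.exp (l * t) - 1) / l) := by
        rw [intervalIntegral.integral_const_mul]
        congr 1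
        have h5 : ∀ s ∈ uIcc 0 t, HasDerivAt (fun s => Real.exp (l * s) / l) (Real.exp (l * s)) s := by
          intro s _
          have h6 : HasDerivAt (fun s => l * s) l s := by
            simpa using (hasDerivAt_id s).const_mul l
          have h7 := h6.exp.div_const l
          rwa [mul_div_cancel_right₀ _ hl.ne'] at h7
        rw [intervalIntegral.integral_eq_sub_of_hasDerivAt h5
          (Continuous.intervalIntegrable (by fun_prop) _ _)]
        simp [sub_div]
    _ ≤ C * Real.exp (l * t) * (Real.exp (l * t) / l) := by
        gcongr
        linarith
    _ = _ := by
        rw [show 2 * l * t = l * t + l * t by ring, Real.exp_add]; ring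

/-- Global solvability for a bounded, globally Lipschitz source. -/
theorem exists_isMild_of_bounded (Φ : FracSpectrum α) {L C : ℝ} (hL0 : 0 ≤ L) (hC0 : 0 ≤ C)
    (hL : ∀ x y, ‖N x - N y‖ ≤ L * ‖x - y‖) (hC : ∀ x, ‖N x‖ ≤ C) (w₀ : L2Omega) :
    ∃ w : ℝ → L2Omega, ∀ T, Φ.IsMild N w₀ T w := by
  have hγ := Φ.γ_pos
  have hNc : Continuous N :=
    (LipschitzWith.of_dist_le_mul (K := ⟨L, hL0⟩) fun x y => by
      rw [dist_eq_norm, dist_eq_norm]; exact hL x y).continuous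
  -- With the weight `exp (-l t)`, the squared contraction constant is `L ^ 2 / (2 γ l)`. This `l`
  -- makes it at most `1 / 4` and meets the requirement `2 γ ≤ l` of the linear estimate.
  set l := 2 * Φ.γ + 2 * L ^ 2 / Φ.γ with hl
  have hl1 : 2 * Φ.γ ≤ l := by
    have : 0 ≤ 2 * L ^ 2 / Φ.γ := by positivity
    rw [hl]; linarith
  have hl0 : 0 < l := by linarith
  have hl2 : L ^ 2 / (2 * Φ.γ * l) ≤ 1 / 4 := by
    rw [div_le_div_iff₀ (by positivity) (by norm_num), hl]
    have : Φ.γ * (2 * L ^ 2 / Φ.γ) = 2 * L ^ 2 := by field_simp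
    nlinarith [sq_nonneg Φ.γ]
  -- The unknown is `z = exp (-l t) w`, so that the weighted space is the space of bounded
  -- continuous functions.
  set src : BoundedContinuousFunction ℝ L2Omega → ℝ → L2Omega :=
    fun z s => N (Real.exp (l * s) • z s) with hsrc
  have hsrcc (z) : Continuous (src z) := by
    have := z.continuous
    simp only [hsrc]
    exact hNc.comp (Continuous.smul (f := fun s => Real.exp (l * s)) (by fun_prop) this)
  choose D hDc hD using fun z => Φ.exists_mild w₀ (hsrcc z)
  have hexp (t : ℝ) (ht : 0 ≤ t) : 1 ≤ Real.exp (2 * l * t) := Real.one_le_exp (by positivity)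
  have hDbound (z) (t : ℝ) (ht : 0 ≤ t) :
      ‖D z t‖ ≤ (√(1 / (2 * Φ.γ) * (C ^ 2 / l)) + ‖w₀‖) * Real.exp (l * t) := by
    have h1 : ‖D z t - Φ.heat t w₀‖ ^ 2 ≤
        1 / (2 * Φ.γ) * (C ^ 2 / l * Real.exp (2 * l * t)) := by
      refine (Φ.norm_sq_le_of_source hl1 (hsrcc z) ht fun i => ?_).trans ?_
      · rw [inner_sub_right, hD z t ht, Φ.inner_heat ht, coeff, add_sub_cancel_left]
      · refine mul_le_mul_of_nonneg_left ?_ (by positivity)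
        refine integral_exp_mul_exp_le hl0 ((hsrcc z).norm.pow 2) ht (sq_nonneg C) fun s hs => ?_
        have h2 := pow_le_pow_left₀ (norm_nonneg _) (hC (Real.exp (l * s) • z s)) 2
        exact h2.trans (le_mul_of_one_le_right (sq_nonneg _) (hexp s hs.1))
    have h3 : ‖D z t - Φ.heat t w₀‖ ≤ √(1 / (2 * Φ.γ) * (C ^ 2 / l)) * Real.exp (l * t) := by
      refine le_of_sq_le_sq (h1.trans (le_of_eq ?_)) (by positivity)
      rw [mul_pow, Real.sq_sqrt (by positivity), ← Real.exp_nat_mul, ← mul_assoc]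
      congr 2; push_cast; ring
    have h4 := Φ.norm_heat_le ht w₀
    have h5 : 1 ≤ Real.exp (l * t) := Real.one_le_exp (by positivity)
    have h6 := norm_sub_norm_le (D z t) (Φ.heat t w₀)
    have h7 := le_mul_of_one_le_right (norm_nonneg w₀) h5
    rw [add_mul]
    linarith
  have hDdiff (z z') (t : ℝ) (ht : 0 ≤ t) :
      ‖D z t - D z' t‖ ≤ 1 / 2 * dist z z' * Real.exp (l * t) := by
    have h1 : ‖D z t - D z' t‖ ^ 2 ≤
        1 / (2 * Φ.γ) * ((L * dist z z') ^ 2 / l * Real.exp (2 * l * t)) := by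
      refine (Φ.norm_sq_le_of_source hl1 ((hsrcc z).sub (hsrcc z')) ht fun i => ?_).trans ?_
      · have e1 := Φ.continuous_inner_comp (hsrcc z) i
        have e2 := Φ.continuous_inner_comp (hsrcc z') i
        rw [inner_sub_right, hD z t ht, hD z' t ht, coeff, coeff,
          add_sub_add_left_eq_sub, ← mul_sub, ← intervalIntegral.integral_sub]
        · simp only [Pi.sub_apply, inner_sub_right, mul_sub (Real.exp _)]
        · exact Continuous.intervalIntegrable (by fun_prop) _ _
        · exact Continuous.intervalIntegrable (by fun_prop) _ _
      · refine mul_le_mul_of_nonneg_left ?_ (by positivity)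
        refine integral_exp_mul_exp_le hl0 (((hsrcc z).sub (hsrcc z')).norm.pow 2) ht (sq_nonneg _)
          fun s hs => ?_
        have h2 : ‖src z s - src z' s‖ ≤ L * dist z z' * Real.exp (l * s) := by
          refine (hL _ _).trans ?_
          rw [← smul_sub, norm_smul, Real.norm_of_nonneg (Real.exp_pos _).le, mul_assoc,
            mul_comm (dist z z')]
          refine mul_le_mul_of_nonneg_left (mul_le_mul_of_nonneg_left ?_ (Real.exp_pos _).le) hL0
          rw [← dist_eq_norm]
          exact z.dist_coe_le_dist s
        have h3 := pow_le_pow_left₀ (norm_nonneg _) h2 2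
        refine h3.trans (le_of_eq ?_)
        rw [mul_pow, ← Real.exp_nat_mul]
        congr 2; push_cast; ring
    refine le_of_sq_le_sq (h1.trans ?_) (by positivity)
    have h4 : 1 / (2 * Φ.γ) * ((L * dist z z') ^ 2 / l * Real.exp (2 * l * t)) =
        L ^ 2 / (2 * Φ.γ * l) * (dist z z' ^ 2 * Real.exp (2 * l * t)) := by
      field_simp
    have h5 : (1 / 2 * dist z z' * Real.exp (l * t)) ^ 2 =
        1 / 4 * (dist z z' ^ 2 * Real.exp (2 * l * t)) := by
      rw [mul_pow, mul_pow, ← Real.exp_nat_mul]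
      push_cast
      rw [← mul_assoc (2 : ℝ) l t]; ring
    rw [h4, h5]
    exact mul_le_mul_of_nonneg_right hl2 (by positivity)
  have hcancel (t : ℝ) (c x : ℝ) (hx : x ≤ c * Real.exp (l * t)) :
      Real.exp (-(l * t)) * x ≤ c := by
    refine (mul_le_mul_of_nonneg_left hx (Real.exp_pos _).le).trans (le_of_eq ?_)
    rw [mul_left_comm, ← Real.exp_add, neg_add_cancel, Real.exp_zero, mul_one]
  set Ψ : BoundedContinuousFunction ℝ L2Omega → BoundedContinuousFunction ℝ L2Omega := fun z =>
    BoundedContinuousFunction.ofNormedAddCommGroup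
      (fun t => Real.exp (-(l * max t 0)) • D z (max t 0))
      (Continuous.smul (f := fun t => Real.exp (-(l * max t 0))) (by fun_prop)
        ((hDc z).comp (by fun_prop)))
      (√(1 / (2 * Φ.γ) * (C ^ 2 / l)) + ‖w₀‖) (fun t => by
        rw [norm_smul, Real.norm_of_nonneg (Real.exp_pos _).le]
        exact hcancel _ _ _ (hDbound z _ (le_max_right _ _))) with hΨ
  have hcontr : ContractingWith (1 / 2) Ψ := by
    refine ⟨by norm_num, LipschitzWith.of_dist_le_mul fun z z' => ?_⟩
    rw [BoundedContinuousFunction.dist_le (by positivity)]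
    intro t
    simp only [hΨ, BoundedContinuousFunction.coe_ofNormedAddCommGroup]
    rw [dist_eq_norm, ← smul_sub, norm_smul, Real.norm_of_nonneg (Real.exp_pos _).le]
    have := hcancel (max t 0) _ _ (hDdiff z z' (max t 0) (le_max_right _ _))
    simpa using this
  set z := ContractingWith.fixedPoint Ψ hcontr
  have hz : Ψ z = z := hcontr.fixedPoint_isFixedPt
  have hfix (s : ℝ) (hs : 0 ≤ s) : Real.exp (l * s) • z s = D z s := by
    conv_lhs => rw [← hz]
    simp only [hΨ, BoundedContinuousFunction.coe_ofNormedAddCommGroup, max_eq_left hs]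
    rw [smul_smul, ← Real.exp_add, add_neg_cancel, Real.exp_zero, one_smul]
  refine ⟨D z, fun T => ⟨hDc z, fun t ht i => ?_⟩⟩
  rw [hD z t ht.1]
  refine Φ.coeff_congr w₀ i ht.1 fun s hs => ?_
  simp only [hsrc, hfix s hs.1]

end FracSpectrum

end

/-! ### Energy inequality and `L²` dissipation, through finite mode truncations. -/

noncomputable section

theorem HilbertBasis.norm_le_of_inner_sq_le {ι H : Type*} [NormedAddCommGroup H]
    [InnerProductSpace ℝ H] [CompleteSpace H] (e : HilbertBasis ι ℝ H) {x y : H}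
    (h : ∀ i, inner ℝ (e i) x ^ 2 ≤ inner ℝ (e i) y ^ 2) : ‖x‖ ≤ ‖y‖ :=
  le_of_sq_le_sq (hasSum_le h (e.hasSum_inner_sq x) (e.hasSum_inner_sq y)) (norm_nonneg _)

namespace FracSpectrum

variable {α : ℝ} (Φ : FracSpectrum α)

theorem B_basis (i : Φ.ι) : Φ.B (Φ.e i) = (√(Φ.ν i))⁻¹ • Φ.e i := by
  refine Φ.e.ext_inner fun k => ?_
  rw [Φ.inner_B, inner_smul_right]
  rcases eq_or_ne k i with rfl | hki
  · rfl
  · rw [Φ.e.orthonormal.2 hki, mul_zero, mul_zero]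

theorem norm_B_le (w : L2Omega) : ‖Φ.B w‖ ≤ ‖w‖ := by
  refine Φ.e.norm_le_of_inner_sq_le fun i => ?_
  rw [Φ.inner_B, mul_pow]
  refine mul_le_of_le_one_left (sq_nonneg _) (pow_le_one₀ (by positivity) ?_)
  exact inv_le_one_of_one_le₀ (Real.one_le_sqrt.2 (Φ.one_le i))

open Classical in
theorem inner_sum_basis (F : Finset Φ.ι) (c : Φ.ι → ℝ) (i : Φ.ι) :
    inner ℝ (Φ.e i) (∑ k ∈ F, c k • Φ.e k) = if i ∈ F then c i else 0 := by
  rw [inner_sum]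
  have h : ∀ k, inner ℝ (Φ.e i) (c k • Φ.e k) = if i = k then c i else 0 := fun k => by
    rw [inner_smul_right, orthonormal_iff_ite.1 Φ.e.orthonormal]
    split_ifs with hik
    · rw [hik, mul_one]
    · rw [mul_zero]
  simp only [h, Finset.sum_ite_eq]

/-- The projection of `w` to finitely many modes. -/
def trunc (F : Finset Φ.ι) (w : L2Omega) : L2Omega := ∑ i ∈ F, inner ℝ (Φ.e i) w • Φ.e i

open Classical in
theorem inner_trunc (F : Finset Φ.ι) (w : L2Omega) (i : Φ.ι) :
    inner ℝ (Φ.e i) (Φ.trunc F w) = if i ∈ F then inner ℝ (Φ.e i) w else 0 :=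
  Φ.inner_sum_basis F _ i

theorem norm_trunc_le (F : Finset Φ.ι) (w : L2Omega) : ‖Φ.trunc F w‖ ≤ ‖w‖ := by
  classical
  refine Φ.e.norm_le_of_inner_sq_le fun i => ?_
  rw [Φ.inner_trunc]
  split_ifs
  · exact le_rfl
  · rw [zero_pow two_ne_zero]; exact sq_nonneg _

theorem norm_B_trunc_le (F : Finset Φ.ι) (w : L2Omega) : ‖Φ.B (Φ.trunc F w)‖ ≤ ‖Φ.B w‖ := by
  classical
  refine Φ.e.norm_le_of_inner_sq_le fun i => ?_
  rw [Φ.inner_B, Φ.inner_B, Φ.inner_trunc]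
  split_ifs
  · exact le_rfl
  · rw [mul_zero, zero_pow two_ne_zero]; exact sq_nonneg _

theorem norm_sub_trunc_sq_le (F : Finset Φ.ι) {w : L2Omega} {M : Φ.ι → ℝ} (hM : Summable M)
    (h : ∀ i, inner ℝ (Φ.e i) w ^ 2 ≤ M i) :
    ‖w - Φ.trunc F w‖ ^ 2 ≤ ∑' i, M i - ∑ i ∈ F, M i := by
  classical
  have h1 : HasSum (fun i => if i ∈ F then M i else 0) (∑ i ∈ F, M i) := by
    have := hasSum_sum_of_ne_finset_zero (f := fun i => if i ∈ F then M i else 0) (s := F)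
      (L := SummationFilter.unconditional _) fun i hi => if_neg hi
    rwa [Finset.sum_congr rfl fun i hi => if_pos hi] at this
  refine hasSum_le (fun i => ?_) (Φ.e.hasSum_inner_sq _) (hM.hasSum.sub h1)
  rw [inner_sub_right, Φ.inner_trunc]
  split_ifs
  · simp
  · simpa using h i

theorem tendsto_trunc (w : L2Omega) : Tendsto (fun F => Φ.trunc F w) atTop (𝓝 w) := by
  have := Φ.e.hasSum_repr w
  simp only [Φ.e.repr_apply_apply] at this
  exact this

theorem inner_B_sum (x : L2Omega) (F : Finset Φ.ι) (c : Φ.ι → ℝ) :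
    inner ℝ x (Φ.B (∑ i ∈ F, c i • Φ.e i)) =
      ∑ i ∈ F, c i * ((√(Φ.ν i))⁻¹ * inner ℝ (Φ.e i) x) := by
  rw [map_sum, inner_sum]
  refine Finset.sum_congr rfl fun i _ => ?_
  rw [map_smul, inner_smul_right, B_basis, inner_smul_right, real_inner_comm]

/-- Sources of potential type, with coercivity bounds. -/
structure IsPotential (N₀ : L2Omega → L2Omega) (J : L2Omega → ℝ) (a b k : ℝ) : Prop where
  lip : LipschitzOnBalls N₀
  deriv : ∀ w, HasFDerivAt J ((innerSL ℝ (N₀ w)).comp Φ.B) w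
  a_pos : 0 < a
  k_nonneg : 0 ≤ k
  le_J : ∀ w, a * ‖Φ.B w‖ ^ 2 - b ≤ J w
  J_le : ∀ w, J w ≤ k * inner ℝ (N₀ w) (Φ.B w) + b
  le_inner : ∀ w, a * ‖Φ.B w‖ ^ 2 - b ≤ inner ℝ (N₀ w) (Φ.B w)

/-- The energy. -/
def energy (J : L2Omega → ℝ) (g w : L2Omega) : ℝ :=
  Φ.γ / 2 * (‖w‖ ^ 2 - ‖Φ.B w‖ ^ 2) + J w - inner ℝ g (Φ.B w)

variable {Φ} {N N₀ : L2Omega → L2Omega} {J : L2Omega → ℝ} {a b k : ℝ} {g w₀ : L2Omega} {T : ℝ}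
  {w : ℝ → L2Omega}

theorem IsMild.mono (h : Φ.IsMild N w₀ T w) {t : ℝ} (ht : t ≤ T) : Φ.IsMild N w₀ t w :=
  ⟨h.continuous, fun s hs => h.inner_eq s ⟨hs.1, hs.2.trans ht⟩⟩

theorem IsMild.hasDerivAt_trunc (h : Φ.IsMild N w₀ T w) (hN : Continuous N) (F : Finset Φ.ι)
    {t : ℝ} (ht : t ∈ Ioo 0 T) : HasDerivAt (fun s => Φ.trunc F (w s))
      (∑ i ∈ F, (-(Φ.eig i) * inner ℝ (Φ.e i) (w t) +
        √(Φ.ν i) * inner ℝ (Φ.e i) (N (w t))) • Φ.e i) t := by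
  have h1 : HasDerivAt (fun s => ∑ i ∈ F, Φ.coeff w₀ (fun s => N (w s)) i s • Φ.e i)
      (∑ i ∈ F, (-(Φ.eig i) * Φ.coeff w₀ (fun s => N (w s)) i t +
        √(Φ.ν i) * inner ℝ (Φ.e i) (N (w t))) • Φ.e i) t :=
    HasDerivAt.fun_sum fun i _ =>
      (Φ.hasDerivAt_coeff w₀ (hN.comp h.continuous) i t).smul_const (Φ.e i)
  have ht' : t ∈ Icc 0 T := Ioo_subset_Icc_self ht
  simp only [← h.inner_eq t ht'] at h1
  refine h1.congr_of_eventuallyEq ?_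
  filter_upwards [isOpen_Ioo.mem_nhds ht] with s hs
  exact Finset.sum_congr rfl fun i _ => by rw [h.inner_eq s (Ioo_subset_Icc_self hs)]

/-- The error is controlled by the tail of a summable bound that does not depend on time, hence
uniformly on `[0, T]`. -/
theorem IsMild.exists_trunc_error (h : Φ.IsMild N w₀ T w) (hN : Continuous N) (hT : 0 ≤ T) :
    ∃ η : Finset Φ.ι → ℝ, Tendsto η atTop (𝓝 0) ∧
      ∀ F, ∀ t ∈ Icc 0 T, ‖w t - Φ.trunc F (w t)‖ ≤ η F := by
  have hc := hN.comp h.continuous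
  have hM := Φ.summable_coeffBound w₀ hc hT
  refine ⟨fun F => √(∑' i, Φ.coeffBound w₀ (fun s => N (w s)) T i -
    ∑ i ∈ F, Φ.coeffBound w₀ (fun s => N (w s)) T i), ?_,
    fun F t ht => Real.le_sqrt_of_sq_le (Φ.norm_sub_trunc_sq_le F hM fun i => ?_)⟩
  · have h1 : Tendsto (fun F => ∑ i ∈ F, Φ.coeffBound w₀ (fun s => N (w s)) T i) atTop
        (𝓝 (∑' i, Φ.coeffBound w₀ (fun s => N (w s)) T i)) := hM.hasSum
    simpa using (h1.const_sub (∑' i, Φ.coeffBound w₀ (fun s => N (w s)) T i)).sqrt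
  · rw [h.inner_eq t ht]
    exact Φ.coeff_sq_le w₀ hc ht i

theorem continuous_trunc (Φ : FracSpectrum α) (F : Finset Φ.ι) : Continuous (Φ.trunc F) := by
  unfold trunc
  fun_prop

/-- A differential inequality along the truncations passes to the limit. -/
theorem IsMild.sub_le_of_trunc (h : Φ.IsMild N w₀ T w) {E : L2Omega → ℝ} (hE : Continuous E)
    {ε : Finset Φ.ι → ℝ} {c : ℝ}
    (hd : ∀ F, ∀ t ∈ Ioo 0 T, ∃ m, HasDerivAt (fun s => E (Φ.trunc F (w s))) m t ∧ m ≤ c + ε F)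
    (hε : Tendsto ε atTop (𝓝 0)) {s t : ℝ}
    (hs : 0 ≤ s) (hst : s ≤ t) (ht : t ≤ T) : E (w t) - E (w s) ≤ c * (t - s) := by
  have hF (F) : E (Φ.trunc F (w t)) - E (Φ.trunc F (w s)) ≤ (c + ε F) * (t - s) := by
    refine Convex.image_sub_le_mul_sub_of_deriv_le (convex_Icc 0 T)
      (f := fun s => E (Φ.trunc F (w s)))
      (hE.comp ((continuous_trunc Φ F).comp h.continuous)).continuousOn
      (fun x hx => ?_) (fun x hx => ?_) s ⟨hs, hst.trans ht⟩ t ⟨hs.trans hst, ht⟩ hst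
    · rw [interior_Icc] at hx
      obtain ⟨m, hm, -⟩ := hd F x hx
      exact hm.differentiableAt.differentiableWithinAt
    · rw [interior_Icc] at hx
      obtain ⟨m, hm, hle⟩ := hd F x hx
      rwa [hm.deriv]
  have hlim (r : ℝ) : Tendsto (fun F => E (Φ.trunc F (w r))) atTop (𝓝 (E (w r))) :=
    (hE.tendsto _).comp (Φ.tendsto_trunc _)
  have h2 : Tendsto (fun F => (c + ε F) * (t - s)) atTop (𝓝 ((c + 0) * (t - s))) :=
    (hε.const_add c).mul_const _
  rw [add_zero] at h2
  exact le_of_tendsto_of_tendsto' ((hlim t).sub (hlim s)) h2 hF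

theorem sum_basis_inner (Φ : FracSpectrum α) (x : L2Omega) (F : Finset Φ.ι) (c : Φ.ι → ℝ) :
    inner ℝ x (∑ i ∈ F, c i • Φ.e i) = ∑ i ∈ F, c i * inner ℝ (Φ.e i) x := by
  rw [inner_sum]
  exact Finset.sum_congr rfl fun i _ => by rw [inner_smul_right, real_inner_comm]

theorem IsPotential.continuous_J (P : Φ.IsPotential N₀ J a b k) : Continuous J :=
  continuous_iff_continuousAt.2 fun w => (P.deriv w).continuousAt

theorem IsPotential.continuous_source (P : Φ.IsPotential N₀ J a b k) (g : L2Omega) :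
    Continuous fun w => g - N₀ w := continuous_const.sub P.lip.continuous

/-- Formally `E' = -‖u'‖²` with `u = B w`. On a truncation the equation still contains `N₀ (w)`
while the derivative of the potential is taken at the truncated point. This defect `d` enters as
`-‖u'‖² + ⟨u', d⟩ ≤ ‖d‖² / 4`, which tends to zero. -/
theorem IsPotential.energy_le (P : Φ.IsPotential N₀ J a b k)
    (h : Φ.IsMild (fun w => g - N₀ w) w₀ T w) {s t : ℝ} (hs : 0 ≤ s) (hst : s ≤ t) (ht : t ≤ T) :
    Φ.energy J g (w t) ≤ Φ.energy J g (w s) := by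
  have hT : 0 ≤ T := hs.trans (hst.trans ht)
  have hNc := P.continuous_source g
  obtain ⟨η, hη, hηle⟩ := h.exists_trunc_error hNc hT
  obtain ⟨R, hR⟩ := isCompact_Icc.exists_bound_of_continuousOn (h.continuous.continuousOn
    (s := Icc 0 T))
  obtain ⟨L, hL0, hL⟩ := P.lip R
  have hJ := P.continuous_J
  have hEc : Continuous (Φ.energy J g) := by
    unfold energy
    fun_prop
  have hε : Tendsto (fun F => (L * η F) ^ 2 / 4) atTop (𝓝 0) := by
    have := ((hη.const_mul L).pow 2).div_const 4
    simpa using this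
  suffices hmain : Φ.energy J g (w t) - Φ.energy J g (w s) ≤ 0 * (t - s) by linarith
  refine h.sub_le_of_trunc hEc (ε := fun F => (L * η F) ^ 2 / 4) (fun F x hx => ?_) hε hs hst ht
  have h1 := h.hasDerivAt_trunc hNc F hx
  have h2 := Φ.B.hasFDerivAt.comp_hasDerivAt x h1
  refine ⟨_, (((h1.norm_sq.sub h2.norm_sq).const_mul (Φ.γ / 2)).add
    ((P.deriv _).comp_hasDerivAt x h1)).sub ((hasDerivAt_const x g).inner ℝ h2), ?_⟩
  · classical
    have hx' := Ioo_subset_Icc_self hx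
    simp only [Function.comp_apply, ContinuousLinearMap.comp_apply, innerSL_apply_apply,
      inner_zero_left, add_zero, inner_B_sum, sum_basis_inner, zero_add]
    set d := N₀ (Φ.trunc F (w x)) - N₀ (w x) with hd
    have hdL : ‖d‖ ≤ L * η F := by
      refine (hL _ _ ((Φ.norm_trunc_le F _).trans (hR x hx')) (hR x hx')).trans ?_
      rw [norm_sub_rev]
      exact mul_le_mul_of_nonneg_left (hηle F x hx') hL0
    refine le_trans ?_ (div_le_div_of_nonneg_right (pow_le_pow_left₀ (norm_nonneg _) hdL 2)
      (by norm_num))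
    refine le_trans ?_ (div_le_div_of_nonneg_right (Φ.e.sum_inner_sq_le d F) (by norm_num))
    rw [← mul_sub, ← Finset.sum_sub_distrib, ← mul_assoc, Finset.mul_sum,
      ← Finset.sum_add_distrib, ← Finset.sum_sub_distrib, Finset.sum_div]
    refine Finset.sum_le_sum fun i hi => ?_
    rw [Φ.inner_B, Φ.inner_trunc, if_pos hi, hd, inner_sub_right, inner_sub_right]
    have hr : √(Φ.ν i) * (√(Φ.ν i))⁻¹ = 1 := mul_inv_cancel₀ (Φ.sqrt_ν_pos i).ne'
    rw [show Φ.eig i = Φ.γ * (√(Φ.ν i) ^ 2 - 1) by rw [Φ.sq_sqrt_ν, eig]]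
    generalize √(Φ.ν i) = q at *
    generalize q⁻¹ = r at *
    generalize inner ℝ (Φ.e i) (w x) = c
    generalize inner ℝ (Φ.e i) g = y
    generalize inner ℝ (Φ.e i) (N₀ (w x)) = z
    generalize inner ℝ (Φ.e i) (N₀ (Φ.trunc F (w x))) = z'
    set c' := -(Φ.γ * (q ^ 2 - 1)) * c + q * (y - z) with hc'
    -- The equation for one mode, solved for the gradient of the quadratic energy; `c'` is the time
    -- derivative of the coefficient of `w`, and `r * c'` that of `u`.
    have h3 : Φ.γ * (1 - r ^ 2) * c = r * (y - z) - r ^ 2 * c' := by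
      rw [hc']
      linear_combination (Φ.γ * c * (q * r + 1) - (y - z) * r) * -hr
    linear_combination sq_nonneg (r * c' - (z' - z) / 2) + c' * h3

/-- Dissipation of the `L²` norm. -/
theorem IsMild.norm_B_sq_sub_le (h : Φ.IsMild N w₀ T w) (hN : Continuous N) {c : ℝ}
    (hc : ∀ s ∈ Icc 0 T, -Φ.γ * (‖w s‖ ^ 2 - ‖Φ.B (w s)‖ ^ 2) +
      inner ℝ (Φ.B (w s)) (N (w s)) ≤ c) (hT : 0 ≤ T) :
    ‖Φ.B (w T)‖ ^ 2 - ‖Φ.B (w 0)‖ ^ 2 ≤ 2 * c * T := by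
  have hγ := Φ.γ_pos
  obtain ⟨η, hη, hηle⟩ := h.exists_trunc_error hN hT
  obtain ⟨R, hR⟩ := isCompact_Icc.exists_bound_of_continuousOn (h.continuous.continuousOn
    (s := Icc 0 T))
  obtain ⟨H, hH⟩ := isCompact_Icc.exists_bound_of_continuousOn
    ((hN.comp h.continuous).continuousOn (s := Icc 0 T))
  -- Truncation changes `γ ‖w‖ ^ 2` by at most `2 γ R η` and the source term by at most `H η`; the
  -- `‖B w‖ ^ 2` term changes in the favourable direction.
  have hε : Tendsto (fun F => 2 * (Φ.γ * (2 * R) + H) * η F) atTop (𝓝 0) := by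
    simpa using hη.const_mul (2 * (Φ.γ * (2 * R) + H))
  suffices hmain : ‖Φ.B (w T)‖ ^ 2 - ‖Φ.B (w 0)‖ ^ 2 ≤ 2 * c * (T - 0) by rwa [sub_zero] at hmain
  refine h.sub_le_of_trunc (E := fun x => ‖Φ.B x‖ ^ 2) (by fun_prop) (fun F x hx => ?_)
    hε le_rfl hT le_rfl
  have h1 := h.hasDerivAt_trunc hN F hx
  refine ⟨_, (Φ.B.hasFDerivAt.comp_hasDerivAt x h1).norm_sq, ?_⟩
  · classical
    have hx' := Ioo_subset_Icc_self hx
    have h2 := hc x hx'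
    have hid : inner ℝ (Φ.B (Φ.trunc F (w x))) (Φ.B (∑ i ∈ F, (-(Φ.eig i) *
        inner ℝ (Φ.e i) (w x) + √(Φ.ν i) * inner ℝ (Φ.e i) (N (w x))) • Φ.e i)) =
        -Φ.γ * (‖Φ.trunc F (w x)‖ ^ 2 - ‖Φ.B (Φ.trunc F (w x))‖ ^ 2) +
          inner ℝ (Φ.B (Φ.trunc F (w x))) (N (w x)) := by
      rw [← real_inner_self_eq_norm_sq, ← real_inner_self_eq_norm_sq,
        real_inner_comm (N (w x))]
      nth_rewrite 3 [trunc]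
      nth_rewrite 4 [trunc]
      nth_rewrite 4 [trunc]
      rw [sum_basis_inner, inner_B_sum, inner_B_sum, inner_B_sum, ← Finset.sum_sub_distrib,
        Finset.mul_sum, ← Finset.sum_add_distrib]
      refine Finset.sum_congr rfl fun i hi => ?_
      rw [Φ.inner_B, Φ.inner_trunc, if_pos hi]
      have hr : √(Φ.ν i) * (√(Φ.ν i))⁻¹ = 1 := mul_inv_cancel₀ (Φ.sqrt_ν_pos i).ne'
      rw [show Φ.eig i = Φ.γ * (√(Φ.ν i) ^ 2 - 1) by rw [Φ.sq_sqrt_ν, eig]]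
      generalize √(Φ.ν i) = q at *
      generalize q⁻¹ = r at *
      generalize inner ℝ (Φ.e i) (w x) = c
      generalize inner ℝ (Φ.e i) (N (w x)) = y
      linear_combination (r * c * y - Φ.γ * c ^ 2 * (q * r + 1)) * hr
    simp only [Function.comp_apply]
    rw [hid]
    have h3 := Φ.norm_trunc_le F (w x)
    have h4 := Φ.norm_B_trunc_le F (w x)
    have h5 := hηle F x hx'
    have h6 : ‖w x‖ ^ 2 - ‖Φ.trunc F (w x)‖ ^ 2 ≤ 2 * R * η F := by
      have h7 : ‖w x‖ - ‖Φ.trunc F (w x)‖ ≤ η F := (norm_sub_norm_le _ _).trans h5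
      have h8 : ‖w x‖ + ‖Φ.trunc F (w x)‖ ≤ 2 * R := by linarith [hR x hx']
      have h9 := mul_le_mul h8 h7 (sub_nonneg.2 h3) (by linarith [norm_nonneg (w x), hR x hx'])
      linarith
    have h7 := pow_le_pow_left₀ (norm_nonneg _) h4 2
    have h8 : inner ℝ (Φ.B (Φ.trunc F (w x))) (N (w x)) - inner ℝ (Φ.B (w x)) (N (w x)) ≤
        H * η F := by
      rw [← inner_sub_left, ← map_sub]
      refine (real_inner_le_norm _ _).trans ?_
      rw [mul_comm]
      refine mul_le_mul (hH x hx') ?_ (norm_nonneg _) ((norm_nonneg _).trans (hH x hx'))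
      refine (Φ.norm_B_le _).trans ?_
      rwa [norm_sub_rev]
    have h9 := mul_le_mul_of_nonneg_left h6 hγ.le
    have h10 := mul_le_mul_of_nonneg_left h7 hγ.le
    linarith

end FracSpectrum

end

/-! ### A priori bounds, absorbing set and global existence. -/

noncomputable section

namespace FracSpectrum

variable {α : ℝ} {Φ : FracSpectrum α} {N₀ : L2Omega → L2Omega} {J : L2Omega → ℝ} {a b k : ℝ}

namespace IsPotential

variable (P : Φ.IsPotential N₀ J a b k) (g : L2Omega)

include P

/-- The bracket on the right is minus half the time derivative of `‖B w‖ ^ 2`, so large energy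
forces decay of the `L²` norm. One `b` comes from `J_le`, the other from `le_inner`; the last
constant is Young's inequality for `k ⟨g, B w⟩` against `a ‖B w‖ ^ 2`. -/
theorem energy_sub_le (w : L2Omega) :
    Φ.energy J g w - (2 * b + k ^ 2 * ‖g‖ ^ 2 / (4 * a)) ≤
      (k + 1) * (Φ.γ * (‖w‖ ^ 2 - ‖Φ.B w‖ ^ 2) - inner ℝ (Φ.B w) (g - N₀ w)) := by
  have ha := P.a_pos
  have hk := P.k_nonneg
  have h1 := P.J_le w
  have h2 := P.le_inner w
  have h3 : inner ℝ g (Φ.B w) ≤ ‖g‖ * ‖Φ.B w‖ := real_inner_le_norm _ _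
  have h4 : 0 ≤ Φ.γ * (‖w‖ ^ 2 - ‖Φ.B w‖ ^ 2) :=
    mul_nonneg Φ.γ_pos.le (sub_nonneg.2 (pow_le_pow_left₀ (norm_nonneg _) (Φ.norm_B_le w) 2))
  have h5 : k * (‖g‖ * ‖Φ.B w‖) ≤ a * ‖Φ.B w‖ ^ 2 + k ^ 2 * ‖g‖ ^ 2 / (4 * a) := by
    have h6 : k ^ 2 * ‖g‖ ^ 2 / (4 * a) = a * (k * ‖g‖ / (2 * a)) ^ 2 := by field_simp; ring
    have h7 : k * (‖g‖ * ‖Φ.B w‖) = 2 * a * ‖Φ.B w‖ * (k * ‖g‖ / (2 * a)) := by field_simp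
    rw [h6, h7]
    nlinarith [mul_nonneg ha.le (sq_nonneg (‖Φ.B w‖ - k * ‖g‖ / (2 * a)))]
  have h6 := mul_le_mul_of_nonneg_left h3 hk
  have h7 := mul_nonneg hk h4
  rw [energy, inner_sub_right, real_inner_comm g, real_inner_comm (N₀ w)]
  linarith

/-- The quadratic part controls only `‖w‖ ^ 2 - ‖B w‖ ^ 2`; coercivity of `J` supplies the missing
`L²` part, half of it being spent on absorbing `g`. -/
theorem le_energy (w : L2Omega) :
    min Φ.γ a / 2 * ‖w‖ ^ 2 - (‖g‖ ^ 2 / (2 * a) + b) ≤ Φ.energy J g w := by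
  have ha := P.a_pos
  have h1 := P.le_J w
  have h3 : inner ℝ g (Φ.B w) ≤ ‖g‖ * ‖Φ.B w‖ := real_inner_le_norm _ _
  have h4 : 0 ≤ ‖w‖ ^ 2 - ‖Φ.B w‖ ^ 2 :=
    sub_nonneg.2 (pow_le_pow_left₀ (norm_nonneg _) (Φ.norm_B_le w) 2)
  have h5 : ‖g‖ * ‖Φ.B w‖ ≤ a / 2 * ‖Φ.B w‖ ^ 2 + ‖g‖ ^ 2 / (2 * a) := by
    have h6 : ‖g‖ ^ 2 / (2 * a) = a / 2 * (‖g‖ / a) ^ 2 := by field_simp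
    have h7 : ‖g‖ * ‖Φ.B w‖ = a * ‖Φ.B w‖ * (‖g‖ / a) := by field_simp
    rw [h6, h7]
    nlinarith [mul_nonneg ha.le (sq_nonneg (‖Φ.B w‖ - ‖g‖ / a))]
  have h6 := mul_le_mul_of_nonneg_right (min_le_left Φ.γ a) h4
  have h7 := mul_le_mul_of_nonneg_right (min_le_right Φ.γ a) (sq_nonneg ‖Φ.B w‖)
  rw [energy]
  linarith

theorem exists_energy_le (M : ℝ) : ∃ K, ∀ w, ‖w‖ ≤ M → Φ.energy J g w ≤ K := by
  obtain ⟨C, hC0, hC⟩ := P.lip.exists_norm_le M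
  refine ⟨Φ.γ / 2 * M ^ 2 + (k * (C * M) + b) + ‖g‖ * M, fun w hw => ?_⟩
  have hB : ‖Φ.B w‖ ≤ M := (Φ.norm_B_le w).trans hw
  have h1 := P.J_le w
  have h2 : inner ℝ (N₀ w) (Φ.B w) ≤ C * M := (real_inner_le_norm _ _).trans
    (mul_le_mul (hC w hw) hB (norm_nonneg _) hC0)
  have h3 : -inner ℝ g (Φ.B w) ≤ ‖g‖ * M := by
    rw [← inner_neg_left]
    refine (real_inner_le_norm _ _).trans ?_
    rw [norm_neg]
    exact mul_le_mul_of_nonneg_left hB (norm_nonneg _)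
  have h4 : ‖w‖ ^ 2 - ‖Φ.B w‖ ^ 2 ≤ M ^ 2 := by
    have := pow_le_pow_left₀ (norm_nonneg _) hw 2
    nlinarith [sq_nonneg ‖Φ.B w‖]
  have h5 := mul_le_mul_of_nonneg_left h4 (half_pos Φ.γ_pos).le
  have h6 := mul_le_mul_of_nonneg_left h2 P.k_nonneg
  rw [energy]
  linarith

theorem norm_le_of_energy_le {w : L2Omega} {E : ℝ} (h : Φ.energy J g w ≤ E) :
    ‖w‖ ≤ √((E + (‖g‖ ^ 2 / (2 * a) + b)) / (min Φ.γ a / 2)) := by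
  have h0 : 0 < min Φ.γ a / 2 := half_pos (lt_min Φ.γ_pos P.a_pos)
  refine Real.le_sqrt_of_sq_le ?_
  rw [le_div_iff₀ h0]
  have := P.le_energy g w
  linarith

/-- Bounds uniform in time. -/
theorem exists_norm_le (M : ℝ) : ∃ K, M ≤ K ∧ ∀ w₀ T w, ‖w₀‖ ≤ M →
    Φ.IsMild (fun w => g - N₀ w) w₀ T w → ∀ t ∈ Icc 0 T, ‖w t‖ ≤ K := by
  obtain ⟨E, hE⟩ := P.exists_energy_le g M
  refine ⟨max M √((E + (‖g‖ ^ 2 / (2 * a) + b)) / (min Φ.γ a / 2)), le_max_left _ _,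
    fun w₀ T w hw₀ h t ht => le_trans (P.norm_le_of_energy_le g ?_) (le_max_right _ _)⟩
  refine (P.energy_le h le_rfl ht.1 ht.2).trans (hE _ ?_)
  rwa [h.zero (ht.1.trans ht.2)]

/-- A bounded absorbing set. -/
theorem exists_absorbing : ∃ R : ℝ, ∀ M : ℝ, ∃ t₀, 0 ≤ t₀ ∧ ∀ w₀ T w, ‖w₀‖ ≤ M →
    Φ.IsMild (fun w => g - N₀ w) w₀ T w → ∀ t ∈ Icc t₀ T, ‖w t‖ ≤ R := by
  set C := 2 * b + k ^ 2 * ‖g‖ ^ 2 / (4 * a) with hC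
  have hk := P.k_nonneg
  -- The radius corresponds to the energy level `C + 1`. If the energy exceeds this level at time
  -- `t`, monotonicity keeps it above on `[0, t]`, and the dissipation inequality yields `2 t ≤ (k +
  -- 1) M ^ 2`, which fails for `t ≥ t₀`.
  refine ⟨√((C + 1 + (‖g‖ ^ 2 / (2 * a) + b)) / (min Φ.γ a / 2)), fun M =>
    ⟨(k + 1) * M ^ 2 / 2 + 1, by positivity, fun w₀ T w hw₀ h t ht => P.norm_le_of_energy_le g ?_⟩⟩
  have ht0 : 0 ≤ t := le_trans (by positivity) ht.1
  by_contra! hlt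
  have h1 := (h.mono ht.2).norm_B_sq_sub_le (P.continuous_source g)
    (c := -(Φ.energy J g (w t) - C) / (k + 1)) (fun s hs => by
      rw [le_div_iff₀ (by linarith)]
      have h2 := P.energy_sub_le g (w s)
      have h3 := P.energy_le h hs.1 hs.2 ht.2
      linarith) ht0
  rw [h.zero (ht0.trans ht.2)] at h1
  have h2 : ‖Φ.B w₀‖ ^ 2 ≤ M ^ 2 :=
    pow_le_pow_left₀ (norm_nonneg _) ((Φ.norm_B_le _).trans hw₀) 2
  have h3 : 2 * (Φ.energy J g (w t) - C) * t / (k + 1) ≤ M ^ 2 := by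
    have : 2 * (-(Φ.energy J g (w t) - C) / (k + 1)) * t =
      -(2 * (Φ.energy J g (w t) - C) * t / (k + 1)) := by ring
    rw [this] at h1
    nlinarith [sq_nonneg ‖Φ.B (w t)‖]
  rw [div_le_iff₀ (by linarith)] at h3
  have h4 := ht.1
  have h5 : 0 < t := lt_of_lt_of_le (by positivity) h4
  nlinarith

theorem lipschitzOnBalls_source : LipschitzOnBalls fun w => g - N₀ w := fun R => by
  obtain ⟨L, hL0, hL⟩ := P.lip R
  refine ⟨L, hL0, fun x y hx hy => ?_⟩
  rw [sub_sub_sub_cancel_left, norm_sub_rev]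
  exact hL x y hx hy

/-- Global existence. -/
theorem exists_isMild (w₀ : L2Omega) : ∃ w : ℝ → L2Omega, ∀ T,
    Φ.IsMild (fun w => g - N₀ w) w₀ T w := by
  obtain ⟨K, hMK, hK⟩ := P.exists_norm_le g ‖w₀‖
  -- The cutoff radius exceeds the a priori bound by `1`. The solution with the modified source
  -- solves the original equation as long as it stays in this ball.
  obtain ⟨N', L, C, hL0, hC0, hL, hC, hN'⟩ := (P.lipschitzOnBalls_source g).exists_cutoff (K + 1)
  obtain ⟨w, hw⟩ := exists_isMild_of_bounded Φ hL0 hC0 hL hC w₀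
  have hwc := (hw 0).continuous
  have hw0 : w 0 = w₀ := (hw 0).zero le_rfl
  have hmild {T : ℝ} (hT : ∀ s ∈ Icc 0 T, ‖w s‖ ≤ K + 1) :
      Φ.IsMild (fun w => g - N₀ w) w₀ T w := by
    refine ⟨hwc, fun t ht i => ?_⟩
    rw [(hw T).inner_eq t ht]
    exact Φ.coeff_congr w₀ i ht.1 fun s hs => hN' _ (hT s ⟨hs.1, hs.2.trans ht.2⟩)
  suffices hlt : ∀ t, 0 ≤ t → ‖w t‖ < K + 1 from
    ⟨w, fun T => hmild fun s hs => (hlt s hs.1).le⟩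
  by_contra! hex
  obtain ⟨t₁, ht₁, hwt₁⟩ := hex
  set A := {t : ℝ | 0 ≤ t ∧ K + 1 ≤ ‖w t‖} with hA
  have hAc : IsClosed A := isClosed_Ici.inter (isClosed_le continuous_const hwc.norm)
  have hAb : BddBelow A := ⟨0, fun t ht => ht.1⟩
  have hmem := hAc.csInf_mem ⟨t₁, ht₁, hwt₁⟩ hAb
  -- At the first time when the norm reaches `K + 1`, the a priori bound on earlier times and
  -- continuity give a norm of at most `K`, a contradiction.
  set τ := sInf A with hτ
  have hτ0 : 0 < τ := by
    refine hmem.1.lt_of_ne fun h0 => ?_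
    have := hmem.2
    rw [← h0, hw0] at this
    linarith
  have hbefore : ∀ t ∈ Ico 0 τ, ‖w t‖ ≤ K := by
    intro t ht
    refine hK w₀ t w le_rfl (hmild fun s hs => ?_) t (right_mem_Icc.2 ht.1)
    by_contra! hs'
    exact absurd (csInf_le hAb ⟨hs.1, hs'.le⟩) (not_le.2 (hs.2.trans_lt ht.2))
  have hle : ‖w τ‖ ≤ K := by
    have hlim : Tendsto (fun t => ‖w t‖) (𝓝[<] τ) (𝓝 ‖w τ‖) :=
      (hwc.norm.tendsto τ).mono_left nhdsWithin_le_nhds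
    refine le_of_tendsto hlim ?_
    filter_upwards [Ico_mem_nhdsLT hτ0] with t ht using hbefore t ht
  linarith [hmem.2]

end IsPotential

end FracSpectrum

end

/-! ### The superposition operator as a gradient with coercive potential. -/

noncomputable section

theorem superpose_ae_eq {f : ℝ → ℝ} {u : L2Omega}
    (h : MemLp (fun x => f (u x)) 2 (volume.restrict Omega)) :
    superpose f u =ᵐ[volume.restrict Omega] fun x => f (u x) := by
  rw [superpose, dif_pos h]
  exact h.coeFn_toLp

/-- Dividing the bounds on `f s * s` by `s` is useful only for `s ≥ 1`; on `[0, 1]` continuity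
bounds `f`. The lower bound `c₁ σ - c₅` integrates to `c₁ s² / 2 - c₅ s`, and half of the quadratic
term absorbs the linear one. -/
theorem exists_bound_primitive_of_nonneg {f : ℝ → ℝ} (hf : Continuous f)
    {p c₁ c₂ c₃ c₄ : ℝ} (hp : 2 ≤ p) (h₁ : 0 < c₁) (h₂ : 0 < c₂) (h₃ : 0 < c₃) (h₄ : 0 < c₄)
    (h : ∀ s : ℝ, c₁ * |s| ^ p - c₂ ≤ f s * s ∧ f s * s ≤ c₃ * |s| ^ p + c₄) :
    ∃ m, 0 ≤ m ∧ ∀ s, 0 ≤ s → c₁ / 4 * s ^ 2 - m ≤ ∫ σ in (0 : ℝ)..s, f σ ∧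
      ∫ σ in (0 : ℝ)..s, f σ ≤ m * |s| ^ p + m := by
  obtain ⟨R, hR⟩ := isCompact_Icc.exists_bound_of_continuousOn (hf.continuousOn (s := Icc 0 1))
  have hR0 : 0 ≤ R := (norm_nonneg _).trans (hR 0 (left_mem_Icc.2 zero_le_one))
  have hlow : ∀ σ, 0 ≤ σ → c₁ * σ - (c₁ + c₂ + R) ≤ f σ := by
    intro σ hσ
    rcases le_total σ 1 with h1 | h1
    · have := (abs_le.1 (hR σ ⟨hσ, h1⟩)).1
      nlinarith
    · have h5 := (h σ).1
      rw [abs_of_nonneg hσ] at h5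
      have h6 : σ ^ 2 ≤ σ ^ p := by
        have := Real.rpow_le_rpow_of_exponent_le h1 hp
        rwa [Real.rpow_two] at this
      by_contra! hlt
      nlinarith [mul_lt_mul_of_pos_right hlt (by linarith : 0 < σ)]
  have hup : ∀ s σ, 0 ≤ σ → σ ≤ s → f σ ≤ c₃ * s ^ (p - 1) + (c₄ + R) := by
    intro s σ hσ hσs
    have hs1 : 0 ≤ s ^ (p - 1) := Real.rpow_nonneg (hσ.trans hσs) _
    rcases le_total σ 1 with h1 | h1
    · have := (abs_le.1 (hR σ ⟨hσ, h1⟩)).2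
      nlinarith
    · have h5 := (h σ).2
      have hσ0 : 0 < σ := by linarith
      have h6 : σ ^ p = σ ^ (p - 1) * σ := by
        rw [Real.rpow_sub_one hσ0.ne', div_mul_cancel₀ _ hσ0.ne']
      have h7 : σ ^ (p - 1) ≤ s ^ (p - 1) := Real.rpow_le_rpow hσ hσs (by linarith)
      rw [abs_of_nonneg hσ, h6] at h5
      have h8 : f σ ≤ c₃ * σ ^ (p - 1) + c₄ := by
        by_contra! hlt
        nlinarith [mul_lt_mul_of_pos_right hlt hσ0]
      nlinarith
  set c₅ := c₁ + c₂ + R with hc₅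
  have hc₅0 : 0 ≤ c₅ ^ 2 / c₁ := by positivity
  refine ⟨c₅ ^ 2 / c₁ + (c₃ + c₄ + R), by positivity, fun s hs => ⟨?_, ?_⟩⟩
  · have h5 : ∫ σ in (0 : ℝ)..s, (c₁ * σ - c₅) ≤ ∫ σ in (0 : ℝ)..s, f σ :=
      intervalIntegral.integral_mono_on hs (Continuous.intervalIntegrable (by fun_prop) _ _)
        (hf.intervalIntegrable _ _) fun σ hσ => hlow σ hσ.1
    rw [intervalIntegral.integral_sub (Continuous.intervalIntegrable (by fun_prop) _ _)
      (Continuous.intervalIntegrable (by fun_prop) _ _), intervalIntegral.integral_const_mul,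
      integral_id, intervalIntegral.integral_const, smul_eq_mul] at h5
    have h6 : c₅ ^ 2 / c₁ = c₁ * (c₅ / c₁) ^ 2 := by field_simp
    have h7 : s * c₅ = c₁ * s * (c₅ / c₁) := by field_simp
    rw [h6]
    rw [sub_zero, h7] at h5
    nlinarith [mul_nonneg h₁.le (sq_nonneg (s / 2 - c₅ / c₁))]
  · have h5 : ∫ σ in (0 : ℝ)..s, f σ ≤ ∫ σ in (0 : ℝ)..s, (c₃ * s ^ (p - 1) + (c₄ + R)) :=
      intervalIntegral.integral_mono_on hs (hf.intervalIntegrable _ _)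
        (Continuous.intervalIntegrable (by fun_prop) _ _) fun σ hσ => hup s σ hσ.1 hσ.2
    rw [intervalIntegral.integral_const, smul_eq_mul, sub_zero] at h5
    refine h5.trans ?_
    rw [abs_of_nonneg hs]
    have h6 : s * s ^ (p - 1) = s ^ p := by
      rcases hs.eq_or_lt with rfl | hs0
      · rw [zero_mul, Real.zero_rpow (by linarith)]
      · rw [Real.rpow_sub_one hs0.ne', mul_div_cancel₀ _ hs0.ne']
    have h7 : s ≤ s ^ p + 1 := by
      have h0 : 0 ≤ s ^ p := Real.rpow_nonneg hs _
      rcases le_total s 1 with h1 | h1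
      · linarith
      · have := Real.rpow_le_rpow_of_exponent_le h1 (by linarith : 1 ≤ p)
        rw [Real.rpow_one] at this
        linarith
    have h8 : 0 ≤ s ^ p := Real.rpow_nonneg hs _
    have h9 := mul_nonneg hc₅0 h8
    nlinarith

/-- Coercivity of a nonlinearity with polynomial growth and of its primitive. -/
theorem GrowthCondition.exists_bounds {f : ℝ → ℝ} (h : GrowthCondition f) (hf : Continuous f) :
    ∃ a b k : ℝ, 0 < a ∧ 0 ≤ k ∧ ∀ s, a * s ^ 2 - b ≤ ∫ σ in (0 : ℝ)..s, f σ ∧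
      ∫ σ in (0 : ℝ)..s, f σ ≤ k * (f s * s) + b ∧ a * s ^ 2 - b ≤ f s * s := by
  obtain ⟨p, hp, c₁, c₂, c₃, c₄, h₁, h₂, h₃, h₄, hb⟩ := h
  obtain ⟨m, hm0, hm⟩ := exists_bound_primitive_of_nonneg hf hp h₁ h₂ h₃ h₄ hb
  -- Negative arguments are handled by the reflection `-f (-s)`, which satisfies the same growth
  -- bounds.
  obtain ⟨m', hm0', hm'⟩ := exists_bound_primitive_of_nonneg (f := fun s => -f (-s))
    (by fun_prop) hp h₁ h₂ h₃ h₄ fun s => by simpa using hb (-s)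
  have hF (s : ℝ) : c₁ / 4 * s ^ 2 - (m + m') ≤ ∫ σ in (0 : ℝ)..s, f σ ∧
      ∫ σ in (0 : ℝ)..s, f σ ≤ (m + m') * |s| ^ p + (m + m') := by
    have hsp : 0 ≤ |s| ^ p := Real.rpow_nonneg (abs_nonneg s) _
    rcases le_total 0 s with hs | hs
    · have h5 := hm s hs
      constructor <;> nlinarith
    · have h5 := hm' (-s) (by linarith)
      rw [intervalIntegral.integral_neg, intervalIntegral.integral_comp_neg, neg_neg, neg_zero,
        ← intervalIntegral.integral_symm, abs_neg, neg_sq] at h5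
      constructor <;> nlinarith
  -- This will be `k`: it converts the bound of the primitive by `(m + m') |s| ^ p` into one by `f s
  -- * s`, through the lower growth bound.
  have hk : 0 ≤ (m + m') / c₁ := by positivity
  refine ⟨c₁ / 4, (m + m') + (m + m') / c₁ * c₂ + (c₁ + c₂), (m + m') / c₁, by positivity, hk, fun s => ⟨?_, ?_, ?_⟩⟩
  · have : 0 ≤ (m + m') / c₁ * c₂ := by positivity
    linarith [(hF s).1]
  · have h5 := mul_le_mul_of_nonneg_left (hb s).1 hk
    have h6 : (m + m') / c₁ * (c₁ * |s| ^ p - c₂) =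
        (m + m') * |s| ^ p - (m + m') / c₁ * c₂ := by field_simp
    linarith [(hF s).2]
  · have h5 : s ^ 2 ≤ |s| ^ p + 1 := by
      have h0 : 0 ≤ |s| ^ p := Real.rpow_nonneg (abs_nonneg s) _
      rw [← sq_abs]
      rcases le_total |s| 1 with h1 | h1
      · have := pow_le_one₀ (abs_nonneg s) h1 (n := 2)
        linarith
      · have := Real.rpow_le_rpow_of_exponent_le h1 hp
        rw [Real.rpow_two] at this
        linarith
    have h6 := (hb s).1
    have : 0 ≤ (m + m') / c₁ * c₂ := by positivity
    nlinarith [sq_nonneg s]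

namespace FracSpectrum

variable {α : ℝ} (Φ : FracSpectrum α) {f : ℝ → ℝ}

/-- The superposition operator on `H₀^{α/2}(Ω)`. -/
def nonlin (f : ℝ → ℝ) (w : L2Omega) : L2Omega := superpose f (Φ.B w)

/-- The potential of the superposition operator. -/
def potential (f : ℝ → ℝ) (w : L2Omega) : ℝ :=
  ∫ x in Omega, ∫ σ in (0 : ℝ)..(Φ.B w x), f σ

variable (hf : LipschitzOnBoundedSets α f)

include hf

theorem lipschitzOnBalls_nonlin : LipschitzOnBalls (Φ.nonlin f) := by
  intro R
  obtain ⟨L, hL⟩ := hf.2 R.toNNReal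
  refine ⟨L, L.2, fun x y hx hy => ?_⟩
  have hR {z : L2Omega} (hz : ‖z‖ ≤ R) : eH0Norm α (Φ.B z) ≤ R.toNNReal := by
    rw [Φ.eH0Norm_B, enorm_eq_nnnorm]
    exact_mod_cast NNReal.le_toNNReal_of_coe_le hz
  have h1 := hL (Φ.B x) (Φ.B y) (hR hx) (hR hy)
  rw [← map_sub, Φ.eH0Norm_B, enorm_eq_nnnorm, enorm_eq_nnnorm] at h1
  exact_mod_cast h1

theorem memLp_nonlin (w : L2Omega) :
    MemLp (fun x => f (Φ.B w x)) 2 (volume.restrict Omega) :=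
  hf.1 _ ((Φ.memH0_iff _).2 ⟨w, rfl⟩)

theorem nonlin_ae_eq (w : L2Omega) :
    Φ.nonlin f w =ᵐ[volume.restrict Omega] fun x => f (Φ.B w x) :=
  superpose_ae_eq (Φ.memLp_nonlin hf w)

theorem enorm_nonlin_sub_sq (v w : L2Omega) : ‖Φ.nonlin f v - Φ.nonlin f w‖ₑ ^ 2 =
    ∫⁻ x in Omega, ‖f (Φ.B v x) - f (Φ.B w x)‖ₑ ^ 2 := by
  rw [Lp.enorm_def, eLpNorm_two_sq]
  refine lintegral_congr_ae ?_
  filter_upwards [Lp.coeFn_sub (Φ.nonlin f v) (Φ.nonlin f w), Φ.nonlin_ae_eq hf v,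
    Φ.nonlin_ae_eq hf w] with x h1 h2 h3
  rw [h1, Pi.sub_apply, h2, h3]

/-- The nonlinearity is locally Lipschitz continuous. -/
theorem lipschitzOnBalls (Φ : FracSpectrum α) (hα₀ : 0 < α) (hα₂ : α < 2) : LipschitzOnBalls f := by
  intro R
  -- The multiples `c • η` equal the constant `c` on `(-1, 1)`, so the Lipschitz bound of the
  -- superposition operator on them is one for `f` itself. The support radius `2` fits in `Ω` as `π
  -- > 3`.
  set η : ContDiffBump (0 : ℝ) := ⟨1, 2, one_pos, one_lt_two⟩
  have hη : IsTestFunction η := by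
    refine ⟨η.contDiff, η.hasCompactSupport, ?_⟩
    rw [η.tsupport_eq, Real.closedBall_eq_Icc, Omega]
    have := Real.pi_gt_three
    exact Icc_subset_Ioo (by simp [η]; linarith) (by simp [η]; linarith)
  obtain ⟨v, hv⟩ := H0Space.exists_of_isTestFunction hα₀ hα₂ hη
  obtain ⟨w, hw⟩ := (Φ.memH0_iff (H0Space.incl α v)).1 ((H0Space.memH0_iff _).2 ⟨v, rfl⟩)
  have hw1 (c : ℝ) : ∀ᵐ x ∂volume.restrict Omega, x ∈ Ioo (-1) 1 → Φ.B (c • w) x = c := by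
    rw [map_smul, hw]
    filter_upwards [Lp.coeFn_smul c (H0Space.incl α v), ae_restrict_of_ae hv,
      ae_restrict_mem measurableSet_Omega] with x h1 h2 h3 h4
    rw [h1, Pi.smul_apply, ← zeroExt_of_mem _ h3, h2, η.one_of_mem_closedBall, smul_eq_mul,
      mul_one]
    rw [Real.closedBall_eq_Icc]
    simp only [η, zero_sub, zero_add]
    exact Ioo_subset_Icc_self h4
  obtain ⟨L, hL0, hL⟩ := Φ.lipschitzOnBalls_nonlin hf (|R| * ‖w‖)
  refine ⟨L * ‖w‖, by positivity, fun c d hc hd => ?_⟩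
  have hle {c : ℝ} (hc : ‖c‖ ≤ R) : ‖c • w‖ ≤ |R| * ‖w‖ := by
    rw [norm_smul]
    exact mul_le_mul_of_nonneg_right (hc.trans (le_abs_self R)) (norm_nonneg _)
  have h1 := hL (c • w) (d • w) (hle hc) (hle hd)
  rw [← sub_smul, norm_smul] at h1
  have h2 : ‖f c - f d‖ₑ ^ 2 ≤ ‖Φ.nonlin f (c • w) - Φ.nonlin f (d • w)‖ₑ ^ 2 := by
    rw [Φ.enorm_nonlin_sub_sq hf]
    have hsub : Ioo (-1 : ℝ) 1 ⊆ Omega := by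
      have := Real.pi_gt_three
      exact Ioo_subset_Ioo (by linarith) (by linarith)
    calc ‖f c - f d‖ₑ ^ 2 ≤ ‖f c - f d‖ₑ ^ 2 * volume (Ioo (-1 : ℝ) 1) := by
          refine le_mul_of_one_le_right zero_le ?_
          rw [Real.volume_Ioo]
          norm_num
      _ = ∫⁻ x in Ioo (-1 : ℝ) 1, ‖f c - f d‖ₑ ^ 2 := by rw [setLIntegral_const]
      _ = ∫⁻ x in Ioo (-1 : ℝ) 1, ‖f (Φ.B (c • w) x) - f (Φ.B (d • w) x)‖ₑ ^ 2 := by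
          refine lintegral_congr_ae ?_
          filter_upwards [ae_restrict_of_ae_restrict_of_subset hsub (hw1 c),
            ae_restrict_of_ae_restrict_of_subset hsub (hw1 d),
            ae_restrict_mem measurableSet_Ioo] with x h3 h4 h5
          rw [h3 h5, h4 h5]
      _ ≤ _ := lintegral_mono_set hsub
  have h3 : ‖f c - f d‖ ≤ ‖Φ.nonlin f (c • w) - Φ.nonlin f (d • w)‖ := by
    have h4 := (ENNReal.pow_le_pow_left_iff two_ne_zero).1 h2
    rw [enorm_eq_nnnorm, enorm_eq_nnnorm] at h4
    exact_mod_cast h4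
  linarith

theorem inner_nonlin (w v : L2Omega) :
    inner ℝ (Φ.nonlin f w) (Φ.B v) = ∫ x in Omega, f (Φ.B w x) * Φ.B v x := by
  rw [L2.inner_def]
  refine integral_congr_ae ?_
  filter_upwards [Φ.nonlin_ae_eq hf w] with x hx
  simp [hx, mul_comm]

theorem integrable_nonlin_mul (w v : L2Omega) :
    Integrable (fun x => f (Φ.B w x) * Φ.B v x) (volume.restrict Omega) :=
  (Φ.memLp_nonlin hf w).integrable_mul (Lp.memLp (Φ.B v))

omit hf in
theorem primitive_taylor (hc : Continuous f) (s δ : ℝ) :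
    (∫ σ in (0 : ℝ)..(s + δ), f σ) - (∫ σ in (0 : ℝ)..s, f σ) - f s * δ =
      ∫ θ in (0 : ℝ)..1, δ * (f (s + θ * δ) - f s) := by
  rw [intervalIntegral.integral_interval_sub_left (hc.intervalIntegrable _ _)
    (hc.intervalIntegrable _ _), intervalIntegral.integral_const_mul,
    intervalIntegral.integral_sub (Continuous.intervalIntegrable (by fun_prop) _ _)
    (Continuous.intervalIntegrable (by fun_prop) _ _), mul_sub,
    ← intervalIntegral.integral_const_mul]
  simp_rw [mul_comm _ δ]
  rw [intervalIntegral.integral_const_mul, intervalIntegral.mul_integral_comp_add_mul]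
  simp

theorem integrable_primitive (hc : Continuous f) {a b k : ℝ} (ha : 0 < a)
    (hF : ∀ s, a * s ^ 2 - b ≤ ∫ σ in (0 : ℝ)..s, f σ ∧
      ∫ σ in (0 : ℝ)..s, f σ ≤ k * (f s * s) + b ∧ a * s ^ 2 - b ≤ f s * s) (w : L2Omega) :
    Integrable (fun x => ∫ σ in (0 : ℝ)..(Φ.B w x), f σ) (volume.restrict Omega) := by
  have hfin : IsFiniteMeasure (volume.restrict Omega) := by rw [Omega]; infer_instance
  have hFc : Continuous fun s => ∫ σ in (0 : ℝ)..s, f σ :=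
    intervalIntegral.continuous_primitive (fun _ _ => hc.intervalIntegrable _ _) 0
  refine Integrable.mono' (((Φ.integrable_nonlin_mul hf w w).const_mul k).abs.add
    (integrable_const b)) (hFc.comp_aestronglyMeasurable (Lp.aestronglyMeasurable _))
    (ae_of_all _ fun x => ?_)
  obtain ⟨h1, h2, -⟩ := hF (Φ.B w x)
  have h3 := le_abs_self (k * (f (Φ.B w x) * Φ.B w x))
  have h4 := abs_nonneg (k * (f (Φ.B w x) * Φ.B w x))
  have h5 := mul_nonneg ha.le (sq_nonneg (Φ.B w x))
  rw [Real.norm_eq_abs, abs_le]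
  simp only [Pi.add_apply]
  constructor <;> linarith

/-- Taylor's formula for the primitive with integral remainder, an exchange of the integrals, and
Cauchy-Schwarz in `x` for each `θ`. The remainder is thus expressed by differences of the
superposition operator, whose Lipschitz continuity is a hypothesis, and no growth of the derivative
of `f` enters. -/
theorem enorm_potential_sub_le (hc : Continuous f)
    (hint : ∀ w, Integrable (fun x => ∫ σ in (0 : ℝ)..(Φ.B w x), f σ) (volume.restrict Omega))
    (w d : L2Omega) :
    ‖Φ.potential f (w + d) - Φ.potential f w - inner ℝ (Φ.nonlin f w) (Φ.B d)‖ₑ ≤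
      ∫⁻ θ in Ioc (0 : ℝ) 1, ‖Φ.B d‖ₑ * ‖Φ.nonlin f (w + θ • d) - Φ.nonlin f w‖ₑ := by
  have hadd (θ : ℝ) : ∀ᵐ x ∂volume.restrict Omega,
      Φ.B (w + θ • d) x = Φ.B w x + θ * Φ.B d x := by
    rw [map_add, map_smul]
    filter_upwards [Lp.coeFn_add (Φ.B w) (θ • Φ.B d), Lp.coeFn_smul θ (Φ.B d)] with x h1 h2
    rw [h1, Pi.add_apply, h2]; rfl
  rw [Φ.inner_nonlin hf, potential, potential, ← integral_sub (hint _) (hint _),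
    ← integral_sub (by exact (hint _).sub (hint _)) (Φ.integrable_nonlin_mul hf w d)]
  refine (enorm_integral_le_lintegral_enorm _).trans ?_
  have hmB (w : L2Omega) : Measurable (Φ.B w) := (Lp.stronglyMeasurable _).measurable
  calc _ ≤ ∫⁻ x in Omega, ∫⁻ θ in Ioc (0 : ℝ) 1,
        ‖Φ.B d x * (f (Φ.B w x + θ * Φ.B d x) - f (Φ.B w x))‖ₑ := by
        refine lintegral_mono_ae ?_
        filter_upwards [hadd 1] with x hx
        rw [one_smul, one_mul] at hx
        rw [hx, primitive_taylor hc, intervalIntegral.integral_of_le zero_le_one]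
        exact enorm_integral_le_lintegral_enorm _
    _ = ∫⁻ θ in Ioc (0 : ℝ) 1, ∫⁻ x in Omega,
        ‖Φ.B d x * (f (Φ.B w x + θ * Φ.B d x) - f (Φ.B w x))‖ₑ := by
        refine lintegral_lintegral_swap (Measurable.aemeasurable ?_)
        have h1 := hmB w
        have h2 := hmB d
        have h3 := hc.measurable
        unfold Function.uncurry
        fun_prop
    _ ≤ _ := by
        refine lintegral_mono fun θ => ?_
        have h1 : AEStronglyMeasurable (fun x => f (Φ.B w x + θ * Φ.B d x) - f (Φ.B w x))
            (volume.restrict Omega) := by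
          have h1 := hmB w
          have h2 := hmB d
          have h3 := hc.measurable
          exact Measurable.aestronglyMeasurable (by fun_prop)
        have h2 := eLpNorm_smul_le_mul_eLpNorm (p := 2) (q := 2) (r := 1) h1
          (Lp.aestronglyMeasurable (Φ.B d))
        rw [eLpNorm_one_eq_lintegral_enorm] at h2
        refine h2.trans (le_of_eq ?_)
        rw [Lp.enorm_def, Lp.enorm_def]
        congr 1
        refine eLpNorm_congr_ae ?_
        filter_upwards [hadd θ, Lp.coeFn_sub (Φ.nonlin f (w + θ • d)) (Φ.nonlin f w),
          Φ.nonlin_ae_eq hf (w + θ • d), Φ.nonlin_ae_eq hf w] with x h3 h4 h5 h6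
        rw [h4, Pi.sub_apply, h5, h6, h3]

theorem hasFDerivAt_potential (hc : Continuous f)
    (hint : ∀ w, Integrable (fun x => ∫ σ in (0 : ℝ)..(Φ.B w x), f σ) (volume.restrict Omega))
    (w : L2Omega) :
    HasFDerivAt (Φ.potential f) ((innerSL ℝ (Φ.nonlin f w)).comp Φ.B) w := by
  obtain ⟨L, hL0, hL⟩ := Φ.lipschitzOnBalls_nonlin hf (‖w‖ + 1)
  refine HasFDerivAt.of_isLittleO (Asymptotics.IsBigO.trans_isLittleO
    (Asymptotics.IsBigO.of_bound L ?_) (Asymptotics.isLittleO_pow_sub_sub w one_lt_two))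
  filter_upwards [Metric.ball_mem_nhds w one_pos] with v hv
  rw [Metric.mem_ball, dist_eq_norm] at hv
  have h1 := Φ.enorm_potential_sub_le hf hc hint w (v - w)
  rw [add_sub_cancel] at h1
  have h2 : ∫⁻ θ in Ioc (0 : ℝ) 1,
      ‖Φ.B (v - w)‖ₑ * ‖Φ.nonlin f (w + θ • (v - w)) - Φ.nonlin f w‖ₑ ≤
      ENNReal.ofReal (L * ‖v - w‖ ^ 2) := by
    calc _ ≤ ∫⁻ θ in Ioc (0 : ℝ) 1, ENNReal.ofReal (L * ‖v - w‖ ^ 2) := by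
          refine setLIntegral_mono measurable_const fun θ hθ => ?_
          have h3 : ‖θ • (v - w)‖ ≤ ‖v - w‖ := by
            rw [norm_smul, Real.norm_of_nonneg hθ.1.le]
            exact mul_le_of_le_one_left (norm_nonneg _) hθ.2
          have h4 := hL (w + θ • (v - w)) w ((norm_add_le _ _).trans (by linarith)) (by linarith)
          rw [add_sub_cancel_left] at h4
          rw [← ofReal_norm, ← ofReal_norm, ← ENNReal.ofReal_mul (norm_nonneg _)]
          refine ENNReal.ofReal_le_ofReal ?_
          have h5 := mul_le_mul (Φ.norm_B_le (v - w)) (h4.trans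
            (mul_le_mul_of_nonneg_left h3 hL0)) (norm_nonneg _) (norm_nonneg _)
          linarith
      _ = _ := by simp
  have h3 := h1.trans h2
  rw [← ofReal_norm, ENNReal.ofReal_le_ofReal_iff (by positivity)] at h3
  simpa using h3

/-- The superposition operator is of potential type. -/
theorem exists_isPotential (hα₀ : 0 < α) (hα₂ : α < 2) (hg : GrowthCondition f) :
    ∃ a b k, Φ.IsPotential (Φ.nonlin f) (Φ.potential f) a b k := by
  have hc : Continuous f := (Φ.lipschitzOnBalls hf hα₀ hα₂).continuous
  obtain ⟨a, b, k, ha, hk, hF⟩ := hg.exists_bounds hc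
  have hint := Φ.integrable_primitive hf hc ha hF
  have hfin : IsFiniteMeasure (volume.restrict Omega) := by rw [Omega]; infer_instance
  set m := (volume.restrict Omega).real univ with hm
  have hsq (w : L2Omega) : Integrable (fun x => a * Φ.B w x ^ 2 - b) (volume.restrict Omega) :=
    ((Lp.memLp (Φ.B w)).integrable_sq.const_mul a).sub (integrable_const b)
  have hsqi (w : L2Omega) : ∫ x in Omega, (a * Φ.B w x ^ 2 - b) = a * ‖Φ.B w‖ ^ 2 - m * b := by
    rw [integral_sub ((Lp.memLp (Φ.B w)).integrable_sq.const_mul a) (integrable_const b),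
      integral_const_mul, integral_const, smul_eq_mul, ← real_inner_self_eq_norm_sq, L2.inner_def]
    simp [sq, hm]
  refine ⟨a, m * b, k, Φ.lipschitzOnBalls_nonlin hf, Φ.hasFDerivAt_potential hf hc hint, ha,
    hk, fun w => ?_, fun w => ?_, fun w => ?_⟩
  · rw [← hsqi]
    exact integral_mono (hsq w) (hint w) fun x => (hF _).1
  · have h1 := Φ.integrable_nonlin_mul hf w w
    rw [Φ.inner_nonlin hf, ← integral_const_mul, ← smul_eq_mul m b, hm, ← integral_const,
      ← integral_add (h1.const_mul k) (integrable_const b)]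
    exact integral_mono (hint w) ((h1.const_mul k).add (integrable_const b)) fun x => (hF _).2.1
  · rw [← hsqi, Φ.inner_nonlin hf]
    exact integral_mono (hsq w) (Φ.integrable_nonlin_mul hf w w) fun x => (hF _).2.2

end FracSpectrum

end

/-! ### Translation between solutions and their representatives, and the theorem. -/

noncomputable section

theorem IsSolutionOn.mono {α : ℝ} {f : ℝ → ℝ} {g u₀ : L2Omega} {I I' : Set ℝ} {u : ℝ → L2Omega}
    (h : IsSolutionOn α f g u₀ I u) (hI : I' ⊆ I) : IsSolutionOn α f g u₀ I' u where
  mem t ht := h.mem t (hI ht)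
  continuousOn t ht := (h.continuousOn t (hI ht)).mono_left (nhdsWithin_mono t hI)
  duhamel := by
    obtain ⟨S, hS, hd⟩ := h.duhamel
    exact ⟨S, hS, fun t ht => hd t (hI ht)⟩

namespace FracSpectrum

variable {α : ℝ} (Φ : FracSpectrum α) {f : ℝ → ℝ} {g w₀ : L2Omega} {w : ℝ → L2Omega}

theorem sqrt_mul_inner_B (w : L2Omega) (i : Φ.ι) :
    √(Φ.ν i) * inner ℝ (Φ.e i) (Φ.B w) = inner ℝ (Φ.e i) w := by
  rw [Φ.inner_B, mul_inv_cancel_left₀ (Φ.sqrt_ν_pos i).ne']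

/-- The coefficients of `w` are `√(ν i)` times those of `B w`; multiplying the coefficients of the
variation of constants formula by this factor gives `coeff`. -/
theorem duhamel_iff (hf : LipschitzOnBoundedSets α f) (hw : Continuous w) {t : ℝ} (ht : 0 ≤ t) :
    Φ.B (w t) = Φ.heat t (Φ.B w₀) -
        ∫ s in (0 : ℝ)..t, Φ.heat (t - s) (superpose f (Φ.B (w s)) - g) ↔
      ∀ i, inner ℝ (Φ.e i) (w t) = Φ.coeff w₀ (fun s => g - Φ.nonlin f (w s)) i t := by
  have hc : Continuous fun s => superpose f (Φ.B (w s)) - g :=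
    ((Φ.lipschitzOnBalls_nonlin hf).continuous.comp hw).sub continuous_const
  have h (i) : √(Φ.ν i) * inner ℝ (Φ.e i) (Φ.heat t (Φ.B w₀) -
      ∫ s in (0 : ℝ)..t, Φ.heat (t - s) (superpose f (Φ.B (w s)) - g)) =
      Φ.coeff w₀ (fun s => g - Φ.nonlin f (w s)) i t := by
    rw [inner_sub_right, Φ.inner_heat ht, Φ.inner_duhamel ht hc.continuousOn, mul_sub,
      mul_left_comm, Φ.sqrt_mul_inner_B, coeff, sub_eq_add_neg _ (√(Φ.ν i) * _),
      ← mul_neg (√(Φ.ν i)), ← intervalIntegral.integral_neg]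
    congr 3 with s
    rw [← mul_neg, ← inner_neg_right, neg_sub]
    rfl
  constructor
  · intro heq i
    rw [← h i, ← heq, Φ.sqrt_mul_inner_B]
  · intro hi
    refine Φ.e.ext_inner fun i => mul_left_cancel₀ (Φ.sqrt_ν_pos i).ne' ?_
    rw [h i, Φ.sqrt_mul_inner_B, hi i]

theorem isSolutionOn_of_isMild (hf : LipschitzOnBoundedSets α f)
    (h : ∀ T, Φ.IsMild (fun w => g - Φ.nonlin f w) w₀ T w) :
    IsSolutionOn α f g (Φ.B w₀) (Ici 0) fun t => Φ.B (w t) where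
  mem t _ := (Φ.memH0_iff _).2 ⟨_, rfl⟩
  continuousOn t _ := by
    simp only [← map_sub, Φ.eH0Norm_B]
    have h1 : Continuous fun s => ‖w s - w t‖ₑ := by
      have := (h 0).continuous
      fun_prop
    have h2 := h1.tendsto t
    simp only [sub_self, enorm_zero] at h2
    exact h2.mono_left nhdsWithin_le_nhds
  duhamel := ⟨Φ.heat, Φ.isFracHeatSemigroup_heat, fun t ht =>
    (Φ.duhamel_iff hf (h t).continuous ht).2 ((h t).inner_eq t (right_mem_Icc.2 ht))⟩

theorem exists_isMild_of_isSolutionOn (hf : LipschitzOnBoundedSets α f) {T : ℝ} (hT : 0 ≤ T)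
    {u : ℝ → L2Omega} (h : IsSolutionOn α f g (Φ.B w₀) (Icc 0 T) u) :
    ∃ w, Φ.IsMild (fun w => g - Φ.nonlin f w) w₀ T w ∧ ∀ t ∈ Icc 0 T, Φ.B (w t) = u t := by
  have hex (t : ℝ) : ∃ x, t ∈ Icc 0 T → Φ.B x = u t := by
    by_cases ht : t ∈ Icc 0 T
    · obtain ⟨x, hx⟩ := (Φ.memH0_iff _).1 (h.mem t ht)
      exact ⟨x, fun _ => hx⟩
    · exact ⟨0, fun h => absurd h ht⟩
  choose y hy using hex
  have hyc : ContinuousOn y (Icc 0 T) := by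
    intro t ht
    rw [ContinuousWithinAt, tendsto_iff_edist_tendsto_0]
    refine (h.continuousOn t ht).congr' ?_
    filter_upwards [self_mem_nhdsWithin] with s hs
    rw [edist_eq_enorm_sub, ← Φ.eH0Norm_B, map_sub, hy s hs, hy t ht]
  have hproj (t : ℝ) : max 0 (min T t) ∈ Icc 0 T :=
    ⟨le_max_left _ _, max_le hT (min_le_left _ _)⟩
  -- The representative is continuous only on `[0, T]`; it is frozen outside, because `IsMild` asks
  -- for continuity on the line.
  set w : ℝ → L2Omega := fun t => y (max 0 (min T t)) with hw
  have hwc : Continuous w := hyc.comp_continuous (by fun_prop) hproj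
  have hwu : ∀ t ∈ Icc 0 T, Φ.B (w t) = u t := fun t ht => by
    simp only [hw]
    rw [min_eq_right ht.2, max_eq_right ht.1, hy t ht]
  refine ⟨w, ⟨hwc, fun t ht => (Φ.duhamel_iff hf hwc ht.1).1 ?_⟩, hwu⟩
  obtain ⟨S, hS, hd⟩ := h.duhamel
  rw [hwu t ht, hd t ht, Φ.semigroup_eq_heat hS ht.1]
  congr 1
  refine intervalIntegral.integral_congr fun s hs => ?_
  rw [uIcc_of_le ht.1] at hs
  simp only [hwu s ⟨hs.1, hs.2.trans ht.2⟩, Φ.semigroup_eq_heat hS (sub_nonneg.2 hs.2)]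

theorem eH0Norm_B_le_iff (w : L2Omega) (M : ℝ≥0) : eH0Norm α (Φ.B w) ≤ M ↔ ‖w‖ ≤ M := by
  rw [Φ.eH0Norm_B, enorm_eq_nnnorm, ENNReal.coe_le_coe, ← NNReal.coe_le_coe, coe_nnnorm]

theorem exists_B_eq {u : L2Omega} {M : ℝ≥0} (hu : eH0Norm α u ≤ M) :
    ∃ w, Φ.B w = u ∧ ‖w‖ ≤ M := by
  obtain ⟨w, rfl⟩ := (Φ.memH0_iff u).1 (hu.trans_lt ENNReal.coe_lt_top)
  exact ⟨w, rfl, (Φ.eH0Norm_B_le_iff w M).1 hu⟩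

end FracSpectrum

end

theorem theorem4p3 (α : ℝ) (hα₀ : 0 < α) (hα₂ : α < 2) (f : ℝ → ℝ)
    (hf : LipschitzOnBoundedSets α f) (hgrowth : GrowthCondition f) (g : L2Omega) :
    -- global existence, and uniqueness on every time interval
    (∀ u₀ : L2Omega, MemH0 α u₀ → ∃ u : ℝ → L2Omega,
      IsSolutionOn α f g u₀ (Ici 0) u ∧
      ∀ T : ℝ, 0 < T → ∀ v : ℝ → L2Omega, IsSolutionOn α f g u₀ (Icc 0 T) v →
        ∀ t ∈ Icc 0 T, v t = u t) ∧
    -- bounds uniform in time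
    (∀ M : ℝ≥0, ∃ K : ℝ≥0, ∀ (u₀ : L2Omega) (u : ℝ → L2Omega), eH0Norm α u₀ ≤ M →
      IsSolutionOn α f g u₀ (Ici 0) u → ∀ t : ℝ, 0 ≤ t → eH0Norm α (u t) ≤ K) ∧
    -- a bounded absorbing set
    (∃ R : ℝ≥0, ∀ M : ℝ≥0, ∃ t₀ : ℝ, 0 ≤ t₀ ∧ ∀ (u₀ : L2Omega) (u : ℝ → L2Omega),
      eH0Norm α u₀ ≤ M → IsSolutionOn α f g u₀ (Ici 0) u →
        ∀ t : ℝ, t₀ ≤ t → eH0Norm α (u t) ≤ R) := by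
  obtain ⟨Φ⟩ := nonempty_fracSpectrum hα₀ hα₂
  obtain ⟨a, b, k, P⟩ := Φ.exists_isPotential hf hα₀ hα₂ hgrowth
  refine ⟨fun u₀ hu₀ => ?_, fun M => ?_, ?_⟩
  · obtain ⟨w₀, rfl⟩ := (Φ.memH0_iff u₀).1 hu₀
    obtain ⟨w, hw⟩ := P.exists_isMild g w₀
    refine ⟨fun t => Φ.B (w t), Φ.isSolutionOn_of_isMild hf hw, fun T hT v hv t ht => ?_⟩
    obtain ⟨y, hy, hyv⟩ := Φ.exists_isMild_of_isSolutionOn hf hT.le hv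
    rw [← hyv t ht, hy.unique (P.lipschitzOnBalls_source g) (hw T) t ht]
  · obtain ⟨K, hMK, hK⟩ := P.exists_norm_le g M
    refine ⟨K.toNNReal, fun u₀ u hu₀ hu t ht => ?_⟩
    obtain ⟨w₀, rfl, hw₀⟩ := Φ.exists_B_eq hu₀
    -- Representatives are available on compact intervals, so the solution is restricted to `[0,
    -- t]`; the constant `K` does not depend on the length.
    obtain ⟨w, hw, hwu⟩ := Φ.exists_isMild_of_isSolutionOn hf ht (hu.mono Icc_subset_Ici_self)
    have htt := right_mem_Icc.2 ht
    rw [← hwu t htt, Φ.eH0Norm_B_le_iff]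
    exact (hK w₀ t w hw₀ hw t htt).trans (Real.le_coe_toNNReal K)
  · obtain ⟨R, hR⟩ := P.exists_absorbing g
    refine ⟨R.toNNReal, fun M => ?_⟩
    obtain ⟨t₀, ht₀, h⟩ := hR M
    refine ⟨t₀, ht₀, fun u₀ u hu₀ hu t ht => ?_⟩
    obtain ⟨w₀, rfl, hw₀⟩ := Φ.exists_B_eq hu₀
    have ht' := ht₀.trans ht
    obtain ⟨w, hw, hwu⟩ := Φ.exists_isMild_of_isSolutionOn hf ht' (hu.mono Icc_subset_Ici_self)
    rw [← hwu t (right_mem_Icc.2 ht'), Φ.eH0Norm_B_le_iff]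
    exact (h w₀ t w hw₀ hw t ⟨ht, le_rfl⟩).trans (Real.le_coe_toNNReal R)
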